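/- Proposition 4.5. Let $k$ be a field, let $n\ge 1$ and $d\ge 3$ be integers, and let $\mathbb P=\mathbb P^n_k$. Let $i:\mathbb P\hookrightarrow\tilde{\mathbb P}$ be the Veronese embedding of degree $d$, where $\tilde{\mathbb P}$ is the projective space of dimension $\binom{n+d}{d}-1$ whose dual $\tilde{\mathbb P}^\vee$ parametrizes the hypersurfaces of degree $d$ in $\mathbb P$. A closed subset of the cotangent bundle $T^*\mathbb P$ is called conical if it is $\mathbb G_m$-invariant. For a closed conical $C\subset T^*\mathbb P$ let $i_\circ C\subset T^*\tilde{\mathbb P}$ be the set of covectors at points $i(x)$, $x\in\mathbb P$, whose pullback by $di$ to $T^*_x\mathbb P$ lies in $C$. Let $P(i_\circ C)\subset P(T^*\tilde{\mathbb P})$ be its projectivization, where $P(T^*\tilde{\mathbb P})$ is identified with the incidence variety in $\tilde{\mathbb P}\times\tilde{\mathbb P}^\vee$ by sending the line spanned by a nonzero covector at a point to that point together with the hyperplane through it that the covector annihilates. Let $D_C\subset\tilde{\mathbb P}^\vee$ be the image of $P(i_\circ C)$ under the projection to $\tilde{\mathbb P}^\vee$. (i) Let $C\subset T^*\mathbb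 P$ be a closed conical irreducible subset with $\dim C\le n$. Then the projection $P(i_\circ C)\to D_C$ is small, that is, $Z:=P(i_\circ C)$ is irreducible, $Z\to D_C$ is generically surjective, and $\dim\bigl(Z\times_{D_C}Z\smallsetminus\Delta(Z)\bigr)<\dim Z$, where $\Delta$ is the diagonal embedding. Hence it is generically radicial, that is, over some dense open subset of $D_C$ it is injective on geometric points. (ii) Let $C\subset T^*\mathbb P$ be any closed conical subset with $\dim C\le n$. If $C_\gamma$ is an irreducible component of $C$, then $D_{C_\gamma}$ is an irreducible component of $D_C$, and $C_\gamma\mapsto D_{C_\gamma}$ is a bijection from the set of irreducible components of $C$ onto the set of irreducible components of $D_C$. -/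

import Mathlib

open scoped LinearAlgebra.Projectivization

/-!
Conventions.  `k` is the base field and `K` an algebraically closed extension of `k`.  A variety
over `k` is described by its set of `K`-points together with its `k`-Zariski topology, whose
closed sets are the sets of `K`-points of the closed subschemes (defined over `k`).  By the
Nullstellensatz, taking `K`-points identifies the lattice of closed subsets of a `k`-scheme of
finite type with the lattice of closed sets of this topology, so that closedness,
irreducibility, irreducible components and (Krull) dimension are those of the scheme over `k`;
it also commutes with images and with fibre products.
-/

namespace VeroneseRadon

universe u v w

section Zariski

/-- The `k`-Zariski topology on the affine space `σ → K`: the closed sets are the sets of common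
zeros in `K` of the ideals of the polynomial ring over `k`. -/
@[reducible]
def affineZariski (k : Type v) {K : Type u} [Field k] [Field K] [Algebra k K] (σ : Type) :
    TopologicalSpace (σ → K) :=
  TopologicalSpace.ofClosed
    (Set.range (MvPolynomial.zeroLocus (k := k) (σ := σ) K))
    ⟨⊤, by simp⟩
    (by
      intro A hA
      refine ⟨sSup {I | MvPolynomial.zeroLocus K I ∈ A}, ?_⟩
      ext x
      rw [Set.mem_sInter]
      constructor
      · intro hx s hs
        obtain ⟨I, rfl⟩ := hA hs
        exact MvPolynomial.zeroLocus_anti_mono (le_sSup hs) hx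
      · intro hx
        have h : sSup {I | MvPolynomial.zeroLocus K I ∈ A} ≤
            MvPolynomial.vanishingIdeal k {x} := by
          refine sSup_le fun I hI p hp => ?_
          rw [MvPolynomial.mem_vanishingIdeal_singleton_iff]
          exact hx _ hI p hp
        intro p hp
        exact (MvPolynomial.mem_vanishingIdeal_singleton_iff x p).1 (h hp))
    (by
      rintro _ ⟨I, rfl⟩ _ ⟨J, rfl⟩
      refine ⟨I * J, ?_⟩
      ext x
      constructor
      · intro hx
        by_contra hcon
        rw [Set.mem_union, not_or] at hcon
        simp only [MvPolynomial.mem_zeroLocus_iff, not_forall] at hcon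
        obtain ⟨⟨p, hp, hpx⟩, ⟨q, hq, hqx⟩⟩ := hcon
        have := hx (p * q) (Ideal.mul_mem_mul hp hq)
        rw [map_mul] at this
        exact (mul_ne_zero hpx hqx) this
      · rintro (hx | hx)
        · exact MvPolynomial.zeroLocus_anti_mono Ideal.mul_le_left hx
        · exact MvPolynomial.zeroLocus_anti_mono Ideal.mul_le_right hx)

/-- A parametrization of the points of a space `X` by a set `Dom` of coordinate vectors
(an atlas by homogeneous coordinates).  Only the instances below are used: projective spaces,
cotangent bundles of projective spaces, and products of these. -/
class CoordSpace (K : outParam (Type u)) (X : Type w) where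
  /-- the index type of the coordinates -/
  Idx : Type
  /-- the admissible coordinate vectors -/
  Dom : Type u
  /-- the coordinates themselves -/
  coord : Dom → Idx → K
  /-- the point with given coordinates -/
  pt : Dom → X

/-- Homogeneous coordinates on a projective space: nonzero vectors. -/
instance instCoordProj {K : Type u} [Field K] (σ : Type) : CoordSpace K (ℙ K (σ → K)) where
  Idx := σ
  Dom := {v : σ → K // v ≠ 0}
  coord v := v.1
  pt v := Projectivization.mk K v.1 v.2

/-- Coordinates on a product of varieties. -/
instance instCoordProd {K : Type u} {X : Type w} {Y : Type v} [CoordSpace K X]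
    [CoordSpace K Y] : CoordSpace K (X × Y) where
  Idx := CoordSpace.Idx X ⊕ CoordSpace.Idx Y
  Dom := CoordSpace.Dom X × CoordSpace.Dom Y
  coord p := Sum.elim (CoordSpace.coord p.1) (CoordSpace.coord p.2)
  pt p := (CoordSpace.pt p.1, CoordSpace.pt p.2)

variable (k : Type v) {K : Type u} [Field k] [Field K] [Algebra k K]
variable {X : Type w} [CoordSpace K X]

/-- The `k`-Zariski topology: the quotient topology of the `k`-Zariski topology on coordinate
vectors.  (On a product of varieties this is the topology of the product variety, not the
product topology.) -/
@[reducible]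
def zariski : TopologicalSpace X :=
  TopologicalSpace.coinduced (CoordSpace.pt : CoordSpace.Dom X → X)
    (TopologicalSpace.induced CoordSpace.coord (affineZariski k (CoordSpace.Idx X)))

/-- Closed subsets of the variety `X` over `k`. -/
def ZClosed (Z : Set X) : Prop := @IsClosed X (zariski k) Z

/-- Open subsets of the variety `X` over `k`. -/
def ZOpen (Z : Set X) : Prop := @IsOpen X (zariski k) Z

/-- Closure in the variety `X` over `k`. -/
def zclosure (Z : Set X) : Set X := @closure X (zariski k) Z

/-- Irreducible (in particular nonempty) subsets of the variety `X` over `k`. -/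
def ZIrreducible (Z : Set X) : Prop := @IsIrreducible X (zariski k) Z

/-- The Krull dimension of a subset of the variety `X` over `k`; it is `⊥` for the empty set. -/
noncomputable def zdim (Z : Set X) : WithBot ℕ∞ :=
  @topologicalKrullDim Z (TopologicalSpace.induced Subtype.val (zariski k))

/-- The set of irreducible components of a subset of the variety `X` over `k`. -/
def zcomponents (Z : Set X) : Set (Set X) := {Y | Maximal (fun S => S ⊆ Z ∧ ZIrreducible k S) Y}

variable {Y : Type*} [CoordSpace K Y]

/-- The map `Z → T` induced by `π` is small: `Z` is irreducible, `Z → T` is dominant, and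
`dim (Z ×_T Z ∖ Δ(Z)) < dim Z`. -/
def IsSmall (π : X → Y) (Z : Set X) (T : Set Y) : Prop :=
  ZIrreducible k Z ∧ Set.MapsTo π Z T ∧ T ⊆ zclosure k (π '' Z) ∧
    zdim k {p : X × X | p.1 ∈ Z ∧ p.2 ∈ Z ∧ π p.1 = π p.2 ∧ p.1 ≠ p.2} < zdim k Z

/-- The map `Z → T` induced by `π` is generically radicial: over a dense open subset of `T` it is
injective on geometric points. -/
def GenericallyRadicial (π : X → Y) (Z : Set X) (T : Set Y) : Prop :=
  Set.MapsTo π Z T ∧ ∃ U : Set Y, ZOpen k U ∧ T ⊆ zclosure k (U ∩ T) ∧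
    Set.InjOn π (Z ∩ π ⁻¹' U)

end Zariski

section Cotangent

variable {K : Type u} [Field K]

/-- Pairs `(v, ξ)` of a nonzero vector `v` and a linear functional `ξ` with `ξ(v) = 0`. -/
def CotangentPair (K : Type u) [Field K] (σ : Type) [Fintype σ] : Type u :=
  {p : (σ → K) × (σ → K) // p.1 ≠ 0 ∧ p.1 ⬝ᵥ p.2 = 0}

/-- `(v, ξ)` and `(t v, t⁻¹ ξ)` describe the same cotangent vector. -/
instance cotangentSetoid (K : Type u) [Field K] (σ : Type) [Fintype σ] :
    Setoid (CotangentPair K σ) where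
  r p q := ∃ t : Kˣ, q.1.1 = (t : K) • p.1.1 ∧ q.1.2 = ((t⁻¹ : Kˣ) : K) • p.1.2
  iseqv :=
    { refl := fun p => ⟨1, by simp, by simp⟩
      symm := by
        rintro p q ⟨t, h1, h2⟩
        exact ⟨t⁻¹, by rw [h1, smul_smul]; simp, by rw [h2, smul_smul]; simp⟩
      trans := by
        rintro p q r ⟨t, h1, h2⟩ ⟨s, h3, h4⟩
        refine ⟨s * t, by rw [h3, h1, smul_smul, Units.val_mul], ?_⟩
        rw [h4, h2, smul_smul, mul_inv, Units.val_mul] }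

/-- The points of the cotangent bundle `T^* ℙ(V)`, `V = K^σ`.  The class of `(v, ξ)` is the
cotangent vector at the point `[v]` whose pullback along `V ∖ 0 → ℙ(V)` is, at the vector `v`,
the functional `ξ`; in other words it is the functional `φ ↦ ξ(φ(v))` on the tangent space
`T_[v] ℙ(V) = Hom(⟨v⟩, V/⟨v⟩)`. -/
def Cotangent (K : Type u) [Field K] (σ : Type) [Fintype σ] : Type u :=
  Quotient (cotangentSetoid K σ)

/-- The cotangent vector at `[v]` given by `ξ`. -/
def Cotangent.mk {σ : Type} [Fintype σ] (v ξ : σ → K) (hv : v ≠ 0) (h : v ⬝ᵥ ξ = 0) :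
    Cotangent K σ :=
  Quotient.mk (cotangentSetoid K σ) ⟨(v, ξ), hv, h⟩

instance instCoordCotangent (σ : Type) [Fintype σ] : CoordSpace K (Cotangent K σ) where
  Idx := σ ⊕ σ
  Dom := CotangentPair K σ
  coord p := Sum.elim p.1.1 p.1.2
  pt p := Quotient.mk (cotangentSetoid K σ) p

/-- A set of cotangent vectors is conical if it is invariant under the scaling action of the
multiplicative group on the fibres. -/
def IsConical {σ : Type} [Fintype σ] (C : Set (Cotangent K σ)) : Prop :=
  ∀ (v ξ : σ → K) (hv : v ≠ 0) (h : v ⬝ᵥ ξ = 0) (c : K), c ≠ 0 → Cotangent.mk v ξ hv h ∈ C →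
    Cotangent.mk v (c • ξ) hv (by rw [dotProduct_smul, h, smul_zero]) ∈ C

/-- The projectivization `P(C)` of a conical set of cotangent vectors, as a subset of
`P(T^* ℙ(V))`.  The latter is identified with the incidence variety in `ℙ(V) × ℙ(V^∨)`: the line
spanned by a nonzero cotangent vector `(w, η)` goes to `([w], [η])`, the point `[w]` together with
the hyperplane `η = 0` through it. -/
def projectivize {σ : Type} [Fintype σ] (C : Set (Cotangent K σ)) :
    Set (ℙ K (σ → K) × ℙ K (σ → K)) :=
  {z | ∃ (w η : σ → K) (hw : w ≠ 0) (hη : η ≠ 0) (h : w ⬝ᵥ η = 0),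
    z = (Projectivization.mk K w hw, Projectivization.mk K η hη) ∧ Cotangent.mk w η hw h ∈ C}

end Cotangent

section Veronese

/-- Exponents of the monomials of degree `d` in `n + 1` variables. -/
abbrev Mon (n d : ℕ) : Type :=
  {m : Fin (n + 1) → ℕ // m ∈ Finset.piAntidiag (Finset.univ : Finset (Fin (n + 1))) d}

variable {K : Type u} [Field K] {n : ℕ}

/-- The monomial with given exponents. -/
noncomputable def mono (K : Type u) [Field K] {n d : ℕ} (m : Mon n d) :
    MvPolynomial (Fin (n + 1)) K :=
  ∏ i, MvPolynomial.X i ^ m.1 i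

/-- The Veronese map of degree `d` on vectors, `v ↦ (v^m)_m` with `m` running over the monomials
of degree `d`.  The target is the dual of the space of forms of degree `d`: the functional `η`
on the target corresponds to the form `∑ η_m x^m`. -/
noncomputable def veronese (d : ℕ) (v : Fin (n + 1) → K) : Mon n d → K :=
  fun m => MvPolynomial.eval v (mono K m)

/-- The Jacobian matrix of the Veronese map at `v`. -/
noncomputable def veroneseJacobian (d : ℕ) (v : Fin (n + 1) → K) :
    Matrix (Mon n d) (Fin (n + 1)) K :=
  fun m i => MvPolynomial.eval v (MvPolynomial.pderiv i (mono K m))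

theorem mono_isHomogeneous {d : ℕ} (m : Mon n d) : (mono K m).IsHomogeneous d := by
  have h : (mono K m).IsHomogeneous (∑ i, m.1 i) :=
    MvPolynomial.IsHomogeneous.prod _ _ _ fun i _ => by
      simpa using (MvPolynomial.isHomogeneous_X K i).pow (m.1 i)
  have hm := (Finset.mem_piAntidiag.1 m.2).1
  rwa [hm] at h

theorem veronese_ne_zero (d : ℕ) {v : Fin (n + 1) → K} (hv : v ≠ 0) : veronese d v ≠ 0 := by
  obtain ⟨i, hi⟩ := Function.ne_iff.1 hv
  refine Function.ne_iff.2 ⟨⟨Pi.single i d, ?_⟩, ?_⟩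
  · simp [Finset.mem_piAntidiag]
  · simp only [veronese, mono, map_prod, map_pow, MvPolynomial.eval_X]
    rw [Pi.zero_apply, Finset.prod_ne_zero_iff]
    intro j _
    by_cases hj : j = i
    · subst hj
      simpa using pow_ne_zero d hi
    · simp [Pi.single_eq_of_ne hj]

theorem veronese_pullback (d : ℕ) {v : Fin (n + 1) → K} {η : Mon n d → K}
    (h : veronese d v ⬝ᵥ η = 0) : v ⬝ᵥ Matrix.vecMul η (veroneseJacobian d v) = 0 := by
  have hJ : Matrix.mulVec (veroneseJacobian d v) v = (d : K) • veronese d v := by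
    ext m
    have := congrArg (MvPolynomial.eval v) (mono_isHomogeneous (K := K) m).sum_X_mul_pderiv
    simp only [map_sum, map_mul, MvPolynomial.eval_X, map_nsmul] at this
    simp only [Matrix.mulVec, dotProduct, veroneseJacobian, Pi.smul_apply, veronese, smul_eq_mul]
    rw [← nsmul_eq_mul, ← this]
    exact Finset.sum_congr rfl fun i _ => mul_comm _ _
  rw [dotProduct_comm, ← Matrix.dotProduct_mulVec, hJ, dotProduct_smul, dotProduct_comm, h,
    smul_zero]

/-- `i_∘ C` for the Veronese embedding `i` of degree `d` and a set `C` of cotangent vectors to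
`ℙ^n`: the cotangent vectors `η` to the target at the points `i([v])` whose pullback
`η ∘ d i` is in `C`. -/
def veronesePush (d : ℕ) (C : Set (Cotangent K (Fin (n + 1)))) : Set (Cotangent K (Mon n d)) :=
  {α | ∃ (v : Fin (n + 1) → K) (hv : v ≠ 0) (η : Mon n d → K) (h : veronese d v ⬝ᵥ η = 0),
    α = Cotangent.mk (veronese d v) η (veronese_ne_zero d hv) h ∧
    Cotangent.mk v (Matrix.vecMul η (veroneseJacobian d v)) hv (veronese_pullback d h) ∈ C}

/-- `P(i_∘ C)`, a subset of the incidence variety. -/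
def conormalLift (d : ℕ) (C : Set (Cotangent K (Fin (n + 1)))) :
    Set (ℙ K (Mon n d → K) × ℙ K (Mon n d → K)) :=
  projectivize (veronesePush d C)

/-- `D_C`: the image of `P(i_∘ C)` in the dual projective space, whose points are the
hypersurfaces of degree `d` in `ℙ^n`. -/
def dualImage (d : ℕ) (C : Set (Cotangent K (Fin (n + 1)))) : Set (ℙ K (Mon n d → K)) :=
  Prod.snd '' conormalLift d C

end Veronese

end VeroneseRadon

/-!
Work with points over field extensions of `k` in the sense of Weil: a point of the lift
`Z_C = P(i_∘ C)` is a pair of a vector `v` and a form `F` of degree `d`, each up to scalars, with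
`F(v) = 0` and `(v, ∇F(v))` in the cone over `C`.  The dimension of an irreducible set is the
transcendence degree of its generic point in normalized coordinates.

Over a fixed `(v, ξ)` in the cone, the conditions `F(v) = 0`, `∇F(v) = ξ` are `n + 1` independent
linear conditions on `F`, solved explicitly by `adjustForm`; hence `Z_C` is irreducible if `C` is
(`zirreducible_conormalLift`) and has a point of transcendence degree at least
`dim C + N - (n + 1) - 1`, where `N` is the number of monomials (`exists_lift_point`).  For
`d ≥ 3` the values and gradients of `F` at two distinct points of projective space can be
prescribed independently (`twoPoint_surjective`): if a linear form `ℓ` vanishes at one of the two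
points only, then `ℓ ^ (d - 1) * μ` vanishes to second order there and has arbitrary first order
behaviour at the other point.  So pairs of distinct points of `Z_C₁` and `Z_C₂` with the same
image `[F]` depend on at most `dim C₁ + dim C₂ + N - 2 (n + 1) - 1` parameters
(`td_incidence_le`), which is smaller than `dim Z_C₁` because `dim C₂ ≤ n`.

With `C₁ = C₂ = C` this is smallness (`zdim_incidence_lt`).  It also shows that the first
components of such pairs are not dense in `Z_C₁` (`not_conormalLift_subset`).  For `C₁ = C₂` this
gives the open set over which the projection is injective, since the projection is closed by
elimination theory (`exists_elimination`, `zclosed_image_snd`).  For two cones, an inclusion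
`D_C₁ ⊆ D_C₂` forces a general point of `Z_C₁` to lie in `Z_C₂`, and hence `C₁ ⊆ C₂`
(`subset_of_dualImage_subset`); so the sets `D_γ`, for `γ` the components of `C`, are closed,
irreducible and pairwise incomparable, and they cover `D_C`.
-/

namespace VeroneseRadon

universe u v w

/-! ### Generic points over extension fields, and the Zariski topology -/

section Points

open MvPolynomial

variable (k : Type v) {K : Type u} [Field k] [Field K] [Algebra k K]
variable {σ τ : Type*} {L : Type*} [Field L] [Algebra k L]

/-- The `L`-point `x` of affine space lies in the `k`-Zariski closure of the set `S` of
`K`-points. -/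
def IsPointOf (S : Set (σ → K)) (x : σ → L) : Prop :=
  ∀ f : MvPolynomial σ k, (∀ p ∈ S, aeval p f = 0) → aeval x f = 0

/-- The `L`-point `x` is a generic point (in the sense of Weil) of the set `S` of `K`-points:
it satisfies exactly the polynomial equations over `k` that hold on `S`. -/
def IsGenericOf (S : Set (σ → K)) (x : σ → L) : Prop :=
  ∀ f : MvPolynomial σ k, aeval x f = 0 ↔ ∀ p ∈ S, aeval p f = 0

/-- Irreducibility of a set of `K`-points of affine space for the `k`-Zariski topology, in terms
of polynomials. -/
def PolyIrreducible (S : Set (σ → K)) : Prop :=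
  S.Nonempty ∧ ∀ f g : MvPolynomial σ k, (∃ p ∈ S, aeval p f ≠ 0) → (∃ p ∈ S, aeval p g ≠ 0) →
    ∃ p ∈ S, aeval p f ≠ 0 ∧ aeval p g ≠ 0

variable {k}

theorem IsGenericOf.isPointOf {S : Set (σ → K)} {x : σ → L} (h : IsGenericOf k S x) :
    IsPointOf k S x := fun f hf => (h f).2 hf

theorem IsPointOf.mono {S T : Set (σ → K)} {x : σ → L} (h : IsPointOf k S x) (hST : S ⊆ T) :
    IsPointOf k T x := fun f hf => h f fun p hp => hf p (hST hp)

/-- A point over an extension field specializes to a `K`-point, avoiding a given hypersurface that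
does not contain it.  This is the Nullstellensatz. -/
theorem exists_specialization [IsAlgClosed K] [Finite σ] (x : σ → L) {h : MvPolynomial σ k}
    (hx : aeval x h ≠ 0) :
    ∃ y : σ → K, aeval y h ≠ 0 ∧ ∀ f : MvPolynomial σ k, aeval x f = 0 → aeval y f = 0 := by
  let P : Ideal (MvPolynomial σ k) := RingHom.ker (aeval (R := k) x)
  have hP : P.IsPrime := RingHom.ker_isPrime _
  have h1 : h ∉ vanishingIdeal k (zeroLocus K P) := by
    rw [IsPrime.vanishingIdeal_zeroLocus]
    exact hx
  rw [mem_vanishingIdeal_iff] at h1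
  push Not at h1
  obtain ⟨y, hy, hyh⟩ := h1
  exact ⟨y, hyh, fun f hf => hy f hf⟩

theorem PolyIrreducible.exists_isGenericOf {σ : Type} {S : Set (σ → K)}
    (hS : PolyIrreducible k S) :
    ∃ (L : Type v) (_ : Field L) (_ : Algebra k L) (x : σ → L), IsGenericOf k S x := by
  let I := vanishingIdeal k S
  have hI : I.IsPrime := by
    refine ⟨fun h => ?_, fun {f g} hfg => ?_⟩
    · obtain ⟨p, hp⟩ := hS.1
      have : (1 : MvPolynomial σ k) ∈ I := h ▸ Submodule.mem_top
      simpa using this p hp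
    · by_contra hcon
      simp only [I, mem_vanishingIdeal_iff, not_or, not_forall] at hcon
      obtain ⟨⟨p, hp, hf⟩, ⟨q, hq, hg⟩⟩ := hcon
      obtain ⟨r, hr, h1, h2⟩ := hS.2 f g ⟨p, hp, hf⟩ ⟨q, hq, hg⟩
      have := hfg r hr
      rw [map_mul] at this
      exact mul_ne_zero h1 h2 this
  refine ⟨FractionRing (MvPolynomial σ k ⧸ I), inferInstance, inferInstance,
    fun i => algebraMap _ _ (Ideal.Quotient.mk I (X i)), fun f => ?_⟩
  have h1 : aeval (fun i => algebraMap (MvPolynomial σ k ⧸ I)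
      (FractionRing (MvPolynomial σ k ⧸ I)) (Ideal.Quotient.mk I (X i))) f =
      algebraMap _ _ (Ideal.Quotient.mk I f) := by
    have : (aeval (R := k) fun i => algebraMap (MvPolynomial σ k ⧸ I)
      (FractionRing (MvPolynomial σ k ⧸ I)) (Ideal.Quotient.mk I (X i))) =
      (IsScalarTower.toAlgHom k (MvPolynomial σ k ⧸ I) _).comp (Ideal.Quotient.mkₐ k I) := by
      ext i
      simp
    rw [this]
    rfl
  rw [h1, map_eq_zero_iff _ (IsFractionRing.injective (MvPolynomial σ k ⧸ I) _),
    Ideal.Quotient.eq_zero_iff_mem]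
  rfl

/-- The polynomial in the variables `τ` obtained by substituting `c` for the variables `σ`. -/
noncomputable def substLeft (f : MvPolynomial (σ ⊕ τ) k) (c : σ → K) : MvPolynomial τ K :=
  MvPolynomial.map (aeval c : MvPolynomial σ k →ₐ[k] K).toRingHom
    (aeval (Sum.elim (fun i => C (X i)) X) f : MvPolynomial τ (MvPolynomial σ k))

theorem eval_substLeft (f : MvPolynomial (σ ⊕ τ) k) (c : σ → K) (t : τ → K) :
    eval t (substLeft f c) = aeval (Sum.elim c t) f := by
  unfold substLeft
  induction f using MvPolynomial.induction_on with
  | C a =>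
    simp only [algHom_C]
    rw [MvPolynomial.algebraMap_apply]
    simp
  | add p q hp hq => simp only [map_add, hp, hq]
  | mul_X p i hp =>
    simp only [map_mul, hp, aeval_X]
    rcases i with i | i <;> simp

/-- The projection along affine space `K^τ` is open: the image of a basic open set contains a
basic open neighbourhood of each of its points. -/
theorem exists_sweep [Infinite K] (f : MvPolynomial (σ ⊕ τ) k) (c : σ → K) (t : τ → K)
    (h : aeval (Sum.elim c t) f ≠ 0) :
    ∃ g : MvPolynomial σ k, aeval c g ≠ 0 ∧
      ∀ c' : σ → K, aeval c' g ≠ 0 → ∃ t' : τ → K, aeval (Sum.elim c' t') f ≠ 0 := by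
  have h1 : substLeft f c ≠ 0 := fun h0 => h (by rw [← eval_substLeft, h0, map_zero])
  obtain ⟨a, ha⟩ := MvPolynomial.ne_zero_iff.1 h1
  refine ⟨coeff a (aeval (Sum.elim (fun i => C (X i)) X) f :
    MvPolynomial τ (MvPolynomial σ k)), ?_, fun c' hc' => ?_⟩
  · rw [substLeft, coeff_map] at ha
    exact ha
  · have h2 : substLeft f c' ≠ 0 := MvPolynomial.ne_zero_iff.2 ⟨a, by
      rw [substLeft, coeff_map]
      exact hc'⟩
    by_contra hcon
    push Not at hcon
    refine h2 (MvPolynomial.funext fun t' => ?_)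
    rw [eval_substLeft, hcon, map_zero]

theorem exists_common_param [Infinite K] (f g : MvPolynomial (σ ⊕ τ) k) (c : σ → K)
    (hf : ∃ t, aeval (Sum.elim c t) f ≠ 0) (hg : ∃ t, aeval (Sum.elim c t) g ≠ 0) :
    ∃ t, aeval (Sum.elim c t) f ≠ 0 ∧ aeval (Sum.elim c t) g ≠ 0 := by
  obtain ⟨t1, h1⟩ := hf
  obtain ⟨t2, h2⟩ := hg
  rw [← eval_substLeft] at h1 h2
  have h3 : substLeft f c * substLeft g c ≠ 0 :=
    mul_ne_zero (fun h => h1 (by rw [h, map_zero])) (fun h => h2 (by rw [h, map_zero]))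
  by_contra hcon
  push Not at hcon
  refine h3 (MvPolynomial.funext fun t => ?_)
  rw [map_zero, map_mul, eval_substLeft, eval_substLeft]
  by_cases h : aeval (Sum.elim c t) f = 0
  · rw [h, zero_mul]
  · rw [hcon t h, mul_zero]

theorem PolyIrreducible.prod [Infinite K] {S : Set (σ → K)} (hS : PolyIrreducible k S) :
    PolyIrreducible k {p : σ ⊕ τ → K | (fun i => p (Sum.inl i)) ∈ S} := by
  obtain ⟨⟨s, hs⟩, hS⟩ := hS
  have key : ∀ p : σ ⊕ τ → K, p = Sum.elim (fun i => p (Sum.inl i)) (fun i => p (Sum.inr i)) := by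
    intro p
    ext (i | i) <;> rfl
  refine ⟨⟨Sum.elim s 0, hs⟩, ?_⟩
  rintro f g ⟨p, hp, hpf⟩ ⟨q, hq, hqg⟩
  rw [key p] at hpf
  rw [key q] at hqg
  obtain ⟨f', hf1, hf2⟩ := exists_sweep f _ _ hpf
  obtain ⟨g', hg1, hg2⟩ := exists_sweep g _ _ hqg
  obtain ⟨c, hc, h1, h2⟩ := hS f' g' ⟨_, hp, hf1⟩ ⟨_, hq, hg1⟩
  obtain ⟨t, ht⟩ := exists_common_param f g c (hf2 c h1) (hg2 c h2)
  exact ⟨Sum.elim c t, hc, ht⟩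

end Points

section Topology

open MvPolynomial CoordSpace

variable {k : Type v} {K : Type u} [Field k] [Field K] [Algebra k K]
variable {X : Type w} [CoordSpace K X]

/-- The set of all coordinate vectors of the points of a set. -/
def hat (Z : Set X) : Set (Idx X → K) := {y | ∃ p : Dom X, pt p ∈ Z ∧ coord p = y}

/-- Open sets are the unions of the sets defined by the nonvanishing of a polynomial in the
coordinates. -/
theorem zopen_iff {U : Set X} :
    ZOpen k U ↔ ∀ p : Dom X, pt p ∈ U → ∃ f : MvPolynomial (Idx X) k, aeval (coord p) f ≠ 0 ∧
      ∀ q : Dom X, aeval (coord q) f ≠ 0 → pt q ∈ U := by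
  have h0 : ZOpen k U ↔ ∃ I : Ideal (MvPolynomial (Idx X) k),
      coord ⁻¹' (zeroLocus K I)ᶜ = (pt : Dom X → X) ⁻¹' U := by
    unfold ZOpen
    rw [isOpen_coinduced, @isOpen_induced_iff]
    constructor
    · rintro ⟨t, ⟨I, hI⟩, ht⟩
      exact ⟨I, by rw [hI, compl_compl, ht]⟩
    · rintro ⟨I, hI⟩
      exact ⟨_, ⟨I, (compl_compl _).symm⟩, hI⟩
  rw [h0]
  constructor
  · rintro ⟨I, hI⟩ p hp
    have hp' : p ∈ coord ⁻¹' (zeroLocus K I)ᶜ := by rw [hI]; exact hp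
    simp only [Set.mem_preimage, Set.mem_compl_iff, mem_zeroLocus_iff, not_forall] at hp'
    obtain ⟨f, hf, hpf⟩ := hp'
    refine ⟨f, hpf, fun q hq => ?_⟩
    have : q ∈ coord ⁻¹' (zeroLocus K I)ᶜ := fun hqI => hq (hqI f hf)
    rw [hI] at this
    exact this
  · intro h
    refine ⟨vanishingIdeal k (hat Uᶜ), ?_⟩
    ext p
    simp only [Set.mem_preimage, Set.mem_compl_iff, mem_zeroLocus_iff, not_forall]
    constructor
    · rintro ⟨f, hf, hpf⟩
      by_contra hp
      exact hpf (hf _ ⟨p, hp, rfl⟩)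
    · intro hp
      obtain ⟨f, hf, hfU⟩ := h p hp
      refine ⟨f, ?_, hf⟩
      rintro _ ⟨q, hq, rfl⟩
      by_contra hqf
      exact hq (hfU q hqf)

theorem ZOpen.exists_poly {U : Set X} (hU : ZOpen k U) {p : Dom X} (hp : pt p ∈ U) :
    ∃ f : MvPolynomial (Idx X) k, aeval (coord p) f ≠ 0 ∧
      ∀ q : Dom X, aeval (coord q) f ≠ 0 → pt q ∈ U := zopen_iff.1 hU p hp

/-- A closed set contains every point with coordinates satisfying all equations of the set. -/
theorem zclosed_iff {Z : Set X} :
    ZClosed k Z ↔ ∀ p : Dom X, IsPointOf k (hat Z) (coord p) → pt p ∈ Z := by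
  have h0 : ZClosed k Z ↔ ZOpen k Zᶜ := (@isOpen_compl_iff X Z (zariski k)).symm
  rw [h0, zopen_iff]
  constructor
  · intro h p hp
    by_contra hpZ
    obtain ⟨f, hf, hfZ⟩ := h p hpZ
    refine hf (hp f ?_)
    rintro _ ⟨q, hq, rfl⟩
    by_contra hqf
    exact hfZ q hqf hq
  · intro h p hp
    have := mt (h p) hp
    simp only [IsPointOf, not_forall] at this
    obtain ⟨f, hf, hpf⟩ := this
    exact ⟨f, hpf, fun q hq hqZ => hq (hf _ ⟨q, hqZ, rfl⟩)⟩

theorem zclosed_zclosure (Z : Set X) : ZClosed k (zclosure k Z) :=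
  @isClosed_closure X (zariski k) Z

theorem subset_zclosure (Z : Set X) : Z ⊆ zclosure k Z :=
  @subset_closure X (zariski k) Z

theorem ZClosed.zclosure_subset {Z T : Set X} (hT : ZClosed k T) (h : Z ⊆ T) :
    zclosure k Z ⊆ T :=
  @closure_minimal X (zariski k) Z T h hT

theorem ZClosed.compl {Z : Set X} (hZ : ZClosed k Z) : ZOpen k Zᶜ :=
  (@isOpen_compl_iff X Z (zariski k)).2 hZ

theorem zirreducible_iff {S : Set X} : ZIrreducible k S ↔ S.Nonempty ∧
    ∀ U V : Set X, ZOpen k U → ZOpen k V → (S ∩ U).Nonempty → (S ∩ V).Nonempty →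
      (S ∩ (U ∩ V)).Nonempty :=
  Iff.rfl

theorem ZIrreducible.subset_of_open {S T U : Set X} (hS : ZIrreducible k S) (hT : ZClosed k T)
    (hU : ZOpen k U) (hne : (S ∩ U).Nonempty) (h : S ∩ U ⊆ T) : S ⊆ T := by
  intro s hs
  by_contra hsT
  obtain ⟨x, hx, hxU, hxT⟩ := hS.2 U Tᶜ hU hT.compl hne ⟨s, hs, hsT⟩
  exact hxT (h ⟨hx, hxU⟩)

theorem zclosed_univ : ZClosed k (Set.univ : Set X) := @isClosed_univ X (zariski k)

theorem ZIrreducible.zclosure {S : Set X} (hS : ZIrreducible k S) :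
    ZIrreducible k (zclosure k S) :=
  @IsIrreducible.closure X (zariski k) S hS

theorem zdim_mono {S T : Set X} (h : S ⊆ T) : zdim k S ≤ zdim k T := by
  let _ : TopologicalSpace X := zariski k
  have : Topology.IsInducing (Set.inclusion h) := by
    refine ⟨?_⟩
    change TopologicalSpace.induced Subtype.val _ = TopologicalSpace.induced _
      (TopologicalSpace.induced Subtype.val _)
    rw [induced_compose]
    rfl
  exact this.topologicalKrullDim_le

end Topology

/-! ### Transcendence degree -/

section TranscendenceDegree

variable (k : Type v) [Field k] {L : Type*} [Field L] [Algebra k L]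

/-- The transcendence degree over `k` of the subfield generated by a subset `S` of an extension
field, as the rank of `S` in the algebraic matroid. -/
noncomputable def td (S : Set L) : ℕ∞ := (AlgebraicIndependent.matroid k L).eRk S

/-- The relative algebraic closure of the field generated by `S`. -/
noncomputable def algClo (S : Set L) : IntermediateField k L :=
  (algebraicClosure (IntermediateField.adjoin k S) L).restrictScalars k

variable {k}

theorem subset_algClo (S : Set L) : S ⊆ algClo k S := fun _ ha =>
  (algebraicClosure (IntermediateField.adjoin k S) L).algebraMap_mem
    ⟨_, IntermediateField.subset_adjoin k S ha⟩

theorem coe_algClo (S : Set L) :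
    (algClo k S : Set L) = (AlgebraicIndependent.matroid k L).closure S := by
  rw [AlgebraicIndependent.matroid_closure_eq]
  ext a
  rw [SetLike.mem_coe, SetLike.mem_coe, Subalgebra.mem_algebraicClosure]
  change a ∈ algebraicClosure (IntermediateField.adjoin k S) L ↔ _
  rw [mem_algebraicClosure_iff (F := IntermediateField.adjoin k S) (E := L)]
  exact IntermediateField.isAlgebraic_adjoin_iff (F := k) (E := L) (S := L)

theorem td_mono {S T : Set L} (h : S ⊆ T) : td k S ≤ td k T :=
  (AlgebraicIndependent.matroid k L).eRk_mono h

theorem td_algClo (S : Set L) : td k (algClo k S : Set L) = td k S := by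
  rw [td, coe_algClo, Matroid.eRk_closure_eq, td]

theorem td_le_of_subset_algClo {S T : Set L} (h : S ⊆ algClo k T) : td k S ≤ td k T :=
  (td_mono h).trans (td_algClo T).le

theorem algClo_mono {S T : Set L} (h : S ⊆ T) : algClo k S ≤ algClo k T := by
  intro a ha
  have : a ∈ (algClo k S : Set L) := ha
  rw [coe_algClo] at this
  have h2 := (AlgebraicIndependent.matroid k L).closure_subset_closure h this
  rw [← coe_algClo] at h2
  exact h2

theorem td_union_le (S T : Set L) : td k (S ∪ T) ≤ td k S + td k T :=
  (AlgebraicIndependent.matroid k L).eRk_union_le_eRk_add_eRk S T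

theorem td_union_le_encard (S T : Set L) : td k (S ∪ T) ≤ td k S + T.encard :=
  (AlgebraicIndependent.matroid k L).eRk_union_le_eRk_add_encard S T

open MvPolynomial in
/-- The dimension of a finitely generated domain is the transcendence degree of its fraction field,
by Noether normalization. -/
theorem ringKrullDim_range_aeval {σ : Type*} [Finite σ] (x : σ → L) :
    ringKrullDim (aeval (R := k) x).range = (td k (Set.range x) : WithBot ℕ∞) := by
  set A := (aeval (R := k) x).range with hA
  have hfg : Algebra.FiniteType k A :=
    Algebra.FiniteType.of_surjective (aeval (R := k) x).rangeRestrict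
      (aeval (R := k) x).rangeRestrict_surjective
  obtain ⟨s, g, hg, hint⟩ := exists_integral_inj_algHom_of_fg k A
  have h1 : ringKrullDim A = (s : WithBot ℕ∞) := by
    have hs : ringKrullDim (MvPolynomial (Fin s) k) = (s : WithBot ℕ∞) := by simp
    let _ : Algebra (MvPolynomial (Fin s) k) A := g.toRingHom.toAlgebra
    have hi : Algebra.IsIntegral (MvPolynomial (Fin s) k) A := ⟨hint⟩
    have hinj : Function.Injective (algebraMap (MvPolynomial (Fin s) k) A) := hg
    have hf : FaithfulSMul (MvPolynomial (Fin s) k) A :=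
      (faithfulSMul_iff_algebraMap_injective _ _).2 hinj
    refine le_antisymm ?_ ?_
    · rw [← hs]
      refine Order.krullDim_le_of_strictMono (PrimeSpectrum.comap (algebraMap _ A)) ?_
      intro P Q hPQ
      exact Ideal.IsIntegral.comap_lt_comap (R := MvPolynomial (Fin s) k) hPQ
    · obtain ⟨l, hl⟩ := Order.le_krullDim_iff.1 hs.ge
      obtain ⟨P, hP⟩ : Nonempty (l.head.asIdeal.primesOver A) := inferInstance
      have := hP.1
      have := hP.2
      obtain ⟨l', hl', -⟩ := Ideal.exists_ltSeries_of_hasGoingUp l P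
      exact Order.le_krullDim_iff.2 ⟨l', hl'.trans hl⟩
  have h2 : td k (Set.range x) = (s : ℕ∞) := by
    let b : Fin s → L := fun i => (g (X i) : A)
    have hgb : ∀ f, ((g f : A) : L) = aeval b f := by
      intro f
      have : (A.val.comp g) = aeval b := by
        ext i
        simp [b]
      exact DFunLike.congr_fun this f
    have hb : AlgebraicIndependent k b := by
      rw [algebraicIndependent_iff_injective_aeval]
      intro f f' hff
      rw [← hgb, ← hgb] at hff
      exact hg (Subtype.ext hff)
    have hAx : A = Algebra.adjoin k (Set.range x) := (Algebra.adjoin_range_eq_range_aeval k x).symm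
    have hbi : (AlgebraicIndependent.matroid k L).Indep (Set.range b) :=
      AlgebraicIndependent.matroid_indep_iff.2 hb.coe_range
    have hbc : (Set.range b).encard = s := by
      rw [← Set.image_univ, hb.injective.encard_image]
      simp
    have e1 : td k (Set.range b) = s := by
      rw [td, hbi.eRk_eq_encard, hbc]
    rw [← e1]
    refine le_antisymm (td_le_of_subset_algClo ?_) (td_le_of_subset_algClo ?_)
    · rintro _ ⟨i, rfl⟩
      have hxi : x i ∈ A := ⟨X i, by simp⟩
      rw [coe_algClo, AlgebraicIndependent.matroid_closure_eq]
      change IsAlgebraic (Algebra.adjoin k (Set.range b)) (x i)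
      obtain ⟨p, hp, hpx⟩ := hint ⟨x i, hxi⟩
      let φ : MvPolynomial (Fin s) k →+* Algebra.adjoin k (Set.range b) :=
        ((aeval b : _ →ₐ[k] L).toRingHom).codRestrict _ (by
          intro f
          rw [Algebra.adjoin_range_eq_range_aeval]
          exact ⟨f, rfl⟩)
      have hpx' : Polynomial.eval₂ (algebraMap (Algebra.adjoin k (Set.range b)) L) (x i)
          (p.map φ) = 0 := by
        rw [Polynomial.eval₂_map]
        have h3 := congrArg A.val hpx
        rw [map_zero] at h3
        change (A.val : A →+* L) _ = 0 at h3
        rw [Polynomial.hom_eval₂] at h3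
        have h5 : (algebraMap (Algebra.adjoin k (Set.range b)) L).comp φ =
            (A.val : A →+* L).comp g.toRingHom := RingHom.ext fun f => (hgb f).symm
        rw [h5]
        exact h3
      have hI : IsIntegral (Algebra.adjoin k (Set.range b)) (x i) := ⟨p.map φ, hp.map φ, hpx'⟩
      exact hI.isAlgebraic
    · rintro _ ⟨i, rfl⟩
      have : b i ∈ Algebra.adjoin k (Set.range x) := by
        rw [← hAx]
        exact (g (X i)).2
      have h4 : Algebra.adjoin k (Set.range x) ≤ (algClo k (Set.range x)).toSubalgebra :=
        Algebra.adjoin_le (subset_algClo _)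
      exact h4 this
  rw [h1, h2]
  rfl

theorem krullDim_zeroLocus_ker {σ : Type*} [Finite σ] (x : σ → L) :
    Order.krullDim (PrimeSpectrum.zeroLocus
      (RingHom.ker (MvPolynomial.aeval (R := k) x) : Set (MvPolynomial σ k))) =
      (td k (Set.range x) : WithBot ℕ∞) := by
  rw [← ringKrullDim_quotient, ← ringKrullDim_range_aeval]
  exact ringKrullDim_eq_of_ringEquiv
    (Ideal.quotientKerAlgEquivOfSurjective
      (f := (MvPolynomial.aeval (R := k) x).rangeRestrict)
      (MvPolynomial.aeval (R := k) x).rangeRestrict_surjective |>.toRingEquiv |> fun e =>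
      (Ideal.quotEquivOfEq (by ext; simp [RingHom.mem_ker, Subtype.ext_iff])).trans e)

open MvPolynomial in
/-- The transcendence degree drops under specialization. -/
theorem td_le_of_specialization {σ : Type*} {L' : Type*} [Field L'] [Algebra k L'] (x : σ → L)
    (z : σ → L') (h : ∀ f : MvPolynomial σ k, aeval x f = 0 → aeval z f = 0) :
    td k (Set.range z) ≤ td k (Set.range x) := by
  rw [td, Matroid.eRk_le_iff]
  intro I hI hIi
  choose j hj using fun i : I => hI i.2
  have hz : AlgebraicIndependent k (fun i : I => z (j i)) := by
    rw [AlgebraicIndependent.matroid_indep_iff] at hIi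
    convert! hIi using 2
    exact hj _
  have hx : AlgebraicIndependent k (fun i : I => x (j i)) := by
    rw [algebraicIndependent_iff] at hz ⊢
    intro p hp
    refine hz p ?_
    have := h (rename j p) (by rw [aeval_rename]; exact hp)
    rwa [aeval_rename] at this
  have hxi : (AlgebraicIndependent.matroid k L).Indep (Set.range fun i : I => x (j i)) :=
    AlgebraicIndependent.matroid_indep_iff.2 hx.coe_range
  calc I.encard = (Set.range fun i : I => x (j i)).encard := by
        rw [← Set.image_univ, hx.injective.encard_image]
        simp
    _ ≤ _ := hxi.encard_le_eRk_of_subset (by rintro _ ⟨i, rfl⟩; exact ⟨_, rfl⟩)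

/-- Elements that are algebraically independent over `L` raise the transcendence degree of a
subset of `L` by their number. -/
theorem td_union_of_algebraicIndependent {L' : Type*} [Field L'] [Algebra k L'] [Algebra L L']
    [IsScalarTower k L L'] (S : Set L) {ι : Type*} {t : ι → L'} (ht : AlgebraicIndependent L t) :
    td k S + ENat.card ι ≤ td k (algebraMap L L' '' S ∪ Set.range t) := by
  obtain ⟨I, hI⟩ := (AlgebraicIndependent.matroid k L).exists_isBasis S
  have hIi : AlgebraicIndependent k (fun i : I => (i : L)) :=
    AlgebraicIndependent.matroid_indep_iff.1 hI.indep
  have hs := AlgebraicIndependent.sumElim_comp hIi ht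
  have hxi : (AlgebraicIndependent.matroid k L').Indep
      (Set.range (Sum.elim t (algebraMap L L' ∘ fun i : I => (i : L)))) :=
    AlgebraicIndependent.matroid_indep_iff.2 hs.coe_range
  have h1 : td k S = I.encard := by rw [td, hI.eRk_eq_encard]
  calc td k S + ENat.card ι
      = (Set.range (Sum.elim t (algebraMap L L' ∘ fun i : I => (i : L)))).encard := by
        rw [← Set.image_univ, hs.injective.encard_image, h1]
        simp [Set.encard_univ, ENat.card_sum, add_comm]
    _ ≤ _ := hxi.encard_le_eRk_of_subset (by
        rintro _ ⟨i | i, rfl⟩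
        · exact Or.inr ⟨_, rfl⟩
        · exact Or.inl ⟨_, hI.subset i.2, rfl⟩)

end TranscendenceDegree

/-! ### Charts and Krull dimension -/

section Charts

open MvPolynomial CoordSpace

variable (k : Type v) {K : Type u} [Field k] [Field K] [Algebra k K]

/-- An open subset `U` of a variety on which every point has a preferred coordinate vector `ρ x`,
whose entries are given by fractions `a j / q` of polynomials in arbitrary coordinates. -/
structure Chart (X : Type w) [CoordSpace K X] where
  /-- the open set -/
  U : Set X
  /-- the normalized coordinates -/
  ρ : X → Idx X → K
  /-- the common denominator -/
  q : MvPolynomial (Idx X) k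
  /-- the numerators -/
  a : Idx X → MvPolynomial (Idx X) k
  mem_iff : ∀ p : Dom X, pt p ∈ U ↔ aeval (coord p) q ≠ 0
  ρ_mul : ∀ p : Dom X, pt p ∈ U → ∀ j, ρ (pt p) j * aeval (coord p) q = aeval (coord p) (a j)
  exists_rep : ∀ x ∈ U, ∃ p : Dom X, pt p = x ∧ coord p = ρ x

variable {k} {X : Type w} [CoordSpace K X]

theorem exists_numerator {σ τ : Type*} (q : MvPolynomial σ k) (a : τ → MvPolynomial σ k)
    (f : MvPolynomial τ k) : ∃ (g : MvPolynomial σ k) (N : ℕ), ∀ (y : σ → K) (r : τ → K),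
      (∀ j, r j * aeval y q = aeval y (a j)) → aeval y g = aeval y q ^ N * aeval r f := by
  induction f using MvPolynomial.induction_on with
  | C c => exact ⟨C c, 0, fun y r _ => by simp⟩
  | add f₁ f₂ h₁ h₂ =>
    obtain ⟨g₁, N₁, h₁⟩ := h₁
    obtain ⟨g₂, N₂, h₂⟩ := h₂
    refine ⟨q ^ N₂ * g₁ + q ^ N₁ * g₂, N₁ + N₂, fun y r h => ?_⟩
    simp only [map_add, map_mul, map_pow, h₁ y r h, h₂ y r h]
    ring
  | mul_X f i h =>
    obtain ⟨g, N, h⟩ := h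
    refine ⟨g * a i, N + 1, fun y r hr => ?_⟩
    simp only [map_mul, aeval_X, h y r hr, ← hr i]
    ring

theorem Chart.zopen (c : Chart k X) (f : MvPolynomial (Idx X) k) :
    ZOpen k {x | x ∈ c.U ∧ aeval (c.ρ x) f ≠ 0} := by
  rw [zopen_iff]
  rintro p ⟨hp, hf⟩
  obtain ⟨g, N, hg⟩ := exists_numerator (K := K) c.q c.a f
  have hq := (c.mem_iff p).1 hp
  refine ⟨g * c.q, ?_, fun p' hp' => ?_⟩
  · rw [map_mul, hg _ _ (c.ρ_mul p hp)]
    exact mul_ne_zero (mul_ne_zero (pow_ne_zero _ hq) hf) hq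
  · rw [map_mul] at hp'
    have hq' := (c.mem_iff p').2 (right_ne_zero_of_mul hp')
    refine ⟨hq', fun h0 => left_ne_zero_of_mul hp' ?_⟩
    rw [hg _ _ (c.ρ_mul p' hq'), h0, mul_zero]

theorem Chart.zopen_U (c : Chart k X) : ZOpen k c.U := by
  have := c.zopen 1
  simpa using this

theorem Chart.polyIrreducible_image (c : Chart k X) {T : Set X} (hT : ZIrreducible k T)
    (hne : (T ∩ c.U).Nonempty) : PolyIrreducible k (c.ρ '' (T ∩ c.U)) := by
  refine ⟨hne.image _, ?_⟩
  rintro f g ⟨_, ⟨x, hx, rfl⟩, hf⟩ ⟨_, ⟨y, hy, rfl⟩, hg⟩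
  obtain ⟨z, hz, hzf, hzg⟩ := hT.2 _ _ (c.zopen f) (c.zopen g) ⟨x, hx.1, hx.2, hf⟩
    ⟨y, hy.1, hy.2, hg⟩
  exact ⟨_, ⟨z, ⟨hz, hzf.1⟩, rfl⟩, hzf.2, hzg.2⟩

/-- Lower bound for the dimension of `S` by the transcendence degree of a point over an extension
field all of whose specializations are normalized coordinates of points of `S`: the primes of the
coordinate ring of `x` give irreducible closed subsets of `S`. -/
theorem td_le_zdim [IsAlgClosed K] [Finite (Idx X)] {L : Type*} [Field L] [Algebra k L]
    (c : Chart k X) {S : Set X} (x : Idx X → L)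
    (h : ∀ y : Idx X → K, (∀ f : MvPolynomial (Idx X) k, aeval x f = 0 → aeval y f = 0) →
      ∃ p : Dom X, coord p = y ∧ pt p ∈ S ∧ pt p ∈ c.U ∧ c.ρ (pt p) = y) :
    (td k (Set.range x) : WithBot ℕ∞) ≤ zdim k S := by
  let _ : TopologicalSpace X := zariski k
  rw [← krullDim_zeroLocus_ker]
  let A : Ideal (MvPolynomial (Idx X) k) → Set S := fun P =>
    {s | ∃ p : Dom X, coord p ∈ zeroLocus K P ∧ pt p = s.1}
  have hP : ∀ P : PrimeSpectrum.zeroLocus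
      (RingHom.ker (aeval (R := k) x) : Set (MvPolynomial (Idx X) k)), ∀ y ∈ zeroLocus K P.1.asIdeal,
      ∃ p : Dom X, coord p = y ∧ pt p ∈ S ∧ pt p ∈ c.U ∧ c.ρ (pt p) = y := by
    intro P y hy
    exact h y fun f hf => hy f (P.2 hf)
  have hirr : ∀ P : PrimeSpectrum.zeroLocus
      (RingHom.ker (aeval (R := k) x) : Set (MvPolynomial (Idx X) k)),
      IsIrreducible (A P.1.asIdeal) := by
    intro P
    have hPp := P.1.isPrime
    constructor
    · have h1 : (1 : MvPolynomial (Idx X) k) ∉ vanishingIdeal k (zeroLocus K P.1.asIdeal) := by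
        rw [IsPrime.vanishingIdeal_zeroLocus]
        exact fun h1 => hPp.ne_top ((Ideal.eq_top_iff_one _).2 h1)
      rw [mem_vanishingIdeal_iff] at h1
      push Not at h1
      obtain ⟨y, hy, -⟩ := h1
      obtain ⟨p, hp, hpS, -⟩ := hP P y hy
      exact ⟨⟨pt p, hpS⟩, p, hp ▸ hy, rfl⟩
    · rintro U V ⟨U', hU', rfl⟩ ⟨V', hV', rfl⟩ ⟨s, ⟨p, hp, hps⟩, hsU⟩ ⟨t, ⟨p', hp', hpt⟩, htV⟩
      obtain ⟨f, hf, hfU⟩ := ZOpen.exists_poly hU' (p := p) (by rw [hps]; exact hsU)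
      obtain ⟨g, hg, hgV⟩ := ZOpen.exists_poly hV' (p := p') (by rw [hpt]; exact htV)
      have h1 : f * g ∉ vanishingIdeal k (zeroLocus K P.1.asIdeal) := by
        rw [IsPrime.vanishingIdeal_zeroLocus]
        intro hfg
        rcases hPp.mem_or_mem hfg with h2 | h2
        · exact hf (hp f h2)
        · exact hg (hp' g h2)
      rw [mem_vanishingIdeal_iff] at h1
      push Not at h1
      obtain ⟨y, hy, hyfg⟩ := h1
      obtain ⟨p, rfl, hpS, -⟩ := hP P y hy
      rw [map_mul] at hyfg
      exact ⟨⟨pt p, hpS⟩, ⟨p, hy, rfl⟩, hfU p (left_ne_zero_of_mul hyfg),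
        hgV p (right_ne_zero_of_mul hyfg)⟩
  let φ : PrimeSpectrum.zeroLocus
      (RingHom.ker (aeval (R := k) x) : Set (MvPolynomial (Idx X) k)) →
      (TopologicalSpace.IrreducibleCloseds S)ᵒᵈ := fun P => OrderDual.toDual
    ⟨closure (A P.1.asIdeal), (hirr P).closure, isClosed_closure⟩
  have hφ : ∀ P Q, φ P ≤ φ Q ↔ P ≤ Q := by
    intro P Q
    have hPp := P.1.isPrime
    have hQp := Q.1.isPrime
    constructor
    · intro hPQ f hf
      have hPQ' : closure (A Q.1.asIdeal) ⊆ closure (A P.1.asIdeal) := hPQ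
      have h1 : f ∈ vanishingIdeal k (zeroLocus K Q.1.asIdeal) := by
        rw [mem_vanishingIdeal_iff]
        intro y hy
        by_contra hyf
        obtain ⟨p, rfl, hpS, hpU, hpρ⟩ := hP Q y hy
        have h2 : (⟨pt p, hpS⟩ : S) ∈ closure (A P.1.asIdeal) :=
          hPQ' (subset_closure ⟨p, hy, rfl⟩)
        have ho : IsOpen ((Subtype.val : S → X) ⁻¹' {x | x ∈ c.U ∧ aeval (c.ρ x) f ≠ 0}) :=
          ⟨_, c.zopen f, rfl⟩
        obtain ⟨⟨s, hs⟩, ⟨hsU, hsf⟩, p', hp', hps⟩ := mem_closure_iff.1 h2 _ ho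
          ⟨hpU, by rw [hpρ]; exact hyf⟩
        obtain ⟨p'', hp'', hS'', hU'', hρ''⟩ := hP P _ hp'
        -- `p` and `p''` have the same coordinates; both represent normalized points
        have h3 : aeval (c.ρ s) f = 0 := by
          have h4 : c.ρ s = coord p' := by
            have := c.ρ_mul p' (by rw [hps]; exact hsU)
            have h5 := c.ρ_mul p'' hU''
            rw [hp''] at h5
            have h6 := (c.mem_iff p').1 (by rw [hps]; exact hsU)
            ext j
            have h7 := this j
            rw [hps, ← h5 j, hρ''] at h7
            exact mul_right_cancel₀ h6 h7
          rw [h4]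
          exact hp' f hf
        exact hsf h3
      rwa [IsPrime.vanishingIdeal_zeroLocus] at h1
    · intro hPQ
      change closure (A Q.1.asIdeal) ⊆ closure (A P.1.asIdeal)
      refine closure_mono ?_
      rintro s ⟨p, hp, hps⟩
      exact ⟨p, zeroLocus_anti_mono hPQ hp, hps⟩
  have h0 := Order.krullDim_le_of_strictMono φ (fun P Q hPQ => by
    rw [lt_iff_le_not_ge] at hPQ ⊢
    rwa [hφ, hφ])
  rw [Order.krullDim_orderDual] at h0
  exact h0

/-- Upper bound for the dimension of `S`: it is less than `z` as soon as, in every member of a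
family of charts covering `S`, the generic points of all irreducible subsets of `S` have
transcendence degree less than `z`.  For a chain of irreducible closed subsets of `S`, a chart
meeting the smallest member meets all of them. -/
theorem zdim_lt_of_charts [Finite (Idx X)] {ι : Type*} (c : ι → Chart k X) {S : Set X} {z : ℕ}
    (hcov : ∀ x ∈ S, ∃ i, x ∈ (c i).U)
    (h : ∀ (i : ι) (T : Set X), T ⊆ S → ZIrreducible k T → (T ∩ (c i).U).Nonempty →
      ∀ (L : Type v) [Field L] [Algebra k L] (x : Idx X → L),
        IsGenericOf k ((c i).ρ '' (T ∩ (c i).U)) x → td k (Set.range x) < z) :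
    zdim k S < z := by
  let _ : TopologicalSpace X := zariski k
  refine Order.krullDim_lt_coe_iff.2 fun l => ?_
  let T : Fin (l.length + 1) → Set X := fun j => Subtype.val '' (l j).carrier
  have hTS : ∀ j, T j ⊆ S := by
    rintro j _ ⟨s, -, rfl⟩
    exact s.2
  have hTirr : ∀ j, ZIrreducible k (T j) := fun j =>
    (l j).isIrreducible.image _ continuous_subtype_val.continuousOn
  obtain ⟨x₀, hx₀⟩ := (hTirr 0).1
  obtain ⟨i, hi⟩ := hcov x₀ (hTS 0 hx₀)
  have hmono : ∀ j j', j ≤ j' → T j ⊆ T j' := fun j j' hjj =>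
    Set.image_mono (l.monotone hjj)
  have hne : ∀ j, (T j ∩ (c i).U).Nonempty := fun j => ⟨x₀, hmono 0 j (Fin.zero_le j) hx₀, hi⟩
  let V : Fin (l.length + 1) → Set (Idx X → K) := fun j => (c i).ρ '' (T j ∩ (c i).U)
  have hV : ∀ j, PolyIrreducible k (V j) := fun j =>
    (c i).polyIrreducible_image (hTirr j) (hne j)
  have hprime : ∀ j, (vanishingIdeal k (V j)).IsPrime := by
    intro j
    obtain ⟨L, _, _, x, hx⟩ := (hV j).exists_isGenericOf
    have : vanishingIdeal k (V j) = RingHom.ker (aeval (R := k) x) := by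
      ext f
      exact (hx f).symm
    rw [this]
    exact RingHom.ker_isPrime _
  obtain ⟨L, _, _, x, hx⟩ := (hV (Fin.last _)).exists_isGenericOf
  have hlt := h i (T (Fin.last _)) (hTS _) (hTirr _) (hne _) L x hx
  have hker : RingHom.ker (aeval (R := k) x) = vanishingIdeal k (V (Fin.last _)) := by
    ext f
    exact hx f
  have hstrict : ∀ j j', j < j' → vanishingIdeal k (V j') < vanishingIdeal k (V j) := by
    intro j j' hjj
    refine lt_of_le_of_ne (vanishingIdeal_anti_mono
      (Set.image_mono (Set.inter_subset_inter_left _ (hmono j j' hjj.le)))) fun heq => ?_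
    have hl := l.strictMono hjj
    refine hl.not_ge ?_
    change (l j').carrier ⊆ (l j).carrier
    -- the part of `T j'` in the chart is contained in `T j`
    have hclosed := (l j).isClosed
    obtain ⟨Z, hZ, hZl⟩ := isClosed_induced_iff.1 hclosed
    have h1 : T j' ∩ (c i).U ⊆ Z := by
      rintro y ⟨hy, hyU⟩
      obtain ⟨p, rfl, hpρ⟩ := (c i).exists_rep y hyU
      refine zclosed_iff.1 hZ p fun f hf => ?_
      have h2 : f ∈ vanishingIdeal k (V j) := by
        rintro _ ⟨t, ⟨ht, htU⟩, rfl⟩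
        obtain ⟨p', rfl, hpρ'⟩ := (c i).exists_rep t htU
        rw [← hpρ']
        refine hf _ ⟨p', ?_, rfl⟩
        obtain ⟨s, hs, hst⟩ := ht
        rw [← hst]
        have : s ∈ Subtype.val ⁻¹' Z := by rw [hZl]; exact hs
        exact this
      rw [← heq] at h2
      rw [hpρ]
      exact h2 _ ⟨_, ⟨hy, hyU⟩, rfl⟩
    have h2 : T j' ⊆ Z := (hTirr j').subset_of_open hZ (c i).zopen_U (hne j') h1
    intro s hs
    have h3 : s ∈ Subtype.val ⁻¹' Z := h2 ⟨s, hs, rfl⟩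
    rw [hZl] at h3
    exact h3
  have hker_le : ∀ j, RingHom.ker (aeval (R := k) x) ≤ vanishingIdeal k (V j) := by
    intro j
    rw [hker]
    rcases (Fin.le_last j).lt_or_eq with h' | h'
    · exact (hstrict _ _ h').le
    · rw [h']
  have hdim := krullDim_zeroLocus_ker (k := k) x
  have hlen : (l.length : WithBot ℕ∞) ≤ (td k (Set.range x) : WithBot ℕ∞) := by
    rw [← hdim]
    refine Order.le_krullDim_iff.2 ⟨LTSeries.mk l.length
      (fun j => ⟨⟨vanishingIdeal k (V j.rev), hprime _⟩, hker_le _⟩) ?_, rfl⟩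
    intro j j' hjj
    exact hstrict _ _ (Fin.rev_lt_rev.2 hjj)
  have hlen' : (l.length : ℕ∞) ≤ td k (Set.range x) := by exact_mod_cast hlen
  exact_mod_cast hlen'.trans_lt hlt

/-- The product of two charts. -/
noncomputable def Chart.prod {Y : Type*} [CoordSpace K Y] (c : Chart k X) (c' : Chart k Y) :
    Chart k (X × Y) where
  U := c.U ×ˢ c'.U
  ρ x := Sum.elim (c.ρ x.1) (c'.ρ x.2)
  q := rename Sum.inl c.q * rename Sum.inr c'.q
  a := Sum.elim (fun j => rename Sum.inl (c.a j) * rename Sum.inr c'.q)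
    (fun j => rename Sum.inl c.q * rename Sum.inr (c'.a j))
  mem_iff p := by
    change pt p.1 ∈ c.U ∧ pt p.2 ∈ c'.U ↔ _
    rw [c.mem_iff, c'.mem_iff, ← mul_ne_zero_iff, map_mul, aeval_rename, aeval_rename]
    rfl
  ρ_mul p hp j := by
    have h1 : pt p.1 ∈ c.U := hp.1
    have h2 : pt p.2 ∈ c'.U := hp.2
    rcases j with j | j
    · change c.ρ (pt p.1) j * _ = _
      simp only [map_mul, aeval_rename, Sum.elim_inl]
      rw [← mul_assoc]
      congr 1
      exact c.ρ_mul p.1 h1 j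
    · change c'.ρ (pt p.2) j * _ = _
      simp only [map_mul, aeval_rename, Sum.elim_inr]
      rw [mul_left_comm]
      congr 1
      exact c'.ρ_mul p.2 h2 j
  exists_rep x hx := by
    obtain ⟨p, hp, hpρ⟩ := c.exists_rep x.1 hx.1
    obtain ⟨p', hp', hpρ'⟩ := c'.exists_rep x.2 hx.2
    refine ⟨(p, p'), Prod.ext hp hp', ?_⟩
    rw [← hpρ, ← hpρ']
    rfl

/-- The standard affine chart of a projective space in which the `a`-th coordinate is `1`. -/
noncomputable def projChart (k : Type v) [Field k] [Algebra k K] {σ : Type} (a : σ) :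
    Chart k (ℙ K (σ → K)) where
  U := {x | x.rep a ≠ 0}
  ρ x j := x.rep j / x.rep a
  q := MvPolynomial.X a
  a j := MvPolynomial.X j
  mem_iff p := by
    obtain ⟨t, ht⟩ := Projectivization.exists_smul_eq_mk_rep K p.1 p.2
    change (Projectivization.mk K p.1 p.2).rep a ≠ 0 ↔ _
    rw [← ht, aeval_X]
    change (t : K) * p.1 a ≠ 0 ↔ p.1 a ≠ 0
    simp
  ρ_mul p hp j := by
    obtain ⟨t, ht⟩ := Projectivization.exists_smul_eq_mk_rep K p.1 p.2
    change (Projectivization.mk K p.1 p.2).rep a ≠ 0 at hp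
    change (Projectivization.mk K p.1 p.2).rep j / (Projectivization.mk K p.1 p.2).rep a * _ = _
    rw [← ht] at hp ⊢
    simp only [aeval_X]
    have hp' : (t : K) * p.1 a ≠ 0 := hp
    change (t : K) * p.1 j / (t * p.1 a) * p.1 a = p.1 j
    field_simp [left_ne_zero_of_mul hp', right_ne_zero_of_mul hp']
  exists_rep x hx := by
    have h0 : (fun j => x.rep j / x.rep a) = (x.rep a)⁻¹ • x.rep := by
      ext j
      simp [div_eq_inv_mul]
    have hne : (fun j => x.rep j / x.rep a) ≠ 0 := by
      rw [h0]
      exact smul_ne_zero (inv_ne_zero hx) x.rep_nonzero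
    refine ⟨⟨_, hne⟩, ?_, rfl⟩
    change Projectivization.mk K _ hne = x
    conv_rhs => rw [← Projectivization.mk_rep x]
    rw [Projectivization.mk_eq_mk_iff]
    exact ⟨Units.mk0 _ (inv_ne_zero hx), h0.symm⟩

/-- The chart of the cotangent bundle of projective space in which the point has `i`-th
coordinate `1`. -/
noncomputable def cotangentChart (k : Type v) [Field k] [Algebra k K] {σ : Type} [Fintype σ]
    (i : σ) : Chart k (Cotangent K σ) where
  U := {x | x.out.1.1 i ≠ 0}
  ρ x := Sum.elim (fun j => x.out.1.1 j / x.out.1.1 i) (fun j => x.out.1.1 i * x.out.1.2 j)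
  q := MvPolynomial.X (Sum.inl i)
  a := Sum.elim (fun j => MvPolynomial.X (Sum.inl j))
    (fun j => MvPolynomial.X (Sum.inl i) ^ 2 * MvPolynomial.X (Sum.inr j))
  mem_iff p := by
    obtain ⟨t, ht, -⟩ := Quotient.exact (Quotient.out_eq (Quotient.mk (cotangentSetoid K σ) p))
    change (Quotient.mk (cotangentSetoid K σ) p).out.1.1 i ≠ 0 ↔ _
    rw [aeval_X]
    change _ ↔ p.1.1 i ≠ 0
    rw [ht]
    simp
  ρ_mul p hp j := by
    obtain ⟨t, ht, ht'⟩ := Quotient.exact (Quotient.out_eq (Quotient.mk (cotangentSetoid K σ) p))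
    change (Quotient.mk (cotangentSetoid K σ) p).out.1.1 i ≠ 0 at hp
    set o := (Quotient.mk (cotangentSetoid K σ) p).out with ho
    rcases j with j | j
    · change o.1.1 j / o.1.1 i * _ = _
      simp only [aeval_X, Sum.elim_inl]
      change o.1.1 j / o.1.1 i * p.1.1 i = p.1.1 j
      rw [ht]
      simp only [Pi.smul_apply, smul_eq_mul]
      field_simp
    · change o.1.1 i * o.1.2 j * _ = _
      simp only [aeval_X, Sum.elim_inr, map_mul, map_pow]
      change o.1.1 i * o.1.2 j * p.1.1 i = p.1.1 i ^ 2 * p.1.2 j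
      rw [ht, ht']
      simp only [Pi.smul_apply, smul_eq_mul]
      have := t.ne_zero
      field_simp
      simp
  exists_rep x hx := by
    have hx' : x.out.1.1 i ≠ 0 := hx
    have h0 : (fun j => x.out.1.1 j / x.out.1.1 i) = (x.out.1.1 i)⁻¹ • x.out.1.1 := by
      ext j
      simp [div_eq_inv_mul]
    have h1 : (fun j => x.out.1.1 i * x.out.1.2 j) = x.out.1.1 i • x.out.1.2 := rfl
    refine ⟨⟨(fun j => x.out.1.1 j / x.out.1.1 i, fun j => x.out.1.1 i * x.out.1.2 j), ?_, ?_⟩,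
      ?_, rfl⟩
    · change (fun j => x.out.1.1 j / x.out.1.1 i) ≠ 0
      rw [h0]
      exact smul_ne_zero (inv_ne_zero hx) x.out.2.1
    · change (fun j => x.out.1.1 j / x.out.1.1 i) ⬝ᵥ (fun j => x.out.1.1 i * x.out.1.2 j) = 0
      rw [h0, h1, smul_dotProduct, dotProduct_smul, x.out.2.2, smul_zero, smul_zero]
    · change Quotient.mk (cotangentSetoid K σ) _ = x
      conv_rhs => rw [← Quotient.out_eq x]
      refine Quotient.sound ⟨Units.mk0 _ hx', ?_, ?_⟩
      · change _ = x.out.1.1 i • fun j => x.out.1.1 j / x.out.1.1 i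
        rw [h0, smul_smul, mul_inv_cancel₀ hx', one_smul]
      · change _ = ((Units.mk0 _ hx')⁻¹ : Kˣ).1 • fun j => x.out.1.1 i * x.out.1.2 j
        rw [h1, smul_smul, Units.val_inv_eq_inv_val, Units.val_mk0, inv_mul_cancel₀ hx', one_smul]

end Charts

/-! ### Forms, gradients and two-point interpolation -/

section Forms

open MvPolynomial

variable {R : Type*} [CommRing R] {n d : ℕ}

/-- The monomial with given exponents, over any commutative ring. -/
noncomputable def formMonomial (R : Type*) [CommRing R] {n d : ℕ} (m : Mon n d) :
    MvPolynomial (Fin (n + 1)) R :=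
  ∏ i, X i ^ m.1 i

/-- The polynomial with coefficient vector `F`. -/
noncomputable def toForm (F : Mon n d → R) : MvPolynomial (Fin (n + 1)) R :=
  ∑ m, C (F m) * formMonomial R m

/-- The value at `v` of the form with coefficient vector `F`. -/
noncomputable def evalForm (v : Fin (n + 1) → R) (F : Mon n d → R) : R :=
  ∑ m, F m * eval v (formMonomial R m)

/-- The gradient at `v` of the form with coefficient vector `F`. -/
noncomputable def gradForm (v : Fin (n + 1) → R) (F : Mon n d → R) (i : Fin (n + 1)) : R :=
  ∑ m, F m * eval v (pderiv i (formMonomial R m))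

/-- The coefficient vector of the degree `d` part of a polynomial. -/
noncomputable def formCoeffs (d : ℕ) (P : MvPolynomial (Fin (n + 1)) R) (m : Mon n d) : R :=
  coeff (Finsupp.equivFunOnFinite.symm m.1) P

theorem formMonomial_eq_monomial (m : Mon n d) :
    formMonomial R m = monomial (Finsupp.equivFunOnFinite.symm m.1) 1 := by
  rw [monomial_eq, C_1, one_mul, formMonomial, Finsupp.prod_fintype _ _ (fun i => pow_zero _)]
  rfl

theorem eval_toForm (v : Fin (n + 1) → R) (F : Mon n d → R) :
    eval v (toForm F) = evalForm v F := by
  simp [toForm, evalForm]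

theorem eval_pderiv_toForm (v : Fin (n + 1) → R) (F : Mon n d → R) (i : Fin (n + 1)) :
    eval v (pderiv i (toForm F)) = gradForm v F i := by
  simp [toForm, gradForm]

theorem toForm_formCoeffs {P : MvPolynomial (Fin (n + 1)) R} (hP : P.IsHomogeneous d) :
    toForm (formCoeffs d P) = P := by
  ext e
  simp only [toForm, coeff_sum, coeff_C_mul, formMonomial_eq_monomial, coeff_monomial]
  by_cases he : coeff e P = 0
  · rw [he]
    refine Finset.sum_eq_zero fun m _ => ?_
    split_ifs with h
    · rw [formCoeffs, h, he, zero_mul]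
    · rw [mul_zero]
  · have hdeg := hP he
    have hm : (e : Fin (n + 1) → ℕ) ∈ Finset.piAntidiag (Finset.univ : Finset (Fin (n + 1))) d := by
      rw [Finset.mem_piAntidiag]
      refine ⟨?_, fun i _ => Finset.mem_univ i⟩
      rw [← hdeg, ← Finsupp.degree_eq_sum, Finsupp.degree_eq_weight_one]
      rfl
    rw [Finset.sum_eq_single ⟨(e : Fin (n + 1) → ℕ), hm⟩]
    · simp [formCoeffs]
    · intro m _ hne
      rw [if_neg, mul_zero]
      intro h
      exact hne (Subtype.ext (congrArg DFunLike.coe h))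
    · simp

theorem formMonomial_isHomogeneous (m : Mon n d) : (formMonomial R m).IsHomogeneous d := by
  have hm := (Finset.mem_piAntidiag.1 m.2).1
  rw [formMonomial_eq_monomial]
  refine isHomogeneous_monomial _ ?_
  rw [Finsupp.degree_eq_sum]
  exact hm

theorem dotProduct_gradForm (v : Fin (n + 1) → R) (F : Mon n d → R) :
    v ⬝ᵥ gradForm v F = d * evalForm v F := by
  simp only [dotProduct, gradForm, evalForm, Finset.mul_sum]
  rw [Finset.sum_comm]
  refine Finset.sum_congr rfl fun m _ => ?_
  have := congrArg (eval v) (formMonomial_isHomogeneous (R := R) m).sum_X_mul_pderiv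
  simp only [map_sum, map_mul, eval_X, nsmul_eq_mul, map_natCast] at this
  rw [mul_left_comm, ← this, Finset.mul_sum]
  exact Finset.sum_congr rfl fun i _ => by ring

theorem ringHom_eval {S ι : Type*} [CommRing S] (φ : R →+* S) (v : ι → R)
    (P : MvPolynomial ι R) :
    φ (eval v P) = eval (fun i => φ (v i)) (MvPolynomial.map φ P) := by
  induction P using MvPolynomial.induction_on with
  | C a => simp
  | add p q hp hq => simp only [map_add, hp, hq]
  | mul_X p i hp => simp only [map_mul, hp, eval_X, MvPolynomial.map_X]

theorem map_formMonomial {S : Type*} [CommRing S] (φ : R →+* S) (m : Mon n d) :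
    MvPolynomial.map φ (formMonomial R m) = formMonomial S m := by
  simp [formMonomial]

theorem map_evalForm {S : Type*} [CommRing S] (φ : R →+* S) (v : Fin (n + 1) → R)
    (F : Mon n d → R) : φ (evalForm v F) = evalForm (fun i => φ (v i)) (fun m => φ (F m)) := by
  simp only [evalForm, map_sum, map_mul, ringHom_eval, map_formMonomial]

theorem map_gradForm {S : Type*} [CommRing S] (φ : R →+* S) (v : Fin (n + 1) → R)
    (F : Mon n d → R) (i : Fin (n + 1)) :
    φ (gradForm v F i) = gradForm (fun i => φ (v i)) (fun m => φ (F m)) i := by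
  simp only [gradForm, map_sum, map_mul, ringHom_eval, ← pderiv_map, map_formMonomial]

theorem eval_formMonomial (v : Fin (n + 1) → R) (m : Mon n d) :
    eval v (formMonomial R m) = ∏ i, v i ^ m.1 i := by
  simp [formMonomial]

theorem evalForm_smul (v : Fin (n + 1) → R) (c : R) (F : Mon n d → R) :
    evalForm v (c • F) = c * evalForm v F := by
  simp [evalForm, Finset.mul_sum, mul_assoc]

theorem gradForm_smul (v : Fin (n + 1) → R) (c : R) (F : Mon n d → R) :
    gradForm v (c • F) = c • gradForm v F := by
  ext i
  simp [gradForm, Finset.mul_sum, mul_assoc]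

theorem evalForm_add (v : Fin (n + 1) → R) (F G : Mon n d → R) :
    evalForm v (F + G) = evalForm v F + evalForm v G := by
  simp [evalForm, add_mul, Finset.sum_add_distrib]

theorem gradForm_add (v : Fin (n + 1) → R) (F G : Mon n d → R) :
    gradForm v (F + G) = gradForm v F + gradForm v G := by
  ext i
  simp [gradForm, add_mul, Finset.sum_add_distrib]

theorem eval_smul_of_isHomogeneous {P : MvPolynomial (Fin (n + 1)) R} {s : ℕ}
    (hP : P.IsHomogeneous s) (v : Fin (n + 1) → R) (t : R) :
    eval (t • v) P = t ^ s * eval v P := by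
  rw [eval_eq', eval_eq', Finset.mul_sum]
  refine Finset.sum_congr rfl fun e he => ?_
  have h1 := hP (mem_support_iff.1 he)
  rw [Finsupp.weight_apply, Finsupp.sum_fintype _ _ (by simp)] at h1
  simp only [Pi.one_apply, smul_eq_mul, mul_one] at h1
  simp only [Pi.smul_apply, smul_eq_mul, mul_pow, Finset.prod_mul_distrib,
    Finset.prod_pow_eq_pow_sum, h1]
  ring

theorem evalForm_smul_left (v : Fin (n + 1) → R) (t : R) (F : Mon n d → R) :
    evalForm (t • v) F = t ^ d * evalForm v F := by
  simp only [evalForm, eval_smul_of_isHomogeneous (formMonomial_isHomogeneous _), Finset.mul_sum]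
  exact Finset.sum_congr rfl fun m _ => by ring

theorem gradForm_smul_left (v : Fin (n + 1) → R) (t : R) (F : Mon n d → R) :
    gradForm (t • v) F = t ^ (d - 1) • gradForm v F := by
  ext i
  simp only [gradForm, eval_smul_of_isHomogeneous (formMonomial_isHomogeneous _).pderiv,
    Finset.mul_sum, Pi.smul_apply, smul_eq_mul]
  exact Finset.sum_congr rfl fun m _ => by ring

/-- The linear form with coefficients `a`. -/
noncomputable def linForm (a : Fin (n + 1) → R) : MvPolynomial (Fin (n + 1)) R :=
  ∑ j, C (a j) * X j

theorem linForm_isHomogeneous (a : Fin (n + 1) → R) : (linForm a).IsHomogeneous 1 :=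
  IsHomogeneous.sum _ _ _ fun j _ => by
    simpa using (isHomogeneous_C _ (a j)).mul (isHomogeneous_X R j)

theorem eval_linForm (v a : Fin (n + 1) → R) : eval v (linForm a) = a ⬝ᵥ v := by
  simp [linForm, dotProduct]

theorem pderiv_linForm (a : Fin (n + 1) → R) (i : Fin (n + 1)) :
    pderiv i (linForm a) = C (a i) := by
  simp [linForm, pderiv_X, Pi.single_apply]

/-- The coefficient vector of the form `ℓ ^ (d - 1) * μ`, where `ℓ` and `μ` are the linear forms
with coefficients `a` and `b`. -/
noncomputable def powForm (d : ℕ) (a b : Fin (n + 1) → R) : Mon n d → R :=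
  formCoeffs d (linForm a ^ (d - 1) * linForm b)

theorem toForm_powForm (hd : 1 ≤ d) (a b : Fin (n + 1) → R) :
    toForm (powForm d a b) = linForm a ^ (d - 1) * linForm b := by
  refine toForm_formCoeffs ?_
  have := ((linForm_isHomogeneous a).pow (d - 1)).mul (linForm_isHomogeneous b)
  rwa [one_mul, Nat.sub_add_cancel hd] at this

theorem evalForm_powForm (hd : 1 ≤ d) (v a b : Fin (n + 1) → R) :
    evalForm v (powForm d a b) = (a ⬝ᵥ v) ^ (d - 1) * (b ⬝ᵥ v) := by
  rw [← eval_toForm, toForm_powForm hd, map_mul, map_pow, eval_linForm, eval_linForm]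

theorem gradForm_powForm (hd : 1 ≤ d) (v a b : Fin (n + 1) → R) :
    gradForm v (powForm d a b) = (a ⬝ᵥ v) ^ (d - 1) • b +
      (((d - 1 : ℕ) : R) * (a ⬝ᵥ v) ^ (d - 2) * (b ⬝ᵥ v)) • a := by
  ext i
  rw [← eval_pderiv_toForm, toForm_powForm hd]
  simp only [Derivation.leibniz, Derivation.leibniz_pow, pderiv_linForm, smul_eq_mul, map_add,
    map_mul, map_pow, eval_linForm, eval_C, nsmul_eq_mul, map_natCast, Pi.add_apply,
    Pi.smul_apply, Nat.sub_sub]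
  ring

/-- A form that vanishes at `v` with gradient `(a ⬝ᵥ v) ^ d • ξ` there, depending
polynomially on all the data; it is obtained from the arbitrary form `G` by a correction of the
shape `ℓ ^ (d - 1) * μ`. -/
noncomputable def adjustForm (v ξ : Fin (n + 1) → R) (G : Mon n d → R) (a : Fin (n + 1) → R) :
    Mon n d → R :=
  (a ⬝ᵥ v) ^ d • G + powForm d a
    ((a ⬝ᵥ v) • ξ - (a ⬝ᵥ v) • gradForm v G + (((d - 1 : ℕ) : R) * evalForm v G) • a)

theorem adjustForm_slope (hd : 1 ≤ d) {v ξ : Fin (n + 1) → R} (h : v ⬝ᵥ ξ = 0) (G : Mon n d → R)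
    (a : Fin (n + 1) → R) :
    ((a ⬝ᵥ v) • ξ - (a ⬝ᵥ v) • gradForm v G + (((d - 1 : ℕ) : R) * evalForm v G) • a) ⬝ᵥ v =
      - ((a ⬝ᵥ v) * evalForm v G) := by
  rw [add_dotProduct, sub_dotProduct, smul_dotProduct, smul_dotProduct, smul_dotProduct,
    dotProduct_comm ξ, h, dotProduct_comm (gradForm v G), dotProduct_gradForm]
  obtain ⟨e, rfl⟩ := Nat.exists_eq_add_of_le hd
  simp only [smul_eq_mul, Nat.add_sub_cancel_left]
  push_cast
  ring

theorem evalForm_adjustForm (hd : 1 ≤ d) {v ξ : Fin (n + 1) → R} (h : v ⬝ᵥ ξ = 0)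
    (G : Mon n d → R) (a : Fin (n + 1) → R) : evalForm v (adjustForm v ξ G a) = 0 := by
  rw [adjustForm, evalForm_add, evalForm_smul, evalForm_powForm hd, adjustForm_slope hd h]
  obtain ⟨e, rfl⟩ := Nat.exists_eq_add_of_le hd
  simp only [Nat.add_sub_cancel_left]
  ring

theorem gradForm_adjustForm (hd : 2 ≤ d) {v ξ : Fin (n + 1) → R} (h : v ⬝ᵥ ξ = 0)
    (G : Mon n d → R) (a : Fin (n + 1) → R) :
    gradForm v (adjustForm v ξ G a) = (a ⬝ᵥ v) ^ d • ξ := by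
  rw [adjustForm, gradForm_add, gradForm_smul, gradForm_powForm (by omega),
    adjustForm_slope (by omega) h]
  obtain ⟨e, rfl⟩ := Nat.exists_eq_add_of_le hd
  ext i
  simp only [show 2 + e - 1 = e + 1 by omega, show 2 + e - 2 = e by omega, Pi.add_apply,
    Pi.sub_apply, Pi.smul_apply, smul_eq_mul]
  ring

theorem adjustForm_self {v : Fin (n + 1) → R} {G : Mon n d → R} (h : evalForm v G = 0)
    {a : Fin (n + 1) → R} (ha : a ⬝ᵥ v = 1) : adjustForm v (gradForm v G) G a = G := by
  rw [adjustForm, ha, h]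
  simp only [one_pow, one_smul, sub_self, mul_zero, zero_smul, add_zero]
  ext m
  simp [powForm, linForm, formCoeffs]

theorem map_dotProduct {S ι : Type*} [CommRing S] [Fintype ι] (φ : R →+* S) (v w : ι → R) :
    φ (v ⬝ᵥ w) = (fun i => φ (v i)) ⬝ᵥ (fun i => φ (w i)) := by
  simp [dotProduct]

theorem map_adjustForm {S : Type*} [CommRing S] (φ : R →+* S) (v ξ : Fin (n + 1) → R)
    (G : Mon n d → R) (a : Fin (n + 1) → R) (m : Mon n d) :
    φ (adjustForm v ξ G a m) = adjustForm (fun i => φ (v i)) (fun i => φ (ξ i))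
      (fun m => φ (G m)) (fun i => φ (a i)) m := by
  simp only [adjustForm, Pi.add_apply, Pi.smul_apply, smul_eq_mul, map_add, map_mul, map_pow,
    map_dotProduct, powForm, formCoeffs]
  congr 1
  rw [← coeff_map]
  congr 1
  simp only [map_mul, map_pow, linForm, map_sum, MvPolynomial.map_C, MvPolynomial.map_X,
    Pi.add_apply, Pi.sub_apply, Pi.smul_apply, smul_eq_mul, map_add, map_sub, map_natCast,
    map_dotProduct, map_evalForm, map_gradForm]

/-- Only `n + 1` of the coefficients of a form `x_i ^ (d - 1) * μ` with `μ` linear can be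
nonzero. -/
theorem exists_support_powForm_single [DecidableEq (Mon n d)] (i : Fin (n + 1)) :
    ∃ J : Finset (Mon n d), J.card ≤ n + 1 ∧
      ∀ (R : Type v) [CommRing R] (b : Fin (n + 1) → R), ∀ m ∉ J,
        powForm d (Pi.single i 1) b m = 0 := by
  classical
  let e : Fin (n + 1) → (Fin (n + 1) → ℕ) := fun j => Pi.single i (d - 1) + Pi.single j 1
  refine ⟨Finset.univ.filter fun m => ∃ j, m.1 = e j, ?_, ?_⟩
  · calc _ ≤ (Finset.univ.image e).card := by
          refine Finset.card_le_card_of_injOn Subtype.val ?_ Subtype.val_injective.injOn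
          intro m hm
          obtain ⟨j, hj⟩ := (Finset.mem_filter.1 hm).2
          exact Finset.mem_image.2 ⟨j, Finset.mem_univ _, hj.symm⟩
      _ ≤ Finset.card (Finset.univ : Finset (Fin (n + 1))) := Finset.card_image_le
      _ = n + 1 := by simp
  · intro R _ b m hm
    have hlin : linForm (Pi.single i 1 : Fin (n + 1) → R) = X i := by
      simp [linForm, Pi.single_apply]
    simp only [powForm, formCoeffs, hlin]
    rw [linForm, Finset.mul_sum, coeff_sum]
    refine Finset.sum_eq_zero fun j _ => ?_
    rw [mul_left_comm, coeff_C_mul, X_pow_eq_monomial, X, monomial_mul, coeff_monomial, if_neg,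
      mul_zero]
    intro h
    refine hm (Finset.mem_filter.2 ⟨Finset.mem_univ _, j, ?_⟩)
    have := congrArg (fun f : Fin (n + 1) →₀ ℕ => (f : Fin (n + 1) → ℕ)) h
    simp only [Finsupp.coe_add, Finsupp.single_eq_pi_single] at this
    exact this.symm

end Forms

section Rank

open MvPolynomial

variable {E : Type*} [Field E] {n d : ℕ}

/-- The conditions imposed on forms by value and gradient at `v`; the `i`-th derivative is
omitted, since by Euler's relation it is determined by the other data when `v i ≠ 0`. -/
noncomputable def jetMatrix (d : ℕ) (v : Fin (n + 1) → E) (i : Fin (n + 1)) :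
    Matrix (Fin (n + 1)) (Mon n d) E :=
  fun j m => if j = i then eval v (formMonomial E m) else eval v (pderiv j (formMonomial E m))

theorem jetMatrix_mulVec (v : Fin (n + 1) → E) (i j : Fin (n + 1)) (F : Mon n d → E) :
    (jetMatrix d v i).mulVec F j = if j = i then evalForm v F else gradForm v F j := by
  simp only [Matrix.mulVec, dotProduct, jetMatrix, evalForm, gradForm]
  split_ifs <;> exact Finset.sum_congr rfl fun m _ => mul_comm _ _

/-- If `ℓ` vanishes at `w` but not at `v`, the forms `ℓ ^ (d - 1) * μ` have arbitrary first order
behaviour at `v` and vanish to second order at `w`. -/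
theorem exists_jet (hd : 3 ≤ d) {v w a : Fin (n + 1) → E} (hav : a ⬝ᵥ v ≠ 0) (haw : a ⬝ᵥ w = 0)
    {i : Fin (n + 1)} (hi : v i ≠ 0) (y : Fin (n + 1) → E) (i' : Fin (n + 1)) :
    ∃ F : Mon n d → E, (jetMatrix d v i).mulVec F = y ∧ (jetMatrix d w i').mulVec F = 0 := by
  -- the gradient with the missing coordinate filled in
  obtain ⟨ξ, hξ, hξv⟩ : ∃ ξ : Fin (n + 1) → E, (∀ j ≠ i, ξ j = y j) ∧ ξ ⬝ᵥ v = d * y i := by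
    refine ⟨Function.update y i ((d * y i - ∑ j ∈ Finset.univ.erase i, y j * v j) / v i),
      fun j hj => Function.update_of_ne hj _ _, ?_⟩
    rw [dotProduct, ← Finset.add_sum_erase _ _ (Finset.mem_univ i)]
    have : ∑ j ∈ Finset.univ.erase i, Function.update y i
        ((d * y i - ∑ j ∈ Finset.univ.erase i, y j * v j) / v i) j * v j =
        ∑ j ∈ Finset.univ.erase i, y j * v j :=
      Finset.sum_congr rfl fun j hj => by
        rw [Function.update_of_ne (Finset.ne_of_mem_erase hj)]
    rw [this, Function.update_self]
    field_simp
    ring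
  obtain ⟨e, rfl⟩ := Nat.exists_eq_add_of_le hd
  set s := a ⬝ᵥ v with hs
  let b : Fin (n + 1) → E := (s ^ (2 + e))⁻¹ • ξ - (((2 + e : ℕ) : E) * (s ^ (3 + e))⁻¹ * y i) • a
  have hbv : b ⬝ᵥ v = (s ^ (2 + e))⁻¹ * y i := by
    simp only [b, sub_dotProduct, smul_dotProduct, hξv, ← hs, smul_eq_mul]
    push_cast
    field_simp
    ring
  have h1 : 3 + e - 1 = 2 + e := by omega
  have h2 : 3 + e - 2 = 1 + e := by omega
  refine ⟨powForm (3 + e) a b, ?_, ?_⟩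
  · ext j
    rw [jetMatrix_mulVec, evalForm_powForm (by omega), gradForm_powForm (by omega), ← hs, hbv, h1,
      h2]
    split_ifs with hj
    · rw [hj]
      field_simp
    · rw [← hξ j hj]
      simp only [Pi.add_apply, Pi.smul_apply, smul_eq_mul, b, Pi.sub_apply]
      field_simp
      ring
  · ext j
    rw [jetMatrix_mulVec, evalForm_powForm (by omega), gradForm_powForm (by omega), haw, h1, h2]
    split_ifs <;> simp

/-- For two distinct points of projective space and `d ≥ 3`, value and gradient at the two points
impose independent conditions on forms of degree `d`. -/
theorem twoPoint_surjective (hd : 3 ≤ d) {v w : Fin (n + 1) → E} {α β : Fin (n + 1)}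
    (h : v α * w β - v β * w α ≠ 0) {i i' : Fin (n + 1)} (hi : v i ≠ 0) (hi' : w i' ≠ 0) :
    Function.Surjective
      (Matrix.fromRows (jetMatrix d v i) (jetMatrix d w i')).mulVecLin := by
  have key : ∀ x y : Fin (n + 1) → E,
      (x α • Pi.single β 1 - x β • Pi.single α 1 : Fin (n + 1) → E) ⬝ᵥ y =
        x α * y β - x β * y α := by
    intro x y
    simp [sub_dotProduct, smul_dotProduct]
  intro y
  obtain ⟨F, hF1, hF2⟩ := exists_jet (d := d) (v := v) (w := w)
    (a := w α • Pi.single β 1 - w β • Pi.single α 1) hd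
    (by rw [key]; intro h0; apply h; linear_combination -h0) (by rw [key]; ring) hi
    (fun j => y (Sum.inl j)) i'
  obtain ⟨G, hG1, hG2⟩ := exists_jet (d := d) (v := w) (w := v)
    (a := v α • Pi.single β 1 - v β • Pi.single α 1) hd
    (by rw [key]; exact h) (by rw [key]; ring) hi'
    (fun j => y (Sum.inr j)) i
  refine ⟨F + G, ?_⟩
  ext (j | j)
  · rw [Matrix.mulVecLin_apply, Matrix.fromRows_mulVec, Sum.elim_inl, Matrix.mulVec_add, hF1, hG2,
      add_zero]
  · rw [Matrix.mulVecLin_apply, Matrix.fromRows_mulVec, Sum.elim_inr, Matrix.mulVec_add, hF2, hG1,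
      zero_add]

theorem two_mul_le_card_mon (hn : 1 ≤ n) (hd : 3 ≤ d) :
    2 * (n + 1) ≤ Fintype.card (Mon n d) := by
  have h01 : (0 : Fin (n + 1)) ≠ ⟨1, by omega⟩ := fun h => by
    simpa using congrArg Fin.val h
  have := twoPoint_surjective (E := ℚ) (n := n) (d := d) (v := Pi.single 0 1)
    (w := Pi.single ⟨1, by omega⟩ 1) hd (α := 0) (β := ⟨1, by omega⟩) (i := 0)
    (i' := ⟨1, by omega⟩) (by simp [h01]) (by simp) (by simp)
  have := LinearMap.finrank_le_finrank_of_surjective this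
  simp only [Module.finrank_fintype_fun_eq_card, Fintype.card_sum, Fintype.card_fin] at this
  omega

/-- A solution in an extension field of a linear system of full row rank is determined by all
but `r` of its entries, `r` being the number of equations. -/
theorem exists_determined_entries {L M r : Type*} [Field L] [Algebra E L] [Fintype M] [Fintype r]
    [DecidableEq M] (A : Matrix r M E) (hA : Function.Surjective A.mulVecLin) (b : r → E)
    (F : M → L) (hF : ∀ i, ∑ m, algebraMap E L (A i m) * F m = algebraMap E L (b i)) :
    ∃ J : Finset M, J.card = Fintype.card r ∧ ∀ m,
      F m ∈ Submodule.span E (insert 1 (F '' (Jᶜ : Finset M))) := by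
  classical
  let c : M → (r → E) := fun m i => A i m
  have hspan : ⊤ ≤ Submodule.span E (Set.range c) := by
    rintro y -
    obtain ⟨x, rfl⟩ := hA y
    have : A.mulVecLin x = ∑ m, x m • c m := by
      ext i
      simp [Matrix.mulVec, dotProduct, c, mul_comm]
    rw [this]
    exact Submodule.sum_mem _ fun m _ => Submodule.smul_mem _ _ (Submodule.subset_span ⟨m, rfl⟩)
  obtain ⟨J₀, hJspan, hJli⟩ : ∃ J₀ : Set M,
      Submodule.span E (c '' J₀) = Submodule.span E (Set.range c) ∧
      LinearIndependent E (fun m : J₀ => c m) := by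
    obtain ⟨κ, a, ha, h1, h2⟩ := exists_linearIndependent' E c
    refine ⟨Set.range a, ?_, ?_⟩
    · rw [← h1, ← Set.range_comp]
    · exact (linearIndepOn_range_iff ha c).2 h2
  have hJspan' : ⊤ ≤ Submodule.span E (Set.range fun m : J₀ => c m) := by
    rw [← Set.image_eq_range, hJspan]
    exact hspan
  let B := Module.Basis.mk hJli hJspan'
  refine ⟨J₀.toFinset, ?_, ?_⟩
  · have := Module.finrank_eq_card_basis B
    rw [Module.finrank_fintype_fun_eq_card] at this
    rw [this, Set.toFinset_card]
  · intro m
    set T := Submodule.span E (insert 1 (F '' (J₀.toFinsetᶜ : Finset M))) with hT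
    have h1T : ∀ e : E, algebraMap E L e ∈ T := fun e => by
      rw [Algebra.algebraMap_eq_smul_one]
      exact Submodule.smul_mem _ _ (Submodule.subset_span (Set.mem_insert _ _))
    have hFT : ∀ m ∉ J₀, F m ∈ T := fun m hm =>
      Submodule.subset_span (Set.mem_insert_of_mem _ ⟨m, by simpa using hm, rfl⟩)
    by_cases hm : m ∈ J₀
    · -- apply the coordinate functional dual to the column `m` to the system
      let φ : (r → E) →ₗ[E] E := B.coord ⟨m, hm⟩
      have hφ : ∀ y : r → E, φ y = ∑ i, y i * φ (Pi.single i 1) := by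
        intro y
        conv_lhs => rw [pi_eq_sum_univ y]
        rw [map_sum]
        refine Finset.sum_congr rfl fun i _ => ?_
        rw [map_smul, smul_eq_mul]
        congr 2
        ext j
        simp [Pi.single_apply, eq_comm]
      have hsum : ∑ m', algebraMap E L (φ (c m')) * F m' = algebraMap E L (φ b) := by
        rw [hφ b, map_sum]
        simp only [map_mul, ← hF, Finset.sum_mul]
        rw [Finset.sum_comm]
        refine Finset.sum_congr rfl fun m' _ => ?_
        rw [hφ (c m'), map_sum, Finset.sum_mul]
        refine Finset.sum_congr rfl fun i _ => ?_
        simp only [map_mul, c]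
        ring
      have hφJ : ∀ m' ∈ J₀, φ (c m') = if m' = m then 1 else 0 := by
        intro m' hm'
        have : c m' = B ⟨m', hm'⟩ := by simp [B]
        rw [this]
        simp [φ, Module.Basis.coord_apply, Finsupp.single_apply]
      have hrest : ∀ m' ∈ Finset.univ.erase m, algebraMap E L (φ (c m')) * F m' ∈ T := by
        intro m' hm'
        by_cases h : m' ∈ J₀
        · rw [hφJ m' h, if_neg (Finset.ne_of_mem_erase hm'), map_zero, zero_mul]
          exact T.zero_mem
        · rw [← Algebra.smul_def]
          exact T.smul_mem _ (hFT m' h)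
      rw [← Finset.add_sum_erase _ _ (Finset.mem_univ m), hφJ m hm, if_pos rfl, map_one,
        one_mul] at hsum
      rw [eq_sub_of_add_eq hsum]
      exact T.sub_mem (h1T _) (T.sum_mem hrest)
    · exact hFT m hm

/-- The transcendence degree of a form vanishing at two distinct points, in terms of its
gradients there. -/
theorem td_twoPoint_le {k L : Type*} [Field k] [Field L] [Algebra k L] (hd : 3 ≤ d)
    {v w : Fin (n + 1) → L} {F : Mon n d → L} {α β : Fin (n + 1)}
    (h : v α * w β - v β * w α ≠ 0) (hv : evalForm v F = 0) (hw : evalForm w F = 0) :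
    td k (Set.range v ∪ Set.range w ∪ Set.range F) + (2 * (n + 1) : ℕ) ≤
      td k (Set.range v ∪ Set.range (gradForm v F)) +
      td k (Set.range w ∪ Set.range (gradForm w F)) + (Fintype.card (Mon n d) : ℕ) := by
  classical
  obtain ⟨i, hi⟩ : ∃ i, v i ≠ 0 := by
    by_contra hcon
    push Not at hcon
    exact h (by rw [hcon, hcon]; ring)
  obtain ⟨i', hi'⟩ : ∃ i, w i ≠ 0 := by
    by_contra hcon
    push Not at hcon
    exact h (by rw [hcon, hcon]; ring)
  set S₁ := Set.range v ∪ Set.range (gradForm v F) with hS₁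
  set S₂ := Set.range w ∪ Set.range (gradForm w F) with hS₂
  set E' := algClo k (S₁ ∪ S₂) with hE'
  have hsub := subset_algClo (k := k) (S₁ ∪ S₂)
  let v' : Fin (n + 1) → E' := fun j => ⟨v j, hsub (Or.inl (Or.inl ⟨j, rfl⟩))⟩
  let w' : Fin (n + 1) → E' := fun j => ⟨w j, hsub (Or.inr (Or.inl ⟨j, rfl⟩))⟩
  let g : Fin (n + 1) → E' := fun j => ⟨gradForm v F j, hsub (Or.inl (Or.inr ⟨j, rfl⟩))⟩
  let g' : Fin (n + 1) → E' := fun j => ⟨gradForm w F j, hsub (Or.inr (Or.inr ⟨j, rfl⟩))⟩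
  have hsurj := twoPoint_surjective (d := d) (v := v') (w := w') (α := α) (β := β) (i := i)
    (i' := i') hd (fun h0 => h (congrArg Subtype.val h0)) (fun h0 => hi (congrArg Subtype.val h0))
    (fun h0 => hi' (congrArg Subtype.val h0))
  have hjet : ∀ (x : Fin (n + 1) → E') (j l : Fin (n + 1)) (m : Mon n d),
      algebraMap E' L (jetMatrix d x l j m) = jetMatrix d (fun i => (x i : L)) l j m := by
    intro x j l m
    have e1 : ∀ P : MvPolynomial (Fin (n + 1)) E', algebraMap E' L (eval x P) =
        eval (fun i => (x i : L)) (MvPolynomial.map (algebraMap E' L) P) :=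
      fun P => ringHom_eval (algebraMap E' L) x P
    simp only [jetMatrix]
    split_ifs
    · rw [e1, map_formMonomial]
    · rw [e1, ← pderiv_map, map_formMonomial]
  obtain ⟨J, hJ, hJF⟩ := exists_determined_entries
    (Matrix.fromRows (jetMatrix d v' i) (jetMatrix d w' i')) hsurj
    (Sum.elim (fun j => if j = i then 0 else g j) (fun j => if j = i' then 0 else g' j)) F (by
      rintro (j | j)
      · have := jetMatrix_mulVec v i j F
        simp only [Matrix.mulVec, dotProduct, hv] at this
        simp only [Matrix.fromRows_apply_inl, hjet, Sum.elim_inl]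
        rw [show (fun i => ((v' i : E') : L)) = v from rfl, this]
        split_ifs <;> simp [g]
      · have := jetMatrix_mulVec w i' j F
        simp only [Matrix.mulVec, dotProduct, hw] at this
        simp only [Matrix.fromRows_apply_inr, hjet, Sum.elim_inr]
        rw [show (fun i => ((w' i : E') : L)) = w from rfl, this]
        split_ifs <;> simp [g'])
  have hle : td k (Set.range v ∪ Set.range w ∪ Set.range F) ≤
      td k (S₁ ∪ S₂) + (Jᶜ.card : ℕ) := by
    have h1 : Set.range v ∪ Set.range w ∪ Set.range F ⊆
        algClo k ((S₁ ∪ S₂) ∪ F '' (Jᶜ : Finset _)) := by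
      have hs := subset_algClo (k := k) ((S₁ ∪ S₂) ∪ F '' (Jᶜ : Finset _))
      have hm := algClo_mono (k := k)
        (Set.subset_union_left (s := S₁ ∪ S₂) (t := F '' (Jᶜ : Finset _)))
      rintro x ((⟨j, rfl⟩ | ⟨j, rfl⟩) | ⟨m, rfl⟩)
      · exact hs (Or.inl (Or.inl (Or.inl ⟨j, rfl⟩)))
      · exact hs (Or.inl (Or.inr (Or.inl ⟨j, rfl⟩)))
      · refine Submodule.span_induction (p := fun x _ => x ∈ algClo k
          ((S₁ ∪ S₂) ∪ F '' (Jᶜ : Finset _))) ?_ (zero_mem _) (fun _ _ _ _ => add_mem)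
          (fun e x _ hx => ?_) (hJF m)
        · rintro x (rfl | hx)
          · exact one_mem _
          · exact hs (Or.inr hx)
        · rw [Algebra.smul_def]
          exact mul_mem (hm e.2) hx
    refine (td_le_of_subset_algClo h1).trans ((td_union_le_encard _ _).trans ?_)
    gcongr
    refine (Set.encard_image_le _ _).trans ?_
    rw [Set.encard_coe_eq_coe_finsetCard]
  have hJc : Jᶜ.card + 2 * (n + 1) = Fintype.card (Mon n d) := by
    have h1 := Finset.card_add_card_compl J
    simp only [hJ, Fintype.card_sum, Fintype.card_fin] at h1
    omega
  rw [← hJc]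
  push_cast
  calc _ ≤ td k (S₁ ∪ S₂) + (Jᶜ.card : ℕ∞) + 2 * (n + 1) := by gcongr
    _ ≤ td k S₁ + td k S₂ + (Jᶜ.card : ℕ∞) + 2 * (n + 1) := by
      gcongr
      exact td_union_le _ _
    _ = _ := by rw [add_assoc]

end Rank

/-! ### Elimination theory and finite decompositions -/

section Elimination

open MvPolynomial

variable {k : Type v} {K : Type u} [Field k] [Field K] [Algebra k K]

theorem IsPointOf.prod [Infinite K] {σ τ : Type*} {L : Type*} [Field L] [Algebra k L]
    {S : Set (σ → K)} {x : σ → L} (hx : IsPointOf k S x) (t : τ → L) :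
    IsPointOf k {p : σ ⊕ τ → K | (fun i => p (Sum.inl i)) ∈ S} (Sum.elim x t) := by
  intro f hf
  have h1 : substLeft f x = 0 := by
    ext a
    rw [substLeft, coeff_map, coeff_zero]
    refine hx _ fun p hp => ?_
    have h2 : substLeft f p = 0 := MvPolynomial.funext fun s => by
      rw [eval_substLeft, map_zero]
      exact hf _ hp
    have h3 := congrArg (coeff a) h2
    rwa [substLeft, coeff_map, coeff_zero] at h3
  rw [← eval_substLeft, h1, map_zero]

variable {n : ℕ}

theorem evalForm_formCoeffs {R : Type*} [CommRing R] (s : ℕ) (P : MvPolynomial (Fin (n + 1)) R)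
    (v : Fin (n + 1) → R) : evalForm v (formCoeffs s P) = eval v (homogeneousComponent s P) := by
  have h1 : formCoeffs s P = formCoeffs s (homogeneousComponent s P) := by
    ext m
    rw [formCoeffs, formCoeffs, coeff_homogeneousComponent, if_pos]
    rw [Finsupp.degree_eq_sum]
    exact (Finset.mem_piAntidiag.1 m.2).1
  rw [h1, ← eval_toForm, toForm_formCoeffs (homogeneousComponent_isHomogeneous s P)]

theorem eval_homogeneousComponent_eq_zero [Infinite K] {P : MvPolynomial (Fin (n + 1)) K}
    {v : Fin (n + 1) → K} (h : ∀ t : K, t ≠ 0 → eval (t • v) P = 0) (s : ℕ) :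
    eval v (homogeneousComponent s P) = 0 := by
  let Q : Polynomial K := ∑ s ∈ Finset.range (P.totalDegree + 1),
    Polynomial.monomial s (eval v (homogeneousComponent s P))
  have hQ : ∀ t : K, Q.eval t = eval (t • v) P := by
    intro t
    conv_rhs => rw [← sum_homogeneousComponent P]
    rw [Polynomial.eval_finsetSum, map_sum]
    refine Finset.sum_congr rfl fun s _ => ?_
    rw [Polynomial.eval_monomial, ← evalForm_formCoeffs, ← evalForm_formCoeffs, evalForm_smul_left,
      mul_comm]
  have hQ0 : Q = 0 := by
    refine Polynomial.eq_zero_of_infinite_isRoot Q ?_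
    refine Set.Infinite.mono (s := {0}ᶜ) (fun t ht => ?_) (Set.finite_singleton 0).infinite_compl
    exact (hQ t).trans (h t ht)
  by_cases hs : s ∈ Finset.range (P.totalDegree + 1)
  · have h2 := congrArg (fun q => Polynomial.coeff q s) hQ0
    simp only [Q, Polynomial.finsetSum_coeff, Polynomial.coeff_monomial, Polynomial.coeff_zero] at h2
    rwa [Finset.sum_ite_eq' , if_pos hs] at h2
  · rw [homogeneousComponent_eq_zero, map_zero]
    simpa using hs

/-- The main theorem of elimination theory: for equations that are invariant under scaling of
`v`, the set of parameters `c` for which there is a nonzero solution `v` is closed.  Invariance is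
only required for the parameters with the property `Q`, such as being nonzero. -/
theorem exists_elimination [IsAlgClosed K] {τ : Type*}
    (I : Set (MvPolynomial (τ ⊕ Fin (n + 1)) k)) (Q : (τ → K) → Prop)
    (hI : ∀ (c : τ → K) (v : Fin (n + 1) → K) (t : K), Q c → t ≠ 0 → v ≠ 0 →
      (∀ f ∈ I, aeval (Sum.elim c v) f = 0) → ∀ f ∈ I, aeval (Sum.elim c (t • v)) f = 0)
    (c : τ → K) (hc : ∀ v : Fin (n + 1) → K, v ≠ 0 → ∃ f ∈ I, aeval (Sum.elim c v) f ≠ 0) :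
    ∃ g : MvPolynomial τ k, aeval c g ≠ 0 ∧ ∀ c' : τ → K, Q c' → aeval c' g ≠ 0 →
      ∀ v : Fin (n + 1) → K, v ≠ 0 → ∃ f ∈ I, aeval (Sum.elim c' v) f ≠ 0 := by
  classical
  have hinf : Infinite K := IsAlgClosed.instInfinite
  let J : (τ → K) → Ideal (MvPolynomial (Fin (n + 1)) K) := fun c =>
    Ideal.span ((fun f => substLeft f c) '' I)
  -- by the Nullstellensatz, all forms of some degree `s` lie in the ideal `J c`
  have hX : ∀ i, ∃ N, (X i : MvPolynomial (Fin (n + 1)) K) ^ N ∈ J c := by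
    intro i
    have : (X i : MvPolynomial (Fin (n + 1)) K) ∈ vanishingIdeal K (zeroLocus K (J c)) := by
      rw [mem_vanishingIdeal_iff]
      intro v hv
      by_contra hvi
      have hv0 : v ≠ 0 := by
        rintro rfl
        simp at hvi
      obtain ⟨f, hf, hfv⟩ := hc v hv0
      refine hfv ?_
      have h1 : aeval v (substLeft f c) = 0 := hv _ (Ideal.subset_span ⟨f, hf, rfl⟩)
      rwa [aeval_eq_eval, eval_substLeft] at h1
    rwa [vanishingIdeal_zeroLocus_eq_radical] at this
  choose N hN using hX
  let s := ∑ i, N i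
  have hmon : ∀ m : Mon n s, formMonomial K m ∈ J c := by
    intro m
    obtain ⟨i, hi⟩ : ∃ i, N i ≤ m.1 i := by
      by_contra hcon
      push Not at hcon
      have h1 := (Finset.mem_piAntidiag.1 m.2).1
      have h2 : ∑ i, m.1 i < ∑ i, N i :=
        Finset.sum_lt_sum_of_nonempty Finset.univ_nonempty fun i _ => hcon i
      have h3 : Finset.univ.sum m.1 = s := h1
      exact absurd h3 h2.ne
    rw [formMonomial, ← Finset.mul_prod_erase _ _ (Finset.mem_univ i),
      ← Nat.sub_add_cancel hi, pow_add, mul_assoc, mul_comm, mul_assoc]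
    exact Ideal.mul_mem_right _ _ (hN i)
  -- coefficient vectors of multiples of the equations
  let P : I × (Fin (n + 1) →₀ ℕ) → MvPolynomial (τ ⊕ Fin (n + 1)) k := fun p =>
    rename Sum.inr (monomial p.2 1) * p.1.1
  let b : I × (Fin (n + 1) →₀ ℕ) → (Mon n s → K) := fun p => formCoeffs s (substLeft (P p) c)
  have hmul : ∀ (c : τ → K) (p : I × (Fin (n + 1) →₀ ℕ)),
      substLeft (P p) c = monomial p.2 1 * substLeft p.1.1 c := by
    intro c p
    refine MvPolynomial.funext fun t => ?_
    rw [eval_substLeft, map_mul, map_mul, eval_substLeft, aeval_rename]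
    congr 1
    simp only [Function.comp_def, Sum.elim_inr]
    rw [aeval_monomial, eval_monomial, map_one]
  have hspan : ⊤ ≤ Submodule.span K (Set.range b) := by
    have h1 : ∀ q ∈ J c, ∀ r : MvPolynomial (Fin (n + 1)) K,
        formCoeffs s (r * q) ∈ Submodule.span K (Set.range b) := by
      have hadd : ∀ p q : MvPolynomial (Fin (n + 1)) K,
          formCoeffs s (p + q) = formCoeffs s p + formCoeffs s q := by
        intro p q
        ext m
        simp [formCoeffs]
      intro q hq
      refine Submodule.span_induction
        (p := fun q _ => ∀ r, formCoeffs s (r * q) ∈ Submodule.span K (Set.range b))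
        ?_ ?_ ?_ ?_ hq
      · rintro _ ⟨f, hf, rfl⟩ r
        induction r using MvPolynomial.induction_on' with
        | monomial a e =>
          have : formCoeffs s (monomial a e * substLeft f c) = e • b (⟨f, hf⟩, a) := by
            ext m
            simp only [b, hmul, formCoeffs, Pi.smul_apply, smul_eq_mul]
            rw [← coeff_C_mul, ← mul_assoc, C_mul_monomial, mul_one]
          rw [this]
          exact Submodule.smul_mem _ _ (Submodule.subset_span ⟨_, rfl⟩)
        | add p q hp hq =>
          simp only [add_mul, hadd] at *
          exact Submodule.add_mem _ hp hq
      · intro r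
        have : formCoeffs s (r * (0 : MvPolynomial (Fin (n + 1)) K)) = 0 := by
          ext m
          simp [formCoeffs]
        rw [this]
        exact Submodule.zero_mem _
      · intro p q _ _ hp hq r
        rw [mul_add, hadd]
        exact Submodule.add_mem _ (hp r) (hq r)
      · intro a q _ hq r
        rw [smul_eq_mul, ← mul_assoc]
        exact hq _
    rintro y -
    rw [pi_eq_sum_univ y]
    refine Submodule.sum_mem _ fun m _ => Submodule.smul_mem _ _ ?_
    have h2 := h1 _ (hmon m) 1
    convert h2 using 1
    ext m'
    rw [one_mul, formCoeffs, formMonomial_eq_monomial, coeff_monomial]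
    refine if_congr ⟨?_, ?_⟩ rfl rfl
    · rintro rfl
      rfl
    · intro h
      exact Subtype.ext (Finsupp.equivFunOnFinite.symm.injective h)
  obtain ⟨κ, e, he, hspan', hli⟩ := exists_linearIndependent' K b
  rw [← hspan'] at hspan
  let B := Module.Basis.mk hli hspan
  have hfin : Finite κ := Module.Finite.finite_basis B
  have := Fintype.ofFinite κ
  have hcard : Fintype.card κ = Fintype.card (Mon n s) := by
    rw [← Module.finrank_eq_card_basis B, Module.finrank_fintype_fun_eq_card]
  let ε : Mon n s ≃ κ := Fintype.equivOfCardEq hcard.symm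
  -- the determinant of the coefficient vectors, as a polynomial in the parameters
  let A : Matrix (Mon n s) (Mon n s) (MvPolynomial τ k) := fun i m =>
    coeff (Finsupp.equivFunOnFinite.symm m.1)
      (aeval (Sum.elim (fun i => C (X i)) X) (P (e (ε i))) :
        MvPolynomial (Fin (n + 1)) (MvPolynomial τ k))
  have hA : ∀ c' : τ → K, aeval c' A.det =
      (Matrix.of fun i => formCoeffs s (substLeft (P (e (ε i))) c')).det := by
    intro c'
    have := RingHom.map_det (aeval c' : MvPolynomial τ k →ₐ[k] K).toRingHom A
    refine this.trans ?_
    congr 1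
  refine ⟨A.det, ?_, fun c' hQ hc' v hv => ?_⟩
  · rw [hA]
    have h1 : LinearIndependent K (Matrix.of fun i => b (e (ε i))).row :=
      hli.comp ε ε.injective
    exact (Matrix.isUnit_iff_isUnit_det _).1
      (Matrix.linearIndependent_rows_iff_isUnit.1 h1) |>.ne_zero
  · by_contra hcon
    push Not at hcon
    rw [hA] at hc'
    set D : Matrix (Mon n s) (Mon n s) K :=
      Matrix.of fun i => formCoeffs s (substLeft (P (e (ε i))) c') with hD
    -- evaluation at `v` kills all rows of the invertible matrix `D`
    have hrow : D.mulVec (fun m => eval v (formMonomial K m)) = 0 := by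
      ext i
      change evalForm v (formCoeffs s (substLeft (P (e (ε i))) c')) = 0
      rw [evalForm_formCoeffs]
      refine eval_homogeneousComponent_eq_zero (fun t ht => ?_) s
      rw [hmul, map_mul, eval_substLeft, hI c' v t hQ ht hv hcon _ (e (ε i)).1.2, mul_zero]
    have h0 := Matrix.eq_zero_of_mulVec_eq_zero hc' hrow
    refine hv (funext fun i => ?_)
    have hm : Pi.single i s ∈ Finset.piAntidiag (Finset.univ : Finset (Fin (n + 1))) s := by
      simp [Finset.mem_piAntidiag]
    have h1 := congrFun h0 ⟨Pi.single i s, hm⟩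
    simp only [eval_formMonomial, Pi.zero_apply, Finset.prod_eq_zero_iff, Finset.mem_univ,
      true_and] at h1
    obtain ⟨j, hj⟩ := h1
    by_cases hji : j = i
    · subst hji
      exact eq_zero_of_pow_eq_zero hj
    · rw [Pi.single_eq_of_ne hji, pow_zero] at hj
      exact absurd hj one_ne_zero

end Elimination

section Noetherian

open MvPolynomial CoordSpace

variable {k : Type v} {K : Type u} [Field k] [Field K] [Algebra k K]
variable {X : Type w} [CoordSpace K X]

/-- The topology is noetherian because the polynomial ring is. -/
theorem noetherianSpace_zariski [Finite (Idx X)]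
    (hpt : Function.Surjective (pt : Dom X → X)) :
    @TopologicalSpace.NoetherianSpace X (zariski k) := by
  let _ : TopologicalSpace X := zariski k
  let φ : TopologicalSpace.Opens X → Ideal (MvPolynomial (Idx X) k) := fun U =>
    vanishingIdeal k (hat (U : Set X)ᶜ)
  have hφ : StrictMono φ := by
    intro U V hUV
    have hle : φ U ≤ φ V := vanishingIdeal_anti_mono (by
      rintro _ ⟨p, hp, rfl⟩
      exact ⟨p, fun h => hp (hUV.le h), rfl⟩)
    refine lt_of_le_of_ne hle fun heq => hUV.not_ge fun x hx => ?_
    by_contra hxU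
    have hclosed : ZClosed k (U : Set X)ᶜ := U.isOpen.isClosed_compl
    have hV : ZOpen k (V : Set X) := V.isOpen
    obtain ⟨p, rfl⟩ := hpt x
    obtain ⟨f, hf, hfV⟩ := hV.exists_poly hx
    have h1 : f ∈ φ V := by
      rintro _ ⟨q, hq, rfl⟩
      by_contra hqf
      exact hq (hfV q hqf)
    rw [← heq] at h1
    exact hf (h1 _ ⟨p, hxU, rfl⟩)
  exact hφ.wellFoundedGT

/-- Every set of points is a finite union of irreducible subsets. -/
theorem exists_finite_irreducible_cover [Finite (Idx X)]
    (hpt : Function.Surjective (pt : Dom X → X)) (S : Set X) :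
    ∃ 𝓕 : Set (Set X), 𝓕.Finite ∧ (∀ T ∈ 𝓕, ZIrreducible k T ∧ T ⊆ S) ∧ S = ⋃₀ 𝓕 := by
  let _ : TopologicalSpace X := zariski k
  have := noetherianSpace_zariski (k := k) hpt
  have : TopologicalSpace.NoetherianSpace S :=
    Topology.IsInducing.subtypeVal.noetherianSpace
  obtain ⟨𝓕, hfin, -, hirr, hcov⟩ :=
    TopologicalSpace.NoetherianSpace.exists_finite_set_isClosed_irreducible
      (isClosed_univ : IsClosed (Set.univ : Set S))
  refine ⟨(fun T => Subtype.val '' T) '' 𝓕, hfin.image _, ?_, ?_⟩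
  · rintro _ ⟨T, hT, rfl⟩
    refine ⟨(hirr T hT).image _ continuous_subtype_val.continuousOn, ?_⟩
    rintro _ ⟨s, -, rfl⟩
    exact s.2
  · ext x
    constructor
    · intro hx
      have : (⟨x, hx⟩ : S) ∈ ⋃₀ 𝓕 := hcov ▸ Set.mem_univ _
      obtain ⟨T, hT, hxT⟩ := this
      exact ⟨_, ⟨T, hT, rfl⟩, _, hxT, rfl⟩
    · rintro ⟨_, ⟨T, hT, rfl⟩, s, -, rfl⟩
      exact s.2

/-- An irreducible subset of a finite union of closed sets lies in one of them. -/
theorem ZIrreducible.exists_subset {S : Set X} (hS : ZIrreducible k S) {𝓕 : Set (Set X)}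
    (hfin : 𝓕.Finite) (hcl : ∀ T ∈ 𝓕, ZClosed k T) (h : S ⊆ ⋃₀ 𝓕) : ∃ T ∈ 𝓕, S ⊆ T := by
  let _ : TopologicalSpace X := zariski k
  have := isIrreducible_iff_sUnion_isClosed.1 hS hfin.toFinset
    (fun T hT => hcl T (hfin.mem_toFinset.1 hT)) (by simpa using h)
  obtain ⟨T, hT, hST⟩ := this
  exact ⟨T, hfin.mem_toFinset.1 hT, hST⟩

end Noetherian

/-! ### Cones of covectors and the lift to the incidence variety -/

section Cones

open MvPolynomial CoordSpace

variable {k : Type v} {K : Type u} [Field k] [Field K] [Algebra k K]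

section

variable {σ : Type} [Fintype σ]

/-- The covector at `[v]` given by `ξ` is defined and lies in `C`. -/
def InCone (C : Set (Cotangent K σ)) (v ξ : σ → K) : Prop :=
  ∃ (hv : v ≠ 0) (h : v ⬝ᵥ ξ = 0), Cotangent.mk v ξ hv h ∈ C

variable {C : Set (Cotangent K σ)} {v ξ : σ → K}

theorem mem_hat_iff {y : σ ⊕ σ → K} :
    y ∈ hat C ↔ InCone C (fun i => y (Sum.inl i)) (fun i => y (Sum.inr i)) := by
  constructor
  · rintro ⟨⟨⟨v, ξ⟩, hv, h⟩, hp, rfl⟩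
    exact ⟨hv, h, hp⟩
  · rintro ⟨hv, h, hp⟩
    refine ⟨⟨(_, _), hv, h⟩, hp, ?_⟩
    ext (i | i) <;> rfl

theorem inCone_iff_mem_hat : InCone C v ξ ↔ Sum.elim v ξ ∈ hat C := by
  rw [mem_hat_iff]
  rfl

theorem exists_cotangent_rep (x : Cotangent K σ) :
    ∃ (v ξ : σ → K) (hv : v ≠ 0) (h : v ⬝ᵥ ξ = 0), x = Cotangent.mk v ξ hv h := by
  obtain ⟨⟨⟨v, ξ⟩, hv, h⟩, rfl⟩ := Quotient.exists_rep x
  exact ⟨v, ξ, hv, h, rfl⟩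

theorem InCone.smul (hC : IsConical C) (h : InCone C v ξ) {t s : K} (ht : t ≠ 0) (hs : s ≠ 0) :
    InCone C (t • v) (s • ξ) := by
  obtain ⟨hv, h0, hm⟩ := h
  have h1 := hC v ξ hv h0 (t * s) (mul_ne_zero ht hs) hm
  refine ⟨smul_ne_zero ht hv, by simp [h0], ?_⟩
  have h2 : Cotangent.mk (t • v) (s • ξ) (smul_ne_zero ht hv) (by simp [h0]) =
      Cotangent.mk v ((t * s) • ξ) hv (by simp [h0]) := by
    refine (Quotient.sound (s := cotangentSetoid K σ) ?_).symm
    refine ⟨Units.mk0 t ht, rfl, ?_⟩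
    change s • ξ = ((Units.mk0 t ht)⁻¹ : Kˣ).1 • ((t * s) • ξ)
    rw [smul_smul, Units.val_inv_eq_inv_val, Units.val_mk0, inv_mul_cancel_left₀ ht]
  rw [h2]
  exact h1

theorem ZClosed.inCone (hC : ZClosed k C) (hv : v ≠ 0) (h : v ⬝ᵥ ξ = 0)
    (hp : IsPointOf k (hat C) (Sum.elim v ξ)) : InCone C v ξ :=
  ⟨hv, h, zclosed_iff.1 hC ⟨(v, ξ), hv, h⟩ hp⟩

/-- Points of the cone over an extension field are orthogonal pairs. -/
theorem IsPointOf.dotProduct_eq_zero {L : Type*} [Field L] [Algebra k L] {v ξ : σ → L}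
    (h : IsPointOf k (hat C) (Sum.elim v ξ)) : v ⬝ᵥ ξ = 0 := by
  have := h (∑ i, X (Sum.inl i) * X (Sum.inr i)) (fun y hy => by
    obtain ⟨-, h, -⟩ := mem_hat_iff.1 hy
    simpa [dotProduct] using h)
  simpa [dotProduct] using this

/-- The polynomial `t * f(v, t ξ)` in the variables `v`, `ξ`, `t`. -/
noncomputable def fibreScale {ι : Type*} (f : MvPolynomial (ι ⊕ ι) k) : MvPolynomial ((ι ⊕ ι) ⊕ Unit) k :=
  X (Sum.inr ()) * aeval (Sum.elim (fun i => X (Sum.inl (Sum.inl i)))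
    (fun i => X (Sum.inr ()) * X (Sum.inl (Sum.inr i)))) f

theorem aeval_fibreScale {ι : Type*} {R : Type*} [Field R] [Algebra k R] (f : MvPolynomial (ι ⊕ ι) k)
    (y : (ι ⊕ ι) ⊕ Unit → R) :
    aeval y (fibreScale f) = y (Sum.inr ()) * aeval (Sum.elim (fun i => y (Sum.inl (Sum.inl i)))
      (y (Sum.inr ()) • fun i => y (Sum.inl (Sum.inr i)))) f := by
  rw [fibreScale, map_mul, aeval_X, ← AlgHom.comp_apply, comp_aeval]
  congr 3
  ext (i | i) <;> simp

/-- Over any extension field, the points of a conical set are stable under scaling. -/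
theorem IsPointOf.smul [Infinite K] (hC : IsConical C) {L : Type*} [Field L] [Algebra k L]
    {v ξ : σ → L} (h : IsPointOf k (hat C) (Sum.elim v ξ)) {t : L} (ht : t ≠ 0) :
    IsPointOf k (hat C) (Sum.elim v (t • ξ)) := by
  intro f hf
  have h1 := h.prod (fun _ : Unit => t)
  have h2 := h1 (fibreScale f) (fun y hy => by
    rw [aeval_fibreScale]
    by_cases hy0 : y (Sum.inr ()) = 0
    · rw [hy0, zero_mul]
    · rw [hf _ (inCone_iff_mem_hat.1 ?_), mul_zero]
      have := (mem_hat_iff.1 hy).smul hC one_ne_zero hy0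
      rwa [one_smul] at this)
  rw [aeval_fibreScale] at h2
  exact (mul_eq_zero.1 h2).resolve_left ht

end

variable {n d : ℕ}

theorem veronese_eq (v : Fin (n + 1) → K) (m : Mon n d) :
    veronese d v m = ∏ i, v i ^ m.1 i := eval_formMonomial v m

theorem veronese_dotProduct (v : Fin (n + 1) → K) (F : Mon n d → K) :
    veronese d v ⬝ᵥ F = evalForm v F :=
  Finset.sum_congr rfl fun _ _ => mul_comm _ _

theorem veronese_smul (t : K) (v : Fin (n + 1) → K) :
    veronese d (t • v) = t ^ d • veronese d v := by
  ext m
  exact eval_smul_of_isHomogeneous (formMonomial_isHomogeneous m) v t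

/-- The exponent vector of `x_i ^ (d - 1) * x_j`. -/
def pairExp (hd : 1 ≤ d) (i j : Fin (n + 1)) : Mon n d :=
  ⟨Pi.single i (d - 1) + Pi.single j 1, by
    rw [Finset.mem_piAntidiag]
    refine ⟨?_, fun _ _ => Finset.mem_univ _⟩
    simp only [Pi.add_apply, Finset.sum_add_distrib]
    rw [Finset.sum_pi_single', Finset.sum_pi_single']
    simp
    omega⟩

theorem prod_pow_pairExp {R : Type*} [CommRing R] (hd : 1 ≤ d) (i j : Fin (n + 1))
    (v : Fin (n + 1) → R) : ∏ l, v l ^ (pairExp hd i j).1 l = v i ^ (d - 1) * v j := by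
  simp only [pairExp, Pi.add_apply, pow_add, Finset.prod_mul_distrib]
  congr 1
  · rw [Finset.prod_eq_single i]
    · simp
    · intro l _ hl
      simp [Pi.single_eq_of_ne hl]
    · simp
  · rw [Finset.prod_eq_single j]
    · simp
    · intro l _ hl
      simp [Pi.single_eq_of_ne hl]
    · simp

/-- The Veronese map is injective on points of projective space. -/
theorem exists_smul_of_veronese_eq_smul (hd : 1 ≤ d) {v w : Fin (n + 1) → K} (hv : v ≠ 0) {t : K}
    (ht : t ≠ 0) (h : veronese d w = t • veronese d v) : ∃ s : K, s ≠ 0 ∧ w = s • v := by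
  obtain ⟨i, hi⟩ := Function.ne_iff.1 hv
  rw [Pi.zero_apply] at hi
  have h1 : ∀ j, w i ^ (d - 1) * w j = t * (v i ^ (d - 1) * v j) := fun j => by
    have := congrFun h (pairExp hd i j)
    rwa [Pi.smul_apply, veronese_eq, veronese_eq, prod_pow_pairExp, prod_pow_pairExp] at this
  have hwi : w i ≠ 0 := by
    intro h0
    have := h1 i
    rw [h0, mul_zero] at this
    exact mul_ne_zero ht (mul_ne_zero (pow_ne_zero _ hi) hi) this.symm
  refine ⟨w i / v i, div_ne_zero hwi hi, ?_⟩
  ext j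
  rw [Pi.smul_apply, smul_eq_mul]
  have h2 := h1 i
  have h3 := h1 j
  have h4 : w i ^ (d - 1) * (w j * v i) = w i ^ (d - 1) * (w i * v j) := by
    calc _ = (w i ^ (d - 1) * w j) * v i := by ring
      _ = (w i ^ (d - 1) * w i) * v j := by rw [h3, h2]; ring
      _ = _ := by ring
  have h5 := mul_left_cancel₀ (pow_ne_zero _ hwi) h4
  field_simp
  exact h5

variable {C : Set (Cotangent K (Fin (n + 1)))}

theorem mem_conormalLift {z : ℙ K (Mon n d → K) × ℙ K (Mon n d → K)} :
    z ∈ conormalLift d C ↔ ∃ (v : Fin (n + 1) → K) (F : Mon n d → K) (hv : v ≠ 0) (hF : F ≠ 0),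
      z = (Projectivization.mk K (veronese d v) (veronese_ne_zero d hv),
        Projectivization.mk K F hF) ∧ evalForm v F = 0 ∧ InCone C v (gradForm v F) := by
  constructor
  · rintro ⟨w, η, hw, hη, h, rfl, v, hv, F, hF, heq, hC⟩
    obtain ⟨t, ht, ht'⟩ := Quotient.exact heq
    change veronese d v = (t : K) • w at ht
    change F = ((t⁻¹ : Kˣ) : K) • η at ht'
    have hF0 : F ≠ 0 := by
      rw [ht']
      exact smul_ne_zero (t⁻¹).ne_zero hη
    refine ⟨v, F, hv, hF0, ?_, ?_, hv, veronese_pullback d hF, hC⟩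
    · refine Prod.ext ?_ ?_
      · refine (Projectivization.mk_eq_mk_iff K _ _ hw _).2 ⟨t⁻¹, ?_⟩
        rw [ht, Units.smul_def, smul_smul, ← Units.val_mul]
        simp
      · refine (Projectivization.mk_eq_mk_iff K _ _ hη hF0).2 ⟨t, ?_⟩
        rw [ht', Units.smul_def, smul_smul, ← Units.val_mul]
        simp
    · rw [← veronese_dotProduct, hF]
  · rintro ⟨v, F, hv, hF, rfl, h0, hv', h1, hm⟩
    have h2 : veronese d v ⬝ᵥ F = 0 := by rw [veronese_dotProduct, h0]
    exact ⟨veronese d v, F, veronese_ne_zero d hv, hF, h2, rfl, v, hv, F, h2, rfl, hm⟩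

/-- For conical `C`, membership in the lift does not depend on the choice of representatives. -/
theorem mk_mem_conormalLift (hd : 1 ≤ d) (hC : IsConical C) {v : Fin (n + 1) → K}
    {F : Mon n d → K} (hv : v ≠ 0) (hF : F ≠ 0) :
    ((Projectivization.mk K (veronese d v) (veronese_ne_zero d hv), Projectivization.mk K F hF) :
      ℙ K (Mon n d → K) × ℙ K (Mon n d → K)) ∈ conormalLift d C ↔
      evalForm v F = 0 ∧ InCone C v (gradForm v F) := by
  rw [mem_conormalLift]
  constructor
  · rintro ⟨w, G, hw, hG, heq, h0, h1⟩
    obtain ⟨t, ht⟩ := (Projectivization.mk_eq_mk_iff K _ _ _ _).1 (congrArg Prod.fst heq)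
    obtain ⟨s, hs⟩ := (Projectivization.mk_eq_mk_iff K _ _ _ _).1 (congrArg Prod.snd heq)
    obtain ⟨r, hr, rfl⟩ := exists_smul_of_veronese_eq_smul hd hw t.ne_zero ht.symm
    have hs' : F = (s : K) • G := hs.symm
    rw [hs', evalForm_smul, evalForm_smul_left, h0, gradForm_smul, gradForm_smul_left, smul_smul]
    exact ⟨by simp, h1.smul hC hr (mul_ne_zero s.ne_zero (pow_ne_zero _ hr))⟩
  · rintro ⟨h0, h1⟩
    exact ⟨v, F, hv, hF, rfl, h0, h1⟩

end Cones

/-! ### Points of the lift of maximal transcendence degree -/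

section Dimension

open MvPolynomial CoordSpace

variable {k : Type v} {K : Type u} [Field k] [Field K] [Algebra k K] {n d : ℕ}

theorem projChart_mem_mk {σ : Type} (a : σ) {v : σ → K} (hv : v ≠ 0) :
    Projectivization.mk K v hv ∈ (projChart k a).U ↔ v a ≠ 0 := by
  have := (projChart k a).mem_iff ⟨v, hv⟩
  rw [show (projChart k a).q = X a from rfl, aeval_X] at this
  exact this

theorem projChart_ρ_mk {σ : Type} (a : σ) {v : σ → K} (hv : v ≠ 0) (ha : v a ≠ 0) :
    (projChart k a).ρ (Projectivization.mk K v hv) = (v a)⁻¹ • v := by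
  ext j
  have := (projChart k a).ρ_mul ⟨v, hv⟩ ((projChart_mem_mk a hv).2 ha) j
  rw [show (projChart k a).q = X a from rfl, show (projChart k a).a j = X j from rfl, aeval_X,
    aeval_X] at this
  change (projChart k a).ρ (Projectivization.mk K v hv) j * v a = v j at this
  rw [Pi.smul_apply, smul_eq_mul, ← this]
  field_simp

/-- The chart of the product of the two projective spaces in which the monomial `x_i ^ d` of the
first factor and the `b`-th coordinate of the second factor are `1`. -/
noncomputable def liftChart (k : Type v) [Field k] [Algebra k K] (hd : 1 ≤ d) (i : Fin (n + 1))
    (b : Mon n d) : Chart k (ℙ K (Mon n d → K) × ℙ K (Mon n d → K)) :=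
  (projChart k (pairExp hd i i)).prod (projChart k b)

/-- The vector recovered from the normalized coordinates of its image under the Veronese map. -/
def vecOf {R : Type*} (hd : 1 ≤ d) (i : Fin (n + 1)) (y : Mon n d ⊕ Mon n d → R)
    (j : Fin (n + 1)) : R :=
  y (Sum.inl (pairExp hd i j))

/-- `(v, F)` is a normalized pair of a point of projective space and a form lying in the lift
of `C`. -/
structure IsLiftPair (C : Set (Cotangent K (Fin (n + 1)))) (i : Fin (n + 1)) (b : Mon n d)
    (v : Fin (n + 1) → K) (F : Mon n d → K) : Prop where
  left : v i = 1
  right : F b = 1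
  eval : evalForm v F = 0
  inCone : InCone C v (gradForm v F)

theorem vecOf_veronese (hd : 1 ≤ d) {i : Fin (n + 1)} {v : Fin (n + 1) → K} (hv : v i = 1)
    (F : Mon n d → K) : vecOf hd i (Sum.elim (veronese d v) F) = v := by
  ext j
  simp [vecOf, veronese_eq, prod_pow_pairExp, hv]

theorem exists_isLiftPair (hd : 1 ≤ d) {C : Set (Cotangent K (Fin (n + 1)))} (hC : IsConical C)
    {i : Fin (n + 1)} {b : Mon n d} {z : ℙ K (Mon n d → K) × ℙ K (Mon n d → K)}
    (hz : z ∈ conormalLift d C) (hU : z ∈ (liftChart k hd i b).U) :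
    ∃ v F, IsLiftPair C i b v F ∧ (liftChart k hd i b).ρ z = Sum.elim (veronese d v) F := by
  obtain ⟨v, F, hv, hF, rfl, h0, h1⟩ := mem_conormalLift.1 hz
  have hi : v i ^ (d - 1) * v i ≠ 0 := by
    rw [← prod_pow_pairExp hd i i, ← veronese_eq]
    exact (projChart_mem_mk _ _).1 hU.1
  have hb : F b ≠ 0 := (projChart_mem_mk _ _).1 hU.2
  have hi' := right_ne_zero_of_mul hi
  refine ⟨(v i)⁻¹ • v, (F b)⁻¹ • F, ⟨by simp [hi'], by simp [hb], ?_, ?_⟩, ?_⟩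
  · rw [evalForm_smul, evalForm_smul_left, h0]
    simp
  · rw [gradForm_smul, gradForm_smul_left, smul_smul]
    exact h1.smul hC (inv_ne_zero hi') (mul_ne_zero (inv_ne_zero hb)
      (pow_ne_zero _ (inv_ne_zero hi')))
  · change Sum.elim ((projChart k _).ρ _) ((projChart k b).ρ _) = _
    rw [projChart_ρ_mk _ _ ((projChart_mem_mk _ _).1 hU.1), projChart_ρ_mk _ _ hb]
    congr 1
    rw [veronese_smul, veronese_eq, prod_pow_pairExp, ← pow_succ, Nat.sub_add_cancel hd, inv_pow]

theorem IsLiftPair.exists_dom (hd : 1 ≤ d) {C : Set (Cotangent K (Fin (n + 1)))}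
    {i : Fin (n + 1)} {b : Mon n d} {v : Fin (n + 1) → K} {F : Mon n d → K}
    (h : IsLiftPair C i b v F) : ∃ p : Dom (ℙ K (Mon n d → K) × ℙ K (Mon n d → K)),
      coord p = Sum.elim (veronese d v) F ∧ pt p ∈ conormalLift d C ∧
      pt p ∈ (liftChart k hd i b).U ∧ (liftChart k hd i b).ρ (pt p) = Sum.elim (veronese d v) F := by
  have hv : v ≠ 0 := h.inCone.1
  have hF : F ≠ 0 := by
    rintro rfl
    exact zero_ne_one h.right
  have h1 : veronese d v (pairExp hd i i) = 1 := by
    rw [veronese_eq, prod_pow_pairExp, h.left, one_pow, one_mul]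
  refine ⟨(⟨_, veronese_ne_zero d hv⟩, ⟨F, hF⟩), rfl,
    mem_conormalLift.2 ⟨v, F, hv, hF, rfl, h.eval, h.inCone⟩, ⟨?_, ?_⟩, ?_⟩
  · refine (projChart_mem_mk _ (veronese_ne_zero d hv)).2 ?_
    rw [h1]
    exact one_ne_zero
  · refine (projChart_mem_mk _ hF).2 ?_
    rw [h.right]
    exact one_ne_zero
  · change Sum.elim ((projChart k _).ρ (Projectivization.mk K _ (veronese_ne_zero d hv)))
      ((projChart k b).ρ (Projectivization.mk K F hF)) = _
    rw [projChart_ρ_mk _ _ (by rw [h1]; exact one_ne_zero),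
      projChart_ρ_mk _ _ (by rw [h.right]; exact one_ne_zero), h1, h.right]
    simp

theorem aeval_evalForm {ι R : Type*} [Field R] [Algebra k R] (y : ι → R)
    (v : Fin (n + 1) → MvPolynomial ι k) (F : Mon n d → MvPolynomial ι k) :
    aeval y (evalForm v F) = evalForm (fun i => aeval y (v i)) (fun m => aeval y (F m)) :=
  map_evalForm (aeval y : MvPolynomial ι k →ₐ[k] R).toRingHom v F

theorem aeval_gradForm {ι R : Type*} [Field R] [Algebra k R] (y : ι → R)
    (v : Fin (n + 1) → MvPolynomial ι k) (F : Mon n d → MvPolynomial ι k) (i : Fin (n + 1)) :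
    aeval y (gradForm v F i) = gradForm (fun i => aeval y (v i)) (fun m => aeval y (F m)) i :=
  map_gradForm (aeval y : MvPolynomial ι k →ₐ[k] R).toRingHom v F i

theorem aeval_adjustForm {ι R : Type*} [Field R] [Algebra k R] (y : ι → R)
    (v ξ : Fin (n + 1) → MvPolynomial ι k) (G : Mon n d → MvPolynomial ι k)
    (a : Fin (n + 1) → MvPolynomial ι k) (m : Mon n d) :
    aeval y (adjustForm v ξ G a m) = adjustForm (fun i => aeval y (v i)) (fun i => aeval y (ξ i))
      (fun m => aeval y (G m)) (fun i => aeval y (a i)) m :=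
  map_adjustForm (aeval y : MvPolynomial ι k →ₐ[k] R).toRingHom v ξ G a m

/-- The pullback of a polynomial in `(v, ξ)` along `(v, F) ↦ (v, ∇F(v))`. -/
noncomputable def gradSubst {ι : Type*} (v : Fin (n + 1) → MvPolynomial ι k)
    (F : Mon n d → MvPolynomial ι k) (f : MvPolynomial (Fin (n + 1) ⊕ Fin (n + 1)) k) :
    MvPolynomial ι k :=
  aeval (Sum.elim v (gradForm v F)) f

theorem aeval_gradSubst {ι R : Type*} [Field R] [Algebra k R] (y : ι → R)
    (v : Fin (n + 1) → MvPolynomial ι k) (F : Mon n d → MvPolynomial ι k)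
    (f : MvPolynomial (Fin (n + 1) ⊕ Fin (n + 1)) k) :
    aeval y (gradSubst v F f) = aeval (Sum.elim (fun i => aeval y (v i))
      (gradForm (fun i => aeval y (v i)) (fun m => aeval y (F m)))) f := by
  rw [gradSubst, ← AlgHom.comp_apply, comp_aeval]
  congr 2
  ext (i | i)
  · simp
  · simp [aeval_gradForm]

theorem gradForm_mem {L : Type*} [Field L] [Algebra k L] (A : IntermediateField k L)
    {v : Fin (n + 1) → L} {F : Mon n d → L} (hv : ∀ i, v i ∈ A) (hF : ∀ m, F m ∈ A)
    (i : Fin (n + 1)) : gradForm v F i ∈ A := by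
  have := map_gradForm (A.val : A →ₐ[k] L).toRingHom (fun i => (⟨v i, hv i⟩ : A))
    (fun m => (⟨F m, hF m⟩ : A)) i
  exact this ▸ (gradForm (fun i => (⟨v i, hv i⟩ : A)) (fun m => (⟨F m, hF m⟩ : A)) i).2

theorem prod_pow_mem {L : Type*} [Field L] [Algebra k L] (A : IntermediateField k L)
    {v : Fin (n + 1) → L} (hv : ∀ i, v i ∈ A) (m : Mon n d) : ∏ i, v i ^ m.1 i ∈ A :=
  prod_mem fun i _ => pow_mem (hv i) _

theorem IsPointOf.algebraMap {σ L L' : Type*} [Field L] [Algebra k L] [Field L'] [Algebra k L']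
    [Algebra L L'] [IsScalarTower k L L'] {S : Set (σ → K)} {x : σ → L} (h : IsPointOf k S x) :
    IsPointOf k S (fun i => algebraMap L L' (x i)) := by
  intro f hf
  have := MvPolynomial.aeval_algebraMap_apply (A := L) L' x f
  rw [h f hf, map_zero] at this
  exact this

/-- The generic point of an affine space over `L`. -/
theorem algebraicIndependent_fractionRing (ι L : Type*) [Field L] :
    AlgebraicIndependent L (fun i : ι =>
      algebraMap (MvPolynomial ι L) (FractionRing (MvPolynomial ι L)) (X i)) := by
  have h := (MvPolynomial.algebraicIndependent_X ι L).map'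
    (f := Algebra.ofId _ _ |>.restrictScalars L)
    (IsFractionRing.injective (MvPolynomial ι L) (FractionRing (MvPolynomial ι L)))
  exact h

variable [IsAlgClosed K]

/-- Every point `(v, ξ)` of the cone over an extension field lifts to a point of the lift of `C`
whose form is as generic as the conditions `F(v) = 0`, `∇F(v) = ξ` permit. -/
theorem exists_lift_point (hn : 1 ≤ n) (hd : 3 ≤ d) {C : Set (Cotangent K (Fin (n + 1)))}
    (hcl : ZClosed k C) (hC : IsConical C) {L : Type v} [Field L] [Algebra k L]
    {v ξ : Fin (n + 1) → L} (hp : IsPointOf k (hat C) (Sum.elim v ξ)) {i : Fin (n + 1)}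
    (hi : v i = 1) :
    ∃ (b : Mon n d) (L' : Type v) (_ : Field L') (_ : Algebra k L')
      (x : Mon n d ⊕ Mon n d → L'),
      td k (Set.range v ∪ Set.range ξ) + (Fintype.card (Mon n d) : ℕ) ≤
        td k (Set.range x) + (n + 2 : ℕ) ∧
      ∀ y : Mon n d ⊕ Mon n d → K, (∀ f : MvPolynomial (Mon n d ⊕ Mon n d) k,
        aeval x f = 0 → aeval y f = 0) →
        ∃ w F, IsLiftPair C i b w F ∧ y = Sum.elim (veronese d w) F := by
  classical
  have hinf : Infinite K := IsAlgClosed.instInfinite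
  have hd1 : 1 ≤ d := by omega
  obtain ⟨J, hJ, hJ0⟩ := exists_support_powForm_single.{v} (n := n) (d := d) i
  -- a coefficient that is not affected by the correction term of `adjustForm`
  obtain ⟨b, hb⟩ : ∃ b, b ∉ J := by
    by_contra hcon
    push Not at hcon
    have h1 := two_mul_le_card_mon hn hd
    rw [← Finset.card_univ, ← Finset.eq_univ_iff_forall.2 hcon] at h1
    omega
  let L' := FractionRing (MvPolynomial (Mon n d) L)
  let G : Mon n d → L' := fun m => algebraMap (MvPolynomial (Mon n d) L) L' (X m)
  have hG : AlgebraicIndependent L G := algebraicIndependent_fractionRing _ _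
  let v' : Fin (n + 1) → L' := fun j => algebraMap L L' (v j)
  let ξ' : Fin (n + 1) → L' := fun j => algebraMap L L' (ξ j)
  have hi' : v' i = 1 := by simp [v', hi]
  have hp' : IsPointOf k (hat C) (Sum.elim v' ξ') := by
    have := hp.algebraMap (L' := L')
    convert this using 1
    ext (j | j) <;> rfl
  have h0 : v' ⬝ᵥ ξ' = 0 := hp'.dotProduct_eq_zero
  let F := adjustForm v' ξ' G (Pi.single i 1)
  have ha : (Pi.single i 1 : Fin (n + 1) → L') ⬝ᵥ v' = 1 := by
    rw [single_dotProduct, hi', one_mul]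
  have hFG : ∀ m ∉ J, F m = G m := by
    intro m hm
    simp only [F, adjustForm, Pi.add_apply, Pi.smul_apply, ha, hJ0 L' _ m hm]
    simp
  have hFe : evalForm v' F = 0 := evalForm_adjustForm hd1 h0 _ _
  have hFg : gradForm v' F = ξ' := by
    rw [gradForm_adjustForm (by omega) h0, ha, one_pow, one_smul]
  have hFb : F b ≠ 0 := by
    rw [hFG b hb]
    exact hG.ne_zero b
  let x : Mon n d ⊕ Mon n d → L' := Sum.elim (fun m => ∏ l, v' l ^ m.1 l) ((F b)⁻¹ • F)
  have hxv : vecOf hd1 i x = v' := by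
    ext j
    simp [vecOf, x, prod_pow_pairExp, hi']
  refine ⟨b, L', inferInstance, inferInstance, x, ?_, ?_⟩
  · have h1 := td_union_of_algebraicIndependent (k := k) (Set.range v ∪ Set.range ξ) hG
    rw [ENat.card_eq_coe_fintype_card] at h1
    refine h1.trans ?_
    let B : Set L' := insert (F b) (G '' J)
    have hxA : ∀ j, x j ∈ algClo k (Set.range x ∪ B) := fun j =>
      subset_algClo _ (Or.inl ⟨j, rfl⟩)
    have hvA : ∀ j, v' j ∈ algClo k (Set.range x ∪ B) := fun j => by
      rw [← hxv]
      exact hxA (Sum.inl (pairExp hd1 i j))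
    have hFA : ∀ m, F m ∈ algClo k (Set.range x ∪ B) := fun m => by
      have h2 := mul_mem (subset_algClo (k := k) (Set.range x ∪ B) (Or.inr (Or.inl rfl)))
        (hxA (Sum.inr m))
      have h3 : F b * x (Sum.inr m) = F m := mul_inv_cancel_left₀ hFb _
      rwa [h3] at h2
    have h2 : algebraMap L L' '' (Set.range v ∪ Set.range ξ) ∪ Set.range G ⊆
        algClo k (Set.range x ∪ B) := by
      rintro _ (⟨_, (⟨j, rfl⟩ | ⟨j, rfl⟩), rfl⟩ | ⟨m, rfl⟩)
      · exact hvA j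
      · have := gradForm_mem _ hvA hFA j
        rwa [hFg] at this
      · by_cases hm : m ∈ J
        · exact subset_algClo _ (Or.inr (Or.inr ⟨m, hm, rfl⟩))
        · have := hFA m
          rwa [hFG m hm] at this
    refine (td_le_of_subset_algClo h2).trans ((td_union_le_encard _ _).trans ?_)
    gcongr
    refine (Set.encard_insert_le _ _).trans ?_
    have h3 : (G '' (J : Set (Mon n d))).encard ≤ (n + 1 : ℕ) := by
      refine (Set.encard_image_le _ _).trans ?_
      rw [Set.encard_coe_eq_coe_finsetCard]
      exact_mod_cast hJ
    calc _ ≤ ((n + 1 : ℕ) : ℕ∞) + 1 := by gcongr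
      _ = _ := by norm_cast
  · intro y hy
    have key : ∀ f g : MvPolynomial (Mon n d ⊕ Mon n d) k, aeval x f = aeval x g →
        aeval y f = aeval y g := by
      intro f g h
      have := hy (f - g) (by rw [map_sub, h, sub_self])
      rwa [map_sub, sub_eq_zero] at this
    have hyi : vecOf hd1 i y i = 1 := by
      have := key (X (Sum.inl (pairExp hd1 i i))) 1 (by
        rw [aeval_X, map_one]
        exact (congrFun hxv i).trans hi')
      rwa [aeval_X, map_one] at this
    have hye : evalForm (vecOf hd1 i y) (fun m => y (Sum.inr m)) = 0 := by
      have := hy (evalForm (fun j => X (Sum.inl (pairExp hd1 i j))) (fun m => X (Sum.inr m))) (by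
        rw [aeval_evalForm]
        simp only [aeval_X]
        change evalForm (vecOf hd1 i x) ((F b)⁻¹ • F) = 0
        rw [hxv, evalForm_smul, hFe, mul_zero])
      rw [aeval_evalForm] at this
      simpa only [aeval_X] using! this
    refine ⟨vecOf hd1 i y, fun m => y (Sum.inr m), ⟨hyi, ?_, hye, ?_⟩, ?_⟩
    · have := key (X (Sum.inr b)) 1 (by
        rw [aeval_X, map_one]
        exact inv_mul_cancel₀ hFb)
      rwa [aeval_X, map_one] at this
    · refine hcl.inCone ?_ (by rw [dotProduct_gradForm, hye, mul_zero]) ?_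
      · intro h
        rw [h] at hyi
        exact zero_ne_one hyi
      · intro f hf
        have := hy (gradSubst (fun j => X (Sum.inl (pairExp hd1 i j))) (fun m => X (Sum.inr m)) f)
          (by
            rw [aeval_gradSubst]
            simp only [aeval_X]
            change aeval (Sum.elim (vecOf hd1 i x) (gradForm (vecOf hd1 i x) ((F b)⁻¹ • F))) f = 0
            rw [hxv, gradForm_smul, hFg]
            exact hp'.smul hC (inv_ne_zero hFb) f hf)
        rw [aeval_gradSubst] at this
        simpa only [aeval_X] using! this
    · ext (m | m)
      · have := key (X (Sum.inl m)) (∏ l, X (Sum.inl (pairExp hd1 i l)) ^ m.1 l) (by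
          simp only [map_prod, map_pow, aeval_X]
          change ∏ l, v' l ^ m.1 l = ∏ l, vecOf hd1 i x l ^ m.1 l
          rw [hxv])
        simp only [map_prod, map_pow, aeval_X] at this
        rw [this, Sum.elim_inl, veronese_eq]
        rfl
      · rfl

end Dimension

/-! ### The dimension count for pairs of points -/

section Incidence

open MvPolynomial CoordSpace

variable {k : Type v} {K : Type u} [Field k] [Field K] [Algebra k K] {n d : ℕ}

/-- The number `c` bounds the transcendence degrees of the normalized points of the cone over
extension fields of `k`; for closed conical `C` the least such `c` is the dimension of `C`. -/
def IsTdBound (k : Type v) [Field k] [Algebra k K] (C : Set (Cotangent K (Fin (n + 1))))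
    (c : ℕ∞) : Prop :=
  ∀ (L : Type v) [Field L] [Algebra k L] (v ξ : Fin (n + 1) → L) (i : Fin (n + 1)), v i = 1 →
    IsPointOf k (hat C) (Sum.elim v ξ) → td k (Set.range v ∪ Set.range ξ) ≤ c

instance finite_idx_cotangent {σ : Type} [Fintype σ] : Finite (Idx (Cotangent K σ)) :=
  inferInstanceAs (Finite (σ ⊕ σ))

instance finite_idx_projectivization {σ : Type} [Finite σ] : Finite (Idx (ℙ K (σ → K))) :=
  inferInstanceAs (Finite σ)

instance finite_idx_prod {X : Type w} {Y : Type*} [CoordSpace K X] [CoordSpace K Y]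
    [Finite (Idx X)] [Finite (Idx Y)] : Finite (Idx (X × Y)) :=
  inferInstanceAs (Finite (Idx X ⊕ Idx Y))

theorem range_sumElim {α β γ : Type*} (f : α → γ) (g : β → γ) :
    Set.range (Sum.elim f g) = Set.range f ∪ Set.range g := Set.Sum.elim_range f g

theorem isTdBound_zdim [IsAlgClosed K] {C : Set (Cotangent K (Fin (n + 1)))} (hC : ZClosed k C)
    {N : ℕ} (hN : zdim k C ≤ (N : WithBot ℕ∞)) : IsTdBound k C N := by
  intro L _ _ v ξ i hi hp
  have h := (td_le_zdim (K := K) (cotangentChart k i) (S := C) (Sum.elim v ξ) ?_).trans hN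
  · rw [range_sumElim] at h
    exact_mod_cast h
  · intro y hy
    have hyi : y (Sum.inl i) = 1 := by
      have := hy (X (Sum.inl i) - 1) (by simp [hi])
      simpa [sub_eq_zero] using! this
    have hyd : (fun j => y (Sum.inl j)) ⬝ᵥ (fun j => y (Sum.inr j)) = 0 := by
      have := hy (∑ j, X (Sum.inl j) * X (Sum.inr j)) (by
        have := hp.dotProduct_eq_zero
        simpa [dotProduct] using! this)
      simpa [dotProduct] using! this
    have hye : y = Sum.elim (fun j => y (Sum.inl j)) (fun j => y (Sum.inr j)) := by
      ext (j | j) <;> rfl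
    have hy0 : (fun j => y (Sum.inl j)) ≠ 0 := fun h => by
      have := congrFun h i
      simp only [hyi, Pi.zero_apply, one_ne_zero] at this
    have hq : aeval y (cotangentChart (K := K) k i).q = 1 := by
      rw [show (cotangentChart (K := K) k i).q = X (Sum.inl i) from rfl]
      rw [show (aeval y) (X (Sum.inl i) : MvPolynomial (Fin (n + 1) ⊕ Fin (n + 1)) k) = _ from
        aeval_X _ _, hyi]
    let p : Dom (Cotangent K (Fin (n + 1))) :=
      ⟨(fun j => y (Sum.inl j), fun j => y (Sum.inr j)), hy0, hyd⟩
    have hpy : coord p = y := hye.symm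
    have hU : pt p ∈ (cotangentChart (K := K) k i).U := by
      rw [(cotangentChart (K := K) k i).mem_iff, hpy, hq]
      exact one_ne_zero
    refine ⟨p, hpy, (hC.inCone hy0 hyd ?_).2.2, hU, ?_⟩
    · rw [← hye]
      exact fun f hf => hy f (hp f hf)
    · ext j
      have := (cotangentChart (K := K) k i).ρ_mul p hU j
      rw [hpy, hq, mul_one] at this
      rw [this]
      rcases j with j | j
      · change aeval y (X (Sum.inl j) : MvPolynomial (Fin (n + 1) ⊕ Fin (n + 1)) k) = _
        rw [aeval_X]
      · change aeval y (X (Sum.inl i) ^ 2 * X (Sum.inr j) :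
          MvPolynomial (Fin (n + 1) ⊕ Fin (n + 1)) k) = _
        rw [map_mul, map_pow, aeval_X, aeval_X, hyi, one_pow, one_mul]

theorem td_range_le_card {L : Type*} [Field L] [Algebra k L] {σ : Type*} [Fintype σ] (x : σ → L) :
    td k (Set.range x) ≤ (Fintype.card σ : ℕ) := by
  refine ((AlgebraicIndependent.matroid k L).eRk_le_encard _).trans ?_
  rw [← Set.image_univ]
  refine (Set.encard_image_le _ _).trans ?_
  rw [Set.encard_univ, ENat.card_eq_coe_fintype_card]

/-- The least bound for the transcendence degrees of points of a nonempty cone is attained. -/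
theorem exists_maximal_td {C : Set (Cotangent K (Fin (n + 1)))} (hC : IsConical C)
    (hne : C.Nonempty) : ∃ (L : Type v) (_ : Field L) (_ : Algebra k L) (v ξ : Fin (n + 1) → L)
      (i : Fin (n + 1)), v i = 1 ∧ IsPointOf k (hat C) (Sum.elim v ξ) ∧
      IsTdBound k C (td k (Set.range v ∪ Set.range ξ)) := by
  let A : Set ℕ := {c | ∃ (L : Type v) (_ : Field L) (_ : Algebra k L) (v ξ : Fin (n + 1) → L)
      (i : Fin (n + 1)), v i = 1 ∧ IsPointOf k (hat C) (Sum.elim v ξ) ∧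
      td k (Set.range v ∪ Set.range ξ) = c}
  have hbd : ∀ (L : Type v) [Field L] [Algebra k L] (v ξ : Fin (n + 1) → L),
      td k (Set.range v ∪ Set.range ξ) ≤ (Fintype.card (Fin (n + 1) ⊕ Fin (n + 1)) : ℕ) := by
    intro L _ _ v ξ
    rw [← range_sumElim]
    exact td_range_le_card _
  have hlift : ∀ (L : Type v) [Field L] [Algebra k L] (v ξ : Fin (n + 1) → L),
      ∃ c : ℕ, td k (Set.range v ∪ Set.range ξ) = c := fun L _ _ v ξ =>
    ⟨_, (ENat.natCast_toNat (ne_top_of_le_ne_top (ENat.natCast_ne_top _) (hbd L v ξ))).symm⟩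
  have hA : A.Nonempty := by
    obtain ⟨x, hx⟩ := hne
    obtain ⟨v, ξ, hv, h, rfl⟩ := exists_cotangent_rep x
    obtain ⟨i, hi⟩ := Function.ne_iff.1 hv
    rw [Pi.zero_apply] at hi
    have h1 : InCone C ((v i)⁻¹ • v) ((1 : K) • ξ) :=
      InCone.smul hC ⟨hv, h, hx⟩ (inv_ne_zero hi) one_ne_zero
    have hirr : PolyIrreducible k {Sum.elim ((v i)⁻¹ • v) ((1 : K) • ξ)} := by
      refine ⟨Set.singleton_nonempty _, ?_⟩
      rintro f g ⟨_, rfl, hf⟩ ⟨_, rfl, hg⟩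
      exact ⟨_, rfl, hf, hg⟩
    obtain ⟨L, _, _, x, hx⟩ := hirr.exists_isGenericOf
    obtain ⟨c, hc⟩ := hlift L (fun j => x (Sum.inl j)) (fun j => x (Sum.inr j))
    refine ⟨c, L, inferInstance, inferInstance, _, _, i, ?_, ?_, hc⟩
    · have := hx.isPointOf (X (Sum.inl i) - 1) (by
        rintro _ rfl
        simp [hi])
      simpa [sub_eq_zero] using! this
    · have hxe : Sum.elim (fun j => x (Sum.inl j)) (fun j => x (Sum.inr j)) = x := by
        ext (j | j) <;> rfl
      rw [hxe]
      exact hx.isPointOf.mono (by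
        rintro _ rfl
        exact inCone_iff_mem_hat.1 h1)
  have hAb : BddAbove A := by
    refine ⟨Fintype.card (Fin (n + 1) ⊕ Fin (n + 1)), ?_⟩
    rintro c ⟨L, _, _, v, ξ, i, -, -, hc⟩
    have := hbd L v ξ
    rw [hc] at this
    exact_mod_cast this
  obtain ⟨L, _, _, v, ξ, i, hi, hp, hc⟩ := Nat.sSup_mem hA hAb
  refine ⟨L, inferInstance, inferInstance, v, ξ, i, hi, hp, ?_⟩
  intro L' _ _ v' ξ' i' hi' hp'
  obtain ⟨c', hc'⟩ := hlift L' v' ξ'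
  rw [hc, hc']
  exact_mod_cast le_csSup hAb ⟨L', inferInstance, inferInstance, v', ξ', i', hi', hp', hc'⟩

/-- Normalized triples of two points of projective space and a form that lies in the lifts of
`C₁` and of `C₂` at these two distinct points, as vectors of normalized coordinates. -/
def incidenceCoords (C₁ C₂ : Set (Cotangent K (Fin (n + 1)))) (i j : Fin (n + 1)) (b : Mon n d) :
    Set ((Mon n d ⊕ Mon n d) ⊕ (Mon n d ⊕ Mon n d) → K) :=
  {p | ∃ v w F, IsLiftPair C₁ i b v F ∧ IsLiftPair C₂ j b w F ∧
    (∃ α β, v α * w β - v β * w α ≠ 0) ∧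
    p = Sum.elim (Sum.elim (veronese d v) F) (Sum.elim (veronese d w) F)}

/-- The data of an incident pair, and the relations between them, carry over from the `K`-points of
`S` to its generic point. -/
theorem exists_incidence_point (hd1 : 1 ≤ d) {C₁ C₂ : Set (Cotangent K (Fin (n + 1)))}
    {i j : Fin (n + 1)} {b : Mon n d}
    {S : Set ((Mon n d ⊕ Mon n d) ⊕ (Mon n d ⊕ Mon n d) → K)} (hne : S.Nonempty)
    (hS : S ⊆ incidenceCoords C₁ C₂ i j b) {L : Type*} [Field L] [Algebra k L]
    {x : (Mon n d ⊕ Mon n d) ⊕ (Mon n d ⊕ Mon n d) → L} (hx : IsGenericOf k S x) :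
    ∃ (v w : Fin (n + 1) → L) (F : Mon n d → L), v i = 1 ∧ w j = 1 ∧ F b = 1 ∧
      evalForm v F = 0 ∧ evalForm w F = 0 ∧
      IsPointOf k (hat C₁) (Sum.elim v (gradForm v F)) ∧
      IsPointOf k (hat C₂) (Sum.elim w (gradForm w F)) ∧
      (∃ α β, v α * w β - v β * w α ≠ 0) ∧
      Set.range x ⊆ algClo k (Set.range v ∪ Set.range w ∪ Set.range F) := by
  have key : ∀ f g : MvPolynomial ((Mon n d ⊕ Mon n d) ⊕ (Mon n d ⊕ Mon n d)) k,
      (∀ p ∈ S, aeval p f = aeval p g) → aeval x f = aeval x g := by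
    intro f g h
    have := hx.isPointOf (f - g) (fun p hp => by rw [map_sub, h p hp, sub_self])
    rwa [map_sub, sub_eq_zero] at this
  -- polynomials giving the two vectors and the form in terms of the coordinates
  obtain ⟨V, hV0⟩ : ∃ V : Fin (n + 1) →
      MvPolynomial ((Mon n d ⊕ Mon n d) ⊕ (Mon n d ⊕ Mon n d)) k,
      ∀ l, V l = X (Sum.inl (Sum.inl (pairExp hd1 i l))) := ⟨_, fun _ => rfl⟩
  obtain ⟨W, hW0⟩ : ∃ W : Fin (n + 1) →
      MvPolynomial ((Mon n d ⊕ Mon n d) ⊕ (Mon n d ⊕ Mon n d)) k,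
      ∀ l, W l = X (Sum.inr (Sum.inl (pairExp hd1 j l))) := ⟨_, fun _ => rfl⟩
  obtain ⟨Φ, hΦ0⟩ : ∃ Φ : Mon n d → MvPolynomial ((Mon n d ⊕ Mon n d) ⊕ (Mon n d ⊕ Mon n d)) k,
      ∀ m, Φ m = X (Sum.inl (Sum.inr m)) := ⟨_, fun _ => rfl⟩
  obtain ⟨v, hV⟩ : ∃ v, v = fun l => aeval x (V l) := ⟨_, rfl⟩
  obtain ⟨w, hW⟩ : ∃ w, w = fun l => aeval x (W l) := ⟨_, rfl⟩
  obtain ⟨F, hΦ⟩ : ∃ F, F = fun l => aeval x (Φ l) := ⟨_, rfl⟩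
  have hSV : ∀ p ∈ S, ∃ v w F, IsLiftPair C₁ i b v F ∧ IsLiftPair C₂ j b w F ∧
      (∃ α β, v α * w β - v β * w α ≠ 0) ∧
      p = Sum.elim (Sum.elim (veronese d v) F) (Sum.elim (veronese d w) F) ∧
      (fun l => aeval p (V l)) = v ∧ (fun l => aeval p (W l)) = w ∧
      (fun l => aeval p (Φ l)) = F := by
    intro p hp
    obtain ⟨v, w, F, h1, h2, h3, rfl⟩ := hS hp
    refine ⟨v, w, F, h1, h2, h3, rfl, ?_, ?_, ?_⟩
    · refine Eq.trans (funext fun l => ?_) (vecOf_veronese hd1 h1.left F)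
      rw [hV0, aeval_X]
      rfl
    · refine Eq.trans (funext fun l => ?_) (vecOf_veronese hd1 h2.left F)
      rw [hW0, aeval_X]
      rfl
    · funext l
      rw [hΦ0, aeval_X]
      rfl
  have hvx : ∀ m, x (Sum.inl (Sum.inl m)) = ∏ l, v l ^ m.1 l := by
    intro m
    have := key (X (Sum.inl (Sum.inl m))) (∏ l, V l ^ m.1 l) (fun p hp => by
      obtain ⟨v, w, F, -, -, -, hp, h, -⟩ := hSV p hp
      rw [aeval_X, map_prod, congrFun hp]
      simp only [map_pow, Sum.elim_inl, veronese_eq, ← h])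
    rw [aeval_X, map_prod] at this
    simp only [this, hV, map_pow]
  have hwx : ∀ m, x (Sum.inr (Sum.inl m)) = ∏ l, w l ^ m.1 l := by
    intro m
    have := key (X (Sum.inr (Sum.inl m))) (∏ l, W l ^ m.1 l) (fun p hp => by
      obtain ⟨v, w, F, -, -, -, hp, -, h, -⟩ := hSV p hp
      rw [aeval_X, map_prod, congrFun hp]
      simp only [map_pow, Sum.elim_inl, Sum.elim_inr, veronese_eq, ← h])
    rw [aeval_X, map_prod] at this
    simp only [this, hW, map_pow]
  have hFx : ∀ m, x (Sum.inr (Sum.inr m)) = F m := by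
    intro m
    have := key (X (Sum.inr (Sum.inr m))) (Φ m) (fun p hp => by
      obtain ⟨v, w, F, -, -, -, hp, -, -, h⟩ := hSV p hp
      rw [aeval_X, congrFun hp, congrFun h]
      rfl)
    rw [aeval_X] at this
    rw [this, hΦ]
  refine ⟨v, w, F, ?_, ?_, ?_, ?_, ?_, ?_, ?_, ?_, ?_⟩
  · rw [hV]
    refine (key (V i) 1 fun p hp => ?_).trans (map_one _)
    obtain ⟨v, w, F, h1, -, -, -, h, -⟩ := hSV p hp
    rw [map_one, ← h1.left, ← h]
  · rw [hW]
    refine (key (W j) 1 fun p hp => ?_).trans (map_one _)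
    obtain ⟨v, w, F, -, h1, -, -, -, h, -⟩ := hSV p hp
    rw [map_one, ← h1.left, ← h]
  · rw [hΦ]
    refine (key (Φ b) 1 fun p hp => ?_).trans (map_one _)
    obtain ⟨v, w, F, h1, -, -, -, -, -, h⟩ := hSV p hp
    rw [map_one, ← h1.right, ← h]
  · rw [hV, hΦ, ← aeval_evalForm]
    refine (key _ 0 fun p hp => ?_).trans (map_zero _)
    obtain ⟨v, w, F, h1, -, -, -, h, -, h'⟩ := hSV p hp
    rw [aeval_evalForm, h, h', h1.eval, map_zero]
  · rw [hW, hΦ, ← aeval_evalForm]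
    refine (key _ 0 fun p hp => ?_).trans (map_zero _)
    obtain ⟨v, w, F, -, h1, -, -, -, h, h'⟩ := hSV p hp
    rw [aeval_evalForm, h, h', h1.eval, map_zero]
  · intro f hf
    rw [hV, hΦ, ← aeval_gradSubst]
    refine (key _ 0 fun p hp => ?_).trans (map_zero _)
    obtain ⟨v, w, F, h1, -, -, -, h, -, h'⟩ := hSV p hp
    rw [aeval_gradSubst, h, h', hf _ (inCone_iff_mem_hat.1 h1.inCone), map_zero]
  · intro f hf
    rw [hW, hΦ, ← aeval_gradSubst]
    refine (key _ 0 fun p hp => ?_).trans (map_zero _)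
    obtain ⟨v, w, F, -, h1, -, -, -, h, h'⟩ := hSV p hp
    rw [aeval_gradSubst, h, h', hf _ (inCone_iff_mem_hat.1 h1.inCone), map_zero]
  · by_contra hcon
    push Not at hcon
    obtain ⟨p, hp⟩ := hne
    obtain ⟨v', w', F', -, -, ⟨α, β, h3⟩, -, hv, hw, -⟩ := hSV p hp
    refine h3 ?_
    have h4 := hcon α β
    rw [hV, hW] at h4
    have h5 : aeval x (V α * W β - V β * W α) = 0 := by
      rw [map_sub, map_mul, map_mul]
      exact h4
    have h6 := (hx _).1 h5 p hp
    rw [map_sub, map_mul, map_mul] at h6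
    rw [← hv, ← hw]
    exact h6
  · have hvA : ∀ l, v l ∈ algClo k (Set.range v ∪ Set.range w ∪ Set.range F) := fun l =>
      subset_algClo _ (Or.inl (Or.inl ⟨l, rfl⟩))
    have hwA : ∀ l, w l ∈ algClo k (Set.range v ∪ Set.range w ∪ Set.range F) := fun l =>
      subset_algClo _ (Or.inl (Or.inr ⟨l, rfl⟩))
    have hFA : ∀ l, F l ∈ algClo k (Set.range v ∪ Set.range w ∪ Set.range F) := fun l =>
      subset_algClo _ (Or.inr ⟨l, rfl⟩)
    rintro _ ⟨(m | m) | (m | m), rfl⟩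
    · rw [hvx]
      exact prod_pow_mem _ hvA m
    · have : x (Sum.inl (Sum.inr m)) = F m := by
        rw [hΦ]
        simp only [hΦ0, aeval_X]
      rw [this]
      exact hFA m
    · rw [hwx]
      exact prod_pow_mem _ hwA m
    · rw [hFx]
      exact hFA m

/-- The dimension count: a form that is tangent in the prescribed way at two distinct points
satisfies `2 (n + 1)` independent conditions. -/
theorem td_incidence_le [Infinite K] (hd : 3 ≤ d) {C₁ C₂ : Set (Cotangent K (Fin (n + 1)))}
    (hC₁ : IsConical C₁) (hC₂ : IsConical C₂) {c₁ c₂ : ℕ∞} (hc₁ : IsTdBound k C₁ c₁)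
    (hc₂ : IsTdBound k C₂ c₂) {i j : Fin (n + 1)} {b : Mon n d}
    {S : Set ((Mon n d ⊕ Mon n d) ⊕ (Mon n d ⊕ Mon n d) → K)} (hne : S.Nonempty)
    (hS : S ⊆ incidenceCoords C₁ C₂ i j b) {L : Type v} [Field L] [Algebra k L]
    {x : (Mon n d ⊕ Mon n d) ⊕ (Mon n d ⊕ Mon n d) → L} (hx : IsGenericOf k S x) :
    td k (Set.range x) + (2 * (n + 1) + 1 : ℕ) ≤ c₁ + c₂ + (Fintype.card (Mon n d) : ℕ) := by
  obtain ⟨v, w, F, hvi, hwj, hFb, hve, hwe, hvp, hwp, ⟨α, β, hαβ⟩, hxA⟩ :=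
    exists_incidence_point (by omega) hne hS hx
  -- the form is only determined up to a scalar, so that it may be multiplied by a variable `t`
  let L' := FractionRing (MvPolynomial Unit L)
  let t : L' := algebraMap (MvPolynomial Unit L) L' (X ())
  have ht : AlgebraicIndependent L (fun _ : Unit => t) := algebraicIndependent_fractionRing _ _
  have ht0 : t ≠ 0 := ht.ne_zero ()
  let φ := algebraMap L L'
  obtain ⟨v', hv'⟩ : ∃ v' : Fin (n + 1) → L', v' = fun l => φ (v l) := ⟨_, rfl⟩
  obtain ⟨w', hw'⟩ : ∃ w' : Fin (n + 1) → L', w' = fun l => φ (w l) := ⟨_, rfl⟩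
  obtain ⟨F', hF'⟩ : ∃ F' : Mon n d → L', F' = fun l => φ (F l) := ⟨_, rfl⟩
  have hvg : gradForm v' F' = fun l => φ (gradForm v F l) := by
    rw [hv', hF']
    exact funext fun l => (map_gradForm φ v F l).symm
  have hwg : gradForm w' F' = fun l => φ (gradForm w F l) := by
    rw [hw', hF']
    exact funext fun l => (map_gradForm φ w F l).symm
  have hve' : evalForm v' (t • F') = 0 := by
    rw [evalForm_smul, hv', hF', ← map_evalForm, hve, map_zero, mul_zero]
  have hwe' : evalForm w' (t • F') = 0 := by
    rw [evalForm_smul, hw', hF', ← map_evalForm, hwe, map_zero, mul_zero]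
  have hαβ' : v' α * w' β - v' β * w' α ≠ 0 := by
    rw [hv', hw', ← map_mul, ← map_mul, ← map_sub]
    exact (map_ne_zero φ).2 hαβ
  have hpt : ∀ (C : Set (Cotangent K (Fin (n + 1)))) (hC : IsConical C) (a b : Fin (n + 1) → L)
      (hp : IsPointOf k (hat C) (Sum.elim a b)),
      IsPointOf k (hat C) (Sum.elim (fun l => φ (a l)) (t • fun l => φ (b l))) := by
    intro C hC a b hp
    refine IsPointOf.smul hC ?_ ht0
    have := hp.algebraMap (L' := L')
    convert this using 1
    ext (l | l) <;> rfl
  have h3 : td k (Set.range v' ∪ Set.range (gradForm v' (t • F'))) ≤ c₁ := by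
    refine hc₁ L' v' _ i (by simp only [hv', hvi, map_one]) ?_
    rw [gradForm_smul, hvg, hv']
    exact hpt C₁ hC₁ _ _ hvp
  have h4 : td k (Set.range w' ∪ Set.range (gradForm w' (t • F'))) ≤ c₂ := by
    refine hc₂ L' w' _ j (by simp only [hw', hwj, map_one]) ?_
    rw [gradForm_smul, hwg, hw']
    exact hpt C₂ hC₂ _ _ hwp
  have h1 := td_union_of_algebraicIndependent (k := k)
    (Set.range v ∪ Set.range w ∪ Set.range F) ht
  rw [ENat.card_eq_coe_fintype_card, Fintype.card_unit] at h1
  have h2 : td k (φ '' (Set.range v ∪ Set.range w ∪ Set.range F) ∪ Set.range fun _ : Unit => t) ≤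
      td k (Set.range v' ∪ Set.range w' ∪ Set.range (t • F')) := by
    refine td_le_of_subset_algClo ?_
    have htF : ∀ m, t * F' m ∈ algClo k (Set.range v' ∪ Set.range w' ∪ Set.range (t • F')) :=
      fun m => subset_algClo _ (Or.inr ⟨m, rfl⟩)
    have htA : t ∈ algClo k (Set.range v' ∪ Set.range w' ∪ Set.range (t • F')) := by
      have := htF b
      have hFb' : F' b = 1 := by simp only [hF', hFb, map_one]
      rwa [hFb', mul_one] at this
    rintro _ (⟨_, ((⟨l, rfl⟩ | ⟨l, rfl⟩) | ⟨m, rfl⟩), rfl⟩ | ⟨_, rfl⟩)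
    · exact subset_algClo _ (Or.inl (Or.inl ⟨l, by rw [hv']⟩))
    · exact subset_algClo _ (Or.inl (Or.inr ⟨l, by rw [hw']⟩))
    · have := mul_mem (inv_mem htA) (htF m)
      rw [inv_mul_cancel_left₀ ht0] at this
      have hFm : F' m = φ (F m) := by rw [hF']
      rwa [hFm] at this
    · exact htA
  calc td k (Set.range x) + (2 * (n + 1) + 1 : ℕ)
      ≤ td k (Set.range v ∪ Set.range w ∪ Set.range F) + (1 : ℕ) + (2 * (n + 1) : ℕ) := by
        push_cast
        rw [add_assoc _ (1 : ℕ∞), add_comm (1 : ℕ∞)]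
        gcongr
        exact td_le_of_subset_algClo hxA
    _ ≤ td k (Set.range v' ∪ Set.range w' ∪ Set.range (t • F')) + (2 * (n + 1) : ℕ) := by
        gcongr
        exact h1.trans h2
    _ ≤ _ := (td_twoPoint_le hd hαβ' hve' hwe').trans (by gcongr)

end Incidence

/-! ### Smallness -/

section Smallness

open MvPolynomial CoordSpace

theorem surjective_pt_prod {K : Type u} {X : Type w} [CoordSpace K X] {Y : Type*} [CoordSpace K Y]
    (hX : Function.Surjective (pt : Dom X → X)) (hY : Function.Surjective (pt : Dom Y → Y)) :
    Function.Surjective (pt : Dom (X × Y) → X × Y) := by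
  rintro ⟨x, y⟩
  obtain ⟨p, rfl⟩ := hX x
  obtain ⟨q, rfl⟩ := hY y
  exact ⟨(p, q), rfl⟩

variable {k : Type v} {K : Type u} [Field k] [Field K] [Algebra k K] {n d : ℕ}

section

variable {X : Type w} [CoordSpace K X] {Y : Type*} [CoordSpace K Y]

theorem ZOpen.fst_preimage {U : Set X} (hU : ZOpen k U) :
    ZOpen k (Prod.fst ⁻¹' U : Set (X × Y)) := by
  rw [zopen_iff]
  rintro p hp
  obtain ⟨f, hf, hfU⟩ := hU.exists_poly (p := p.1) hp
  have key : ∀ q : Dom (X × Y), aeval (coord q) (rename Sum.inl f : MvPolynomial (Idx (X × Y)) k) =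
      aeval (coord q.1) f := by
    intro q
    rw [aeval_rename]
    rfl
  exact ⟨rename Sum.inl f, by rwa [key], fun q hq => hfU q.1 (by rwa [key] at hq)⟩

theorem ZOpen.snd_preimage {U : Set Y} (hU : ZOpen k U) :
    ZOpen k (Prod.snd ⁻¹' U : Set (X × Y)) := by
  rw [zopen_iff]
  rintro p hp
  obtain ⟨f, hf, hfU⟩ := hU.exists_poly (p := p.2) hp
  have key : ∀ q : Dom (X × Y), aeval (coord q) (rename Sum.inr f : MvPolynomial (Idx (X × Y)) k) =
      aeval (coord q.2) f := by
    intro q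
    rw [aeval_rename]
    rfl
  exact ⟨rename Sum.inr f, by rwa [key], fun q hq => hfU q.2 (by rwa [key] at hq)⟩

theorem ZOpen.compl {Z : Set X} (hZ : ZOpen k Z) : ZClosed k Zᶜ :=
  (@isClosed_compl_iff X (zariski k) Z).2 hZ

theorem ZClosed.fst_preimage {Z : Set X} (hZ : ZClosed k Z) :
    ZClosed k (Prod.fst ⁻¹' Z : Set (X × Y)) := by
  have := (hZ.compl.fst_preimage (Y := Y)).compl
  rwa [Set.preimage_compl, compl_compl] at this

theorem zclosed_sUnion {𝓕 : Set (Set X)} (hfin : 𝓕.Finite) (h : ∀ T ∈ 𝓕, ZClosed k T) :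
    ZClosed k (⋃₀ 𝓕) := by
  let _ : TopologicalSpace X := zariski k
  rw [Set.sUnion_eq_biUnion]
  exact hfin.isClosed_biUnion h

end

theorem surjective_pt_projectivization {σ : Type} :
    Function.Surjective (pt : Dom (ℙ K (σ → K)) → ℙ K (σ → K)) := fun x =>
  ⟨⟨x.rep, x.rep_nonzero⟩, x.mk_rep⟩

theorem surjective_pt_cotangent {σ : Type} [Fintype σ] :
    Function.Surjective (pt : Dom (Cotangent K σ) → Cotangent K σ) := Quotient.exists_rep

/-- Pairs of distinct points of the lifts of `C₁` and `C₂` with the same image in the dual space. -/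
def incidence (d : ℕ) (C₁ C₂ : Set (Cotangent K (Fin (n + 1)))) :
    Set ((ℙ K (Mon n d → K) × ℙ K (Mon n d → K)) × (ℙ K (Mon n d → K) × ℙ K (Mon n d → K))) :=
  {p | p.1 ∈ conormalLift d C₁ ∧ p.2 ∈ conormalLift d C₂ ∧ p.1.2 = p.2.2 ∧ p.1 ≠ p.2}

variable {C C₁ C₂ : Set (Cotangent K (Fin (n + 1)))}

theorem exists_mem_liftChart (k : Type v) [Field k] [Algebra k K] (hd : 1 ≤ d)
    {z : ℙ K (Mon n d → K) × ℙ K (Mon n d → K)} (hz : z ∈ conormalLift d C) :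
    ∃ i b, z ∈ (liftChart k hd i b).U := by
  obtain ⟨v, F, hv, hF, rfl, -⟩ := mem_conormalLift.1 hz
  obtain ⟨i, hi⟩ := Function.ne_iff.1 hv
  obtain ⟨b, hb⟩ := Function.ne_iff.1 hF
  refine ⟨i, b, (projChart_mem_mk _ _).2 ?_, (projChart_mem_mk _ _).2 hb⟩
  rw [veronese_eq, prod_pow_pairExp]
  exact mul_ne_zero (pow_ne_zero _ hi) hi

theorem exists_mem_incidenceChart (k : Type v) [Field k] [Algebra k K] (hd : 1 ≤ d)
    {i : Fin (n + 1)} {b : Mon n d} {p} (hp : p ∈ incidence d C₁ C₂)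
    (h1 : p.1 ∈ (liftChart k hd i b).U) :
    ∃ j, p ∈ ((liftChart k hd i b).prod (liftChart k hd j b)).U := by
  obtain ⟨j, b', h2, -⟩ := exists_mem_liftChart k hd hp.2.1
  refine ⟨j, h1, h2, ?_⟩
  have := h1.2
  rwa [hp.2.2.1] at this

theorem image_subset_incidenceCoords (hd : 1 ≤ d) (hC₁ : IsConical C₁) (hC₂ : IsConical C₂)
    (i j : Fin (n + 1)) (b : Mon n d) :
    ((liftChart k hd i b).prod (liftChart k hd j b)).ρ ''
      (incidence d C₁ C₂ ∩ ((liftChart k hd i b).prod (liftChart k hd j b)).U) ⊆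
      incidenceCoords C₁ C₂ i j b := by
  rintro _ ⟨⟨z, z'⟩, ⟨⟨hz, hz', heq, hne⟩, hU, hU'⟩, rfl⟩
  obtain ⟨v, F, hvF, hρ⟩ := exists_isLiftPair hd hC₁ hz hU
  obtain ⟨w, G, hwG, hρ'⟩ := exists_isLiftPair hd hC₂ hz' hU'
  have hF : (projChart k b).ρ z.2 = F := funext fun m => congrFun hρ (Sum.inr m)
  have hG : (projChart k b).ρ z'.2 = G := funext fun m => congrFun hρ' (Sum.inr m)
  have hFG : F = G := by
    rw [← hF, ← hG]
    exact congrArg _ heq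
  subst hFG
  refine ⟨v, w, F, hvF, hwG, ?_, ?_⟩
  · by_contra hcon
    push Not at hcon
    refine hne (Prod.ext ?_ heq)
    have hw : w = w i • v := by
      ext l
      have := hcon i l
      rw [hvF.left, one_mul, sub_eq_zero] at this
      rw [this, Pi.smul_apply, smul_eq_mul, mul_comm]
    have hwi : w i ≠ 0 := by
      intro h0
      rw [h0, zero_smul] at hw
      exact hwG.inCone.1 hw
    obtain ⟨⟨p, hp0⟩, hp, hpc⟩ := (projChart k (pairExp hd i i)).exists_rep z.1 hU.1
    obtain ⟨⟨q, hq0⟩, hq, hqc⟩ := (projChart k (pairExp hd j j)).exists_rep z'.1 hU'.1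
    change z.1 = z'.1
    rw [← hp, ← hq]
    refine (Projectivization.mk_eq_mk_iff' K _ _ _ _).2 ⟨(w i ^ d)⁻¹, ?_⟩
    have h1 : p = veronese d v := by
      refine Eq.trans hpc (funext fun m => congrFun hρ (Sum.inl m))
    have h2 : q = veronese d w := by
      refine Eq.trans hqc (funext fun m => congrFun hρ' (Sum.inl m))
    change (w i ^ d)⁻¹ • q = p
    rw [h1, h2]
    conv_lhs => rw [hw, veronese_smul]
    rw [smul_smul]
    simp [hwi, hvF.left]
  · change Sum.elim ((liftChart k hd i b).ρ z) ((liftChart k hd j b).ρ z') = _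
    rw [hρ, hρ']

variable [IsAlgClosed K]

/-- The lift of `C₁` has a point over an extension field whose transcendence degree exceeds that
of every generic point of pairs of distinct points with the same image. -/
theorem exists_dominating_point (hn : 1 ≤ n) (hd : 3 ≤ d) (hcl₁ : ZClosed k C₁)
    (hC₁ : IsConical C₁) (hdim₁ : zdim k C₁ ≤ (n : WithBot ℕ∞)) (hne : C₁.Nonempty)
    (hcl₂ : ZClosed k C₂) (hC₂ : IsConical C₂) (hdim₂ : zdim k C₂ ≤ (n : WithBot ℕ∞)) :
    ∃ (i : Fin (n + 1)) (b : Mon n d) (L : Type v) (_ : Field L) (_ : Algebra k L)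
      (x : Mon n d ⊕ Mon n d → L),
      (∀ y : Mon n d ⊕ Mon n d → K, (∀ f : MvPolynomial (Mon n d ⊕ Mon n d) k,
        aeval x f = 0 → aeval y f = 0) →
        ∃ w F, IsLiftPair C₁ i b w F ∧ y = Sum.elim (veronese d w) F) ∧
      ∀ (i' j : Fin (n + 1)) (b' : Mon n d)
        (S : Set ((Mon n d ⊕ Mon n d) ⊕ (Mon n d ⊕ Mon n d) → K)), S.Nonempty →
        S ⊆ incidenceCoords C₁ C₂ i' j b' → ∀ (L' : Type v) [Field L'] [Algebra k L']
        (x' : (Mon n d ⊕ Mon n d) ⊕ (Mon n d ⊕ Mon n d) → L'), IsGenericOf k S x' →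
        td k (Set.range x') < td k (Set.range x) := by
  have hinf : Infinite K := IsAlgClosed.instInfinite
  obtain ⟨L, _, _, v, ξ, i, hi, hp, hbd⟩ := exists_maximal_td (k := k) hC₁ hne
  obtain ⟨b, L', _, _, x, hx, hxs⟩ := exists_lift_point hn hd hcl₁ hC₁ hp hi
  refine ⟨i, b, L', inferInstance, inferInstance, x, hxs, ?_⟩
  intro i' j b' S hS hSi L'' _ _ x' hx'
  have h1 := td_incidence_le hd hC₁ hC₂ hbd (isTdBound_zdim hcl₂ hdim₂) hS hSi hx'
  have h2 : td k (Set.range v ∪ Set.range ξ) ≤ n := isTdBound_zdim hcl₁ hdim₁ L v ξ i hi hp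
  obtain ⟨c, hc⟩ : ∃ c : ℕ, td k (Set.range v ∪ Set.range ξ) = c :=
    ⟨_, (ENat.natCast_toNat (ne_top_of_le_ne_top (ENat.natCast_ne_top _) h2)).symm⟩
  obtain ⟨t, ht⟩ : ∃ t : ℕ, td k (Set.range x) = t :=
    ⟨_, (ENat.natCast_toNat (ne_top_of_le_ne_top (ENat.natCast_ne_top _)
      (td_range_le_card x))).symm⟩
  obtain ⟨s, hs⟩ : ∃ s : ℕ, td k (Set.range x') = s :=
    ⟨_, (ENat.natCast_toNat (ne_top_of_le_ne_top (ENat.natCast_ne_top _)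
      (td_range_le_card x'))).symm⟩
  rw [hc, ht] at hx
  rw [hc, hs] at h1
  rw [hs, ht]
  norm_cast at hx h1 ⊢
  omega

/-- The dimension of the pairs of distinct points of the two lifts with the same image is smaller
than that of the first lift. -/
theorem zdim_incidence_lt (hn : 1 ≤ n) (hd : 3 ≤ d) (hcl₁ : ZClosed k C₁)
    (hC₁ : IsConical C₁) (hdim₁ : zdim k C₁ ≤ (n : WithBot ℕ∞)) (hne : C₁.Nonempty)
    (hcl₂ : ZClosed k C₂) (hC₂ : IsConical C₂) (hdim₂ : zdim k C₂ ≤ (n : WithBot ℕ∞)) :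
    zdim k (incidence d C₁ C₂) < zdim k (conormalLift d C₁) := by
  have hd1 : 1 ≤ d := by omega
  obtain ⟨i, b, L, _, _, x, hx, hlt⟩ :=
    exists_dominating_point hn hd hcl₁ hC₁ hdim₁ hne hcl₂ hC₂ hdim₂
  obtain ⟨t, ht⟩ : ∃ t : ℕ, td k (Set.range x) = t :=
    ⟨_, (ENat.natCast_toNat (ne_top_of_le_ne_top (ENat.natCast_ne_top _)
      (td_range_le_card x))).symm⟩
  have h1 : (td k (Set.range x) : WithBot ℕ∞) ≤ zdim k (conormalLift d C₁) := by
    refine td_le_zdim (K := K) (X := ℙ K (Mon n d → K) × ℙ K (Mon n d → K))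
      (liftChart k hd1 i b) (S := conormalLift d C₁) x ?_
    intro y hy
    obtain ⟨w, F, hwF, rfl⟩ := hx y hy
    exact hwF.exists_dom hd1
  rw [ht] at h1
  refine lt_of_lt_of_le ?_ h1
  refine zdim_lt_of_charts
    (fun a : Fin (n + 1) × Fin (n + 1) × Mon n d =>
      (liftChart k hd1 a.1 a.2.2).prod (liftChart k hd1 a.2.1 a.2.2)) ?_ ?_
  · intro p hp
    obtain ⟨i', b', h⟩ := exists_mem_liftChart k hd1 hp.1
    obtain ⟨j, hj⟩ := exists_mem_incidenceChart k hd1 hp h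
    exact ⟨(i', j, b'), hj⟩
  · rintro ⟨i', j, b'⟩ T hT - hTne L' _ _ x' hx'
    rw [← ht]
    refine hlt i' j b' _ (hTne.image _) ?_ L' x' hx'
    refine (Set.image_mono (Set.inter_subset_inter_left _ hT)).trans ?_
    exact image_subset_incidenceCoords hd1 hC₁ hC₂ i' j b'

/-- A general point of the first lift does not have the same image as any other point of the
second lift. -/
theorem not_conormalLift_subset (hn : 1 ≤ n) (hd : 3 ≤ d) (hcl₁ : ZClosed k C₁)
    (hC₁ : IsConical C₁) (hdim₁ : zdim k C₁ ≤ (n : WithBot ℕ∞)) (hne : C₁.Nonempty)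
    (hirr : ZIrreducible k (conormalLift d C₁))
    (hcl₂ : ZClosed k C₂) (hC₂ : IsConical C₂) (hdim₂ : zdim k C₂ ≤ (n : WithBot ℕ∞)) :
    ¬ conormalLift d C₁ ⊆ zclosure k (Prod.fst '' incidence d C₁ C₂) := by
  intro hsub
  have hd1 : 1 ≤ d := by omega
  obtain ⟨i, b, L, _, _, x, hx, hlt⟩ :=
    exists_dominating_point hn hd hcl₁ hC₁ hdim₁ hne hcl₂ hC₂ hdim₂
  have hpt : Function.Surjective (pt : Dom (ℙ K (Mon n d → K) × ℙ K (Mon n d → K)) → _) :=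
    surjective_pt_prod surjective_pt_projectivization surjective_pt_projectivization
  obtain ⟨𝓕, hfin, h𝓕, hcov⟩ := exists_finite_irreducible_cover (k := k)
    (surjective_pt_prod hpt hpt) (incidence d C₁ C₂)
  obtain ⟨_, ⟨T, hT, rfl⟩, hZT⟩ := hirr.exists_subset
    (hfin.image fun T => zclosure k (Prod.fst '' T)) (by
      rintro _ ⟨T, -, rfl⟩
      exact zclosed_zclosure _) (hsub.trans (by
      refine ZClosed.zclosure_subset (zclosed_sUnion (hfin.image _) ?_) ?_
      · rintro _ ⟨T, -, rfl⟩
        exact zclosed_zclosure _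
      · rintro _ ⟨p, hp, rfl⟩
        rw [hcov] at hp
        obtain ⟨T, hT, hpT⟩ := hp
        exact ⟨_, ⟨T, hT, rfl⟩, subset_zclosure _ ⟨p, hpT, rfl⟩⟩))
  -- a point of the lift in the chart of the dominating point
  obtain ⟨y, -, hy⟩ := exists_specialization (k := k) (K := K) x (h := 1) (by simp)
  obtain ⟨w, F, hwF, rfl⟩ := hx y hy
  obtain ⟨q, -, hqZ, hqU, -⟩ := hwF.exists_dom (k := k) hd1
  obtain ⟨p, hpT, hpU⟩ : ∃ p ∈ T, p.1 ∈ (liftChart k hd1 i b).U := by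
    by_contra hcon
    push Not at hcon
    have : zclosure k (Prod.fst '' T) ⊆ (liftChart k hd1 i b).Uᶜ := by
      refine ZClosed.zclosure_subset (liftChart k hd1 i b).zopen_U.compl ?_
      rintro _ ⟨p, hp, rfl⟩
      exact hcon p hp
    exact this (hZT hqZ) hqU
  have hTI : T ⊆ incidence d C₁ C₂ := (h𝓕 T hT).2
  obtain ⟨j, hpj⟩ := exists_mem_incidenceChart k hd1 (hTI hpT) hpU
  let c : Chart k ((ℙ K (Mon n d → K) × ℙ K (Mon n d → K)) ×
      (ℙ K (Mon n d → K) × ℙ K (Mon n d → K))) :=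
    (liftChart k hd1 i b).prod (liftChart k hd1 j b)
  obtain ⟨L', _, _, x', hx'⟩ :=
    (c.polyIrreducible_image (h𝓕 T hT).1 ⟨p, hpT, hpj⟩).exists_isGenericOf
  have h1 := hlt i j b (c.ρ '' (T ∩ c.U)) (Set.Nonempty.image _ ⟨p, hpT, hpj⟩)
    ((Set.image_mono (Set.inter_subset_inter_left _ hTI)).trans
      (image_subset_incidenceCoords hd1 hC₁ hC₂ i j b)) L' x' hx'
  refine h1.not_ge (le_trans ?_ (td_mono (Set.range_comp_subset_range Sum.inl x')))
  refine td_le_of_specialization _ _ fun f hf => ?_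
  -- an equation of the first components of `T` holds on the whole lift, hence at `x`
  have h2 : ∀ r ∈ T ∩ c.U, aeval ((liftChart k hd1 i b).ρ r.1) f = 0 := by
    intro r hr
    have h3 := (hx' (rename Sum.inl f)).1 (by rwa [aeval_rename]) _ ⟨r, hr, rfl⟩
    rw [aeval_rename] at h3
    exact h3
  let A : Set (ℙ K (Mon n d → K) × ℙ K (Mon n d → K)) :=
    {z | z ∈ (liftChart k hd1 i b).U ∧ aeval ((liftChart k hd1 i b).ρ z) f ≠ 0}
  have hA : ZClosed k Aᶜ := ((liftChart k hd1 i b).zopen f).compl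
  have h4 : T ⊆ Prod.fst ⁻¹' Aᶜ :=
    (h𝓕 T hT).1.subset_of_open hA.fst_preimage c.zopen_U ⟨p, hpT, hpj⟩ (by
      intro r hr hrA
      exact hrA.2 (h2 r hr))
  have h5 : conormalLift d C₁ ⊆ Aᶜ := hZT.trans (hA.zclosure_subset (by
    rintro _ ⟨r, hr, rfl⟩
    exact h4 hr))
  by_contra hxf
  obtain ⟨y, hyf, hy⟩ := exists_specialization (K := K) x hxf
  obtain ⟨w, F, hwF, rfl⟩ := hx y hy
  obtain ⟨q, -, hqZ, hqU, hqρ⟩ := hwF.exists_dom (k := k) hd1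
  refine h5 hqZ ⟨hqU, ?_⟩
  rw [hqρ]
  exact hyf

end Smallness

/-! ### Irreducibility of the lift, and recovering the cone from its image -/

section Irreducibility

open MvPolynomial CoordSpace

variable {k : Type v} {K : Type u} [Field k] [Field K] [Algebra k K] {n d : ℕ}

theorem PolyIrreducible.zirreducible {X : Type w} [CoordSpace K X]
    (hpt : Function.Surjective (pt : Dom X → X)) {S : Set X} (hS : PolyIrreducible k (hat S)) :
    ZIrreducible k S := by
  rw [zirreducible_iff]
  refine ⟨?_, ?_⟩
  · obtain ⟨_, p, hp, -⟩ := hS.1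
    exact ⟨_, hp⟩
  · rintro U V hU hV ⟨x, hxS, hxU⟩ ⟨y, hyS, hyV⟩
    obtain ⟨p, rfl⟩ := hpt x
    obtain ⟨q, rfl⟩ := hpt y
    obtain ⟨f, hf, hfU⟩ := hU.exists_poly hxU
    obtain ⟨g, hg, hgV⟩ := hV.exists_poly hyV
    obtain ⟨_, ⟨r, hr, rfl⟩, hrf, hrg⟩ :=
      hS.2 f g ⟨_, ⟨p, hxS, rfl⟩, hf⟩ ⟨_, ⟨q, hyS, rfl⟩, hg⟩
    exact ⟨pt r, hr, hfU r hrf, hgV r hrg⟩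

section

variable {σ : Type} [Fintype σ]

/-- All scalings `(t v, s ξ)` of coordinates `(v, ξ)` of points of `S`. -/
def fullCone (S : Set (Cotangent K σ)) : Set (σ ⊕ σ → K) :=
  {y | ∃ (v ξ : σ → K) (t s : K), t ≠ 0 ∧ s ≠ 0 ∧ InCone S v ξ ∧ y = Sum.elim (t • v) (s • ξ)}

theorem fullCone_eq_hat {C : Set (Cotangent K σ)} (hC : IsConical C) : fullCone C = hat C := by
  ext y
  constructor
  · rintro ⟨v, ξ, t, s, ht, hs, h, rfl⟩
    exact inCone_iff_mem_hat.1 (h.smul hC ht hs)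
  · intro hy
    refine ⟨_, _, 1, 1, one_ne_zero, one_ne_zero, mem_hat_iff.1 hy, ?_⟩
    ext (i | i) <;> simp

/-- The polynomial `t * s * f(t v, s ξ)` in the variables `v`, `ξ` and `t`, `s`. -/
noncomputable def torusScale {ι : Type*} (f : MvPolynomial (ι ⊕ ι) k) :
    MvPolynomial ((ι ⊕ ι) ⊕ Bool) k :=
  X (Sum.inr true) * X (Sum.inr false) *
    aeval (Sum.elim (fun i => X (Sum.inr true) * X (Sum.inl (Sum.inl i)))
      (fun i => X (Sum.inr false) * X (Sum.inl (Sum.inr i)))) f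

theorem aeval_torusScale {ι : Type*} (f : MvPolynomial (ι ⊕ ι) k) (v ξ : ι → K) (t : Bool → K) :
    aeval (Sum.elim (Sum.elim v ξ) t) (torusScale f) =
      t true * t false * aeval (Sum.elim (t true • v) (t false • ξ)) f := by
  rw [torusScale, map_mul, map_mul, aeval_X, aeval_X, ← AlgHom.comp_apply, comp_aeval]
  congr 3
  ext (i | i) <;> simp

/-- The scalings of the points of an irreducible set form an irreducible set. -/
theorem ZIrreducible.polyIrreducible_fullCone [Infinite K] {S : Set (Cotangent K σ)}
    (hS : ZIrreducible k S) : PolyIrreducible k (fullCone S) := by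
  let A : MvPolynomial (σ ⊕ σ) k → Set (Cotangent K σ) := fun f => {x | ∃ p : Dom (Cotangent K σ),
    pt p = x ∧ ∃ t : Bool → K, aeval (Sum.elim (coord p) t) (torusScale f) ≠ 0}
  -- the condition does not depend on the representative
  have hrep : ∀ f (p : Dom (Cotangent K σ)), pt p ∈ A f →
      ∃ t : Bool → K, aeval (Sum.elim (coord p) t) (torusScale f) ≠ 0 := by
    rintro f ⟨⟨v, ξ⟩, hv, h⟩ ⟨⟨⟨w, η⟩, hw, h'⟩, heq, t, ht⟩
    obtain ⟨r, hr, hr'⟩ := Quotient.exact heq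
    change v = (r : K) • w at hr
    change ξ = ((r⁻¹ : Kˣ) : K) • η at hr'
    change aeval (Sum.elim (Sum.elim w η) t) (torusScale f) ≠ 0 at ht
    rw [aeval_torusScale] at ht
    refine ⟨fun i => if i then ((r⁻¹ : Kˣ) : K) * t true else (r : K) * t false, ?_⟩
    change aeval (Sum.elim (Sum.elim v ξ) _) (torusScale f) ≠ 0
    rw [aeval_torusScale, hr, hr']
    simp only [if_true, Bool.false_eq_true, if_false, smul_smul]
    have e₁ : ((r⁻¹ : Kˣ) : K) * t true * r = t true := by
      rw [mul_right_comm, ← Units.val_mul, inv_mul_cancel, Units.val_one, one_mul]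
    have e₂ : (r : K) * t false * ((r⁻¹ : Kˣ) : K) = t false := by
      rw [mul_right_comm, ← Units.val_mul, mul_inv_cancel, Units.val_one, one_mul]
    have e₃ : ((r⁻¹ : Kˣ) : K) * t true * (r * t false) = t true * t false := by
      rw [← mul_assoc, e₁]
    rwa [e₁, e₂, e₃]
  have hA : ∀ f, ZOpen k (A f) := by
    intro f
    rw [zopen_iff]
    intro p hp
    obtain ⟨t, ht⟩ := hrep f p hp
    obtain ⟨g, hg, hgt⟩ := exists_sweep (torusScale f) (coord p) t ht
    exact ⟨g, hg, fun q hq => ⟨q, rfl, hgt _ hq⟩⟩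
  have hmeet : ∀ f, (∃ y ∈ fullCone S, aeval y f ≠ 0) → (S ∩ A f).Nonempty := by
    rintro f ⟨_, ⟨v, ξ, t, s, ht, hs, ⟨hv, h, hm⟩, rfl⟩, hf⟩
    refine ⟨_, hm, ⟨(v, ξ), hv, h⟩, rfl, fun i => if i then t else s, ?_⟩
    change aeval (Sum.elim (Sum.elim v ξ) _) (torusScale f) ≠ 0
    rw [aeval_torusScale]
    simp only [if_true, Bool.false_eq_true, if_false]
    exact mul_ne_zero (mul_ne_zero ht hs) hf
  refine ⟨?_, fun f g hf hg => ?_⟩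
  · obtain ⟨x, hx⟩ := hS.1
    obtain ⟨v, ξ, hv, h, rfl⟩ := exists_cotangent_rep x
    exact ⟨_, v, ξ, 1, 1, one_ne_zero, one_ne_zero, ⟨hv, h, hx⟩, rfl⟩
  · obtain ⟨x, hxS, hxf, hxg⟩ := hS.2 _ _ (hA f) (hA g) (hmeet f hf) (hmeet g hg)
    obtain ⟨v, ξ, hv, h, rfl⟩ := exists_cotangent_rep x
    obtain ⟨t, htf, htg⟩ := exists_common_param (torusScale f) (torusScale g) (Sum.elim v ξ)
      (hrep f ⟨(v, ξ), hv, h⟩ hxf) (hrep g ⟨(v, ξ), hv, h⟩ hxg)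
    rw [aeval_torusScale] at htf htg
    have h0 := left_ne_zero_of_mul htf
    exact ⟨_, ⟨v, ξ, t true, t false, left_ne_zero_of_mul h0, right_ne_zero_of_mul h0,
      ⟨hv, h, hxS⟩, rfl⟩, right_ne_zero_of_mul htf, right_ne_zero_of_mul htg⟩

/-- The components of a conical set are conical. -/
theorem IsConical.of_mem_zcomponents [Infinite K] {C S : Set (Cotangent K σ)} (hC : IsConical C)
    (hS : S ∈ zcomponents k C) : IsConical S := by
  replace hS : Maximal (fun S => S ⊆ C ∧ ZIrreducible k S) S := hS
  let T : Set (Cotangent K σ) := {x | ∃ (v ξ : σ → K) (hv : v ≠ 0) (h : v ⬝ᵥ ξ = 0) (c : K),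
    c ≠ 0 ∧ Cotangent.mk v ξ hv h ∈ S ∧
      x = Cotangent.mk v (c • ξ) hv (by rw [dotProduct_smul, h, smul_zero])}
  have hST : S ⊆ T := by
    intro x hx
    obtain ⟨v, ξ, hv, h, rfl⟩ := exists_cotangent_rep x
    exact ⟨v, ξ, hv, h, 1, one_ne_zero, hx, by simp⟩
  have hTC : T ⊆ C := by
    rintro _ ⟨v, ξ, hv, h, c, hc, hx, rfl⟩
    exact hC v ξ hv h c hc (hS.prop.1 hx)
  have hT : hat T = fullCone S := by
    ext y
    constructor
    · intro hy
      obtain ⟨hy0, hyd, v, ξ, hv, h, c, hc, hx, heq⟩ := mem_hat_iff.1 hy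
      obtain ⟨t, ht, ht'⟩ := Quotient.exact heq.symm
      refine ⟨v, ξ, t, ((t⁻¹ : Kˣ) : K) * c, t.ne_zero, mul_ne_zero (t⁻¹).ne_zero hc,
        ⟨hv, h, hx⟩, ?_⟩
      ext (i | i)
      · exact congrFun ht i
      · rw [← smul_smul]
        exact congrFun ht' i
    · rintro ⟨v, ξ, t, s, ht, hs, ⟨hv, h, hx⟩, rfl⟩
      refine inCone_iff_mem_hat.1 ⟨smul_ne_zero ht hv, by simp [h], v, ξ, hv, h, t * s,
        mul_ne_zero ht hs, hx, ?_⟩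
      refine (Quotient.sound (s := cotangentSetoid K σ) ?_).symm
      refine ⟨Units.mk0 t ht, rfl, ?_⟩
      change s • ξ = ((Units.mk0 t ht)⁻¹ : Kˣ).1 • ((t * s) • ξ)
      rw [smul_smul, Units.val_inv_eq_inv_val, Units.val_mk0, inv_mul_cancel_left₀ ht]
  have hTirr : ZIrreducible k T := by
    refine PolyIrreducible.zirreducible surjective_pt_cotangent ?_
    rw [hT]
    exact hS.prop.2.polyIrreducible_fullCone
  have hTS : T ⊆ S := hS.le_of_ge ⟨hTC, hTirr⟩ hST
  intro v ξ hv h c hc hx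
  exact hTS ⟨v, ξ, hv, h, c, hc, hx, rfl⟩

end

variable {C C₁ C₂ : Set (Cotangent K (Fin (n + 1)))}

/-- An open set that meets the lift of `C` contains the points given by general `(v, ξ)` in the
cone over `C` and general parameters of `adjustForm`. -/
theorem exists_poly_of_meets {U : Set (ℙ K (Mon n d → K) × ℙ K (Mon n d → K))}
    (hU : ZOpen k U) (hne : (conormalLift d C ∩ U).Nonempty) :
    ∃ h : MvPolynomial ((Fin (n + 1) ⊕ Fin (n + 1)) ⊕ (Mon n d ⊕ Fin (n + 1))) k,
      (∃ c ∈ hat C, ∃ t, aeval (Sum.elim c t) h ≠ 0) ∧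
      ∀ v ξ G a, aeval (Sum.elim (Sum.elim v ξ) (Sum.elim G a)) h ≠ 0 → a ⬝ᵥ v ≠ 0 ∧
        ∃ (hv : v ≠ 0) (hF : adjustForm v ξ G a ≠ 0),
          (Projectivization.mk K (veronese d v) (veronese_ne_zero d hv),
            Projectivization.mk K (adjustForm v ξ G a) hF) ∈ U := by
  obtain ⟨z, hz, hzU⟩ := hne
  obtain ⟨v₀, F₀, hv₀, hF₀, rfl, h0, h1⟩ := mem_conormalLift.1 hz
  obtain ⟨f, hf, hfU⟩ := hU.exists_poly (p := (⟨_, veronese_ne_zero d hv₀⟩, ⟨F₀, hF₀⟩)) hzU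
  obtain ⟨b, hb⟩ := Function.ne_iff.1 hF₀
  obtain ⟨i, hi⟩ := Function.ne_iff.1 hv₀
  rw [Pi.zero_apply] at hb hi
  let V : Fin (n + 1) → MvPolynomial ((Fin (n + 1) ⊕ Fin (n + 1)) ⊕ (Mon n d ⊕ Fin (n + 1))) k :=
    fun j => X (Sum.inl (Sum.inl j))
  let a : Fin (n + 1) → MvPolynomial ((Fin (n + 1) ⊕ Fin (n + 1)) ⊕ (Mon n d ⊕ Fin (n + 1))) k :=
    fun j => X (Sum.inr (Sum.inr j))
  let Φ : Mon n d → MvPolynomial ((Fin (n + 1) ⊕ Fin (n + 1)) ⊕ (Mon n d ⊕ Fin (n + 1))) k :=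
    adjustForm V (fun j => X (Sum.inl (Sum.inr j))) (fun m => X (Sum.inr (Sum.inl m))) a
  have hΦ : ∀ v ξ G (a : Fin (n + 1) → K) m,
      aeval (Sum.elim (Sum.elim v ξ) (Sum.elim G a)) (Φ m) = adjustForm v ξ G a m := by
    intro v ξ G a' m
    rw [show Φ m = adjustForm _ _ _ _ m from rfl, aeval_adjustForm]
    simp only [V, a, aeval_X, Sum.elim_inl, Sum.elim_inr]
  let f' : MvPolynomial ((Fin (n + 1) ⊕ Fin (n + 1)) ⊕ (Mon n d ⊕ Fin (n + 1))) k :=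
    aeval (Sum.elim (fun m : Mon n d => ∏ j, V j ^ m.1 j) Φ) f
  have hf' : ∀ v ξ G (a : Fin (n + 1) → K),
      aeval (Sum.elim (Sum.elim v ξ) (Sum.elim G a)) f' =
        aeval (Sum.elim (veronese d v) (adjustForm v ξ G a)) f := by
    intro v ξ G a'
    rw [show f' = aeval _ f from rfl, ← AlgHom.comp_apply]
    erw [comp_aeval]
    congr 2
    ext (m | m)
    · simp [V, veronese_eq]
    · exact hΦ v ξ G a' m
  let h : MvPolynomial ((Fin (n + 1) ⊕ Fin (n + 1)) ⊕ (Mon n d ⊕ Fin (n + 1))) k :=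
    (a ⬝ᵥ V) * (Φ b * f')
  have hh : ∀ v ξ G (a : Fin (n + 1) → K), aeval (Sum.elim (Sum.elim v ξ) (Sum.elim G a)) h =
      (a ⬝ᵥ v) * (adjustForm v ξ G a b *
        aeval (Sum.elim (veronese d v) (adjustForm v ξ G a)) f) := by
    intro v ξ G a'
    rw [show h = (a ⬝ᵥ V) * (Φ b * f') from rfl, map_mul, map_mul, hΦ, hf']
    congr 1
    simp [dotProduct, a, V]
  refine ⟨h, ⟨_, inCone_iff_mem_hat.1 h1, Sum.elim F₀ (Pi.single i (v₀ i)⁻¹), ?_⟩, ?_⟩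
  · have ha : Pi.single i (v₀ i)⁻¹ ⬝ᵥ v₀ = 1 := by
      rw [single_dotProduct, inv_mul_cancel₀ hi]
    rw [hh, ha, adjustForm_self h0 ha, one_mul]
    exact mul_ne_zero hb hf
  · intro v ξ G a' hne
    rw [hh] at hne
    have h2 := left_ne_zero_of_mul hne
    have h3 := left_ne_zero_of_mul (right_ne_zero_of_mul hne)
    have h4 := right_ne_zero_of_mul (right_ne_zero_of_mul hne)
    have hv : v ≠ 0 := by
      rintro rfl
      exact h2 (dotProduct_zero _)
    have hF : adjustForm v ξ G a' ≠ 0 := fun h => h3 (by rw [h]; rfl)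
    exact ⟨h2, hv, hF, hfU (⟨_, veronese_ne_zero d hv⟩, ⟨_, hF⟩) h4⟩

theorem mk_adjustForm_mem_conormalLift (hd : 2 ≤ d) (hC : IsConical C) {v ξ : Fin (n + 1) → K}
    (h : InCone C v ξ) {G : Mon n d → K} {a : Fin (n + 1) → K} (ha : a ⬝ᵥ v ≠ 0) (hv : v ≠ 0)
    (hF : adjustForm v ξ G a ≠ 0) :
    ((Projectivization.mk K (veronese d v) (veronese_ne_zero d hv),
      Projectivization.mk K (adjustForm v ξ G a) hF) : ℙ K (Mon n d → K) × ℙ K (Mon n d → K)) ∈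
      conormalLift d C := by
  rw [mk_mem_conormalLift (by omega) hC hv hF, evalForm_adjustForm (by omega) h.2.1,
    gradForm_adjustForm hd h.2.1]
  refine ⟨rfl, ?_⟩
  have := h.smul hC one_ne_zero (pow_ne_zero d ha)
  rwa [one_smul] at this

/-- Two polynomial conditions on the cone over `C` and the parameters of `adjustForm`, each of
which can be satisfied, can be satisfied together. -/
theorem exists_common_conditions [Infinite K] (hC : IsConical C) (hirr : ZIrreducible k C)
    {h₁ h₂ : MvPolynomial ((Fin (n + 1) ⊕ Fin (n + 1)) ⊕ (Mon n d ⊕ Fin (n + 1))) k}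
    (H₁ : ∃ c ∈ hat C, ∃ t, aeval (Sum.elim c t) h₁ ≠ 0)
    (H₂ : ∃ c ∈ hat C, ∃ t, aeval (Sum.elim c t) h₂ ≠ 0) :
    ∃ (v ξ : Fin (n + 1) → K) (G : Mon n d → K) (a : Fin (n + 1) → K), InCone C v ξ ∧
      aeval (Sum.elim (Sum.elim v ξ) (Sum.elim G a)) h₁ ≠ 0 ∧
      aeval (Sum.elim (Sum.elim v ξ) (Sum.elim G a)) h₂ ≠ 0 := by
  have hP := hirr.polyIrreducible_fullCone
  rw [fullCone_eq_hat hC] at hP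
  obtain ⟨c₁, hc₁, t₁, ht₁⟩ := H₁
  obtain ⟨c₂, hc₂, t₂, ht₂⟩ := H₂
  obtain ⟨p, hp, hp₁, hp₂⟩ := hP.prod.2 h₁ h₂ ⟨Sum.elim c₁ t₁, hc₁, ht₁⟩ ⟨Sum.elim c₂ t₂, hc₂, ht₂⟩
  have hpe : p = Sum.elim (Sum.elim (fun i => p (Sum.inl (Sum.inl i)))
      (fun i => p (Sum.inl (Sum.inr i)))) (Sum.elim (fun i => p (Sum.inr (Sum.inl i)))
      (fun i => p (Sum.inr (Sum.inr i)))) := by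
    ext ((i | i) | (i | i)) <;> rfl
  rw [hpe] at hp₁ hp₂
  exact ⟨_, _, _, _, mem_hat_iff.1 hp, hp₁, hp₂⟩

variable [IsAlgClosed K]

theorem conormalLift_nonempty (hn : 1 ≤ n) (hd : 3 ≤ d) (hcl : ZClosed k C) (hC : IsConical C)
    (hne : C.Nonempty) : (conormalLift d C).Nonempty := by
  obtain ⟨L, _, _, v, ξ, i, hi, hp, -⟩ := exists_maximal_td (k := k) hC hne
  obtain ⟨b, L', _, _, x, -, hx⟩ := exists_lift_point hn hd hcl hC hp hi
  obtain ⟨y, -, hy⟩ := exists_specialization (k := k) (K := K) x (h := 1) (by simp)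
  obtain ⟨w, F, hwF, -⟩ := hx y hy
  obtain ⟨q, -, hq, -⟩ := hwF.exists_dom (k := k) (by omega)
  exact ⟨_, hq⟩

theorem zirreducible_conormalLift (hn : 1 ≤ n) (hd : 3 ≤ d) (hcl : ZClosed k C)
    (hC : IsConical C) (hirr : ZIrreducible k C) : ZIrreducible k (conormalLift d C) := by
  have hinf : Infinite K := IsAlgClosed.instInfinite
  rw [zirreducible_iff]
  refine ⟨conormalLift_nonempty hn hd hcl hC hirr.1, fun U V hU hV hZU hZV => ?_⟩
  obtain ⟨h₁, H₁, hU'⟩ := exists_poly_of_meets hU hZU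
  obtain ⟨h₂, H₂, hV'⟩ := exists_poly_of_meets hV hZV
  obtain ⟨v, ξ, G, a, hvξ, hp₁, hp₂⟩ := exists_common_conditions hC hirr H₁ H₂
  obtain ⟨ha, hv, hF, hmU⟩ := hU' v ξ G a hp₁
  obtain ⟨-, _, _, hmV⟩ := hV' v ξ G a hp₂
  exact ⟨_, mk_adjustForm_mem_conormalLift (by omega) hC hvξ ha hv hF, hmU, hmV⟩

/-- The cone can be recovered from its dual image. -/
theorem subset_of_dualImage_subset (hn : 1 ≤ n) (hd : 3 ≤ d) (hcl₁ : ZClosed k C₁)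
    (hC₁ : IsConical C₁) (hdim₁ : zdim k C₁ ≤ (n : WithBot ℕ∞)) (hirr : ZIrreducible k C₁)
    (hcl₂ : ZClosed k C₂) (hC₂ : IsConical C₂) (hdim₂ : zdim k C₂ ≤ (n : WithBot ℕ∞))
    (hsub : dualImage d C₁ ⊆ dualImage d C₂) : C₁ ⊆ C₂ := by
  have hinf : Infinite K := IsAlgClosed.instInfinite
  intro x hx
  by_contra hxC
  obtain ⟨v₀, ξ₀, hv₀, h₀, rfl⟩ := exists_cotangent_rep x
  obtain ⟨f, hf, hf₀⟩ : ∃ f : MvPolynomial (Fin (n + 1) ⊕ Fin (n + 1)) k,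
      (∀ p ∈ hat C₂, aeval p f = 0) ∧ aeval (Sum.elim v₀ ξ₀) f ≠ 0 := by
    by_contra hcon
    push Not at hcon
    exact hxC (zclosed_iff.1 hcl₂ ⟨(v₀, ξ₀), hv₀, h₀⟩ hcon)
  have hnot := not_conormalLift_subset hn hd hcl₁ hC₁ hdim₁ hirr.1
    (zirreducible_conormalLift hn hd hcl₁ hC₁ hirr) hcl₂ hC₂ hdim₂
  obtain ⟨z, hz, hzW⟩ := Set.not_subset.1 hnot
  obtain ⟨h₁, H₁, hU⟩ := exists_poly_of_meets (C := C₁)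
    (zclosed_zclosure (k := k) (Prod.fst '' incidence d C₁ C₂)).compl ⟨z, hz, hzW⟩
  obtain ⟨v, ξ, G, a, hvξ, hp₁, hp₂⟩ := exists_common_conditions hC₁ hirr H₁ (h₂ := rename Sum.inl f)
    ⟨_, inCone_iff_mem_hat.1 ⟨hv₀, h₀, hx⟩, 0, by rwa [aeval_rename]⟩
  rw [aeval_rename] at hp₂
  obtain ⟨ha, hv, hF, hmU⟩ := hU v ξ G a hp₁
  have hZ₁ := mk_adjustForm_mem_conormalLift (by omega) hC₁ hvξ ha hv hF
  obtain ⟨z', hz', heq⟩ := hsub ⟨_, hZ₁, rfl⟩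
  have hZ₂ : ((Projectivization.mk K (veronese d v) (veronese_ne_zero d hv),
      Projectivization.mk K (adjustForm v ξ G a) hF) :
      ℙ K (Mon n d → K) × ℙ K (Mon n d → K)) ∈ conormalLift d C₂ := by
    by_contra hcon
    refine hmU (subset_zclosure _ ⟨(_, z'), ⟨hZ₁, hz', heq.symm, ?_⟩, rfl⟩)
    exact fun h => hcon (Eq.mpr (congrArg (· ∈ conormalLift d C₂) h) hz')
  rw [mk_mem_conormalLift (by omega) hC₂ hv hF, gradForm_adjustForm (by omega) hvξ.2.1] at hZ₂
  have h5 := hZ₂.2.smul hC₂ one_ne_zero (inv_ne_zero (pow_ne_zero d ha))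
  rw [one_smul, smul_smul, inv_mul_cancel₀ (pow_ne_zero d ha), one_smul] at h5
  exact hp₂ (hf _ (inCone_iff_mem_hat.1 h5))

end Irreducibility

/-! ### Irreducible components -/

section Components

open MvPolynomial CoordSpace

variable {k : Type v} {K : Type u} [Field k] [Field K] [Algebra k K] {n d : ℕ}

section

variable {X : Type w} [CoordSpace K X] {Y : Type*} [CoordSpace K Y]

theorem ZIrreducible.image_snd {S : Set (X × Y)} (hS : ZIrreducible k S) :
    ZIrreducible k (Prod.snd '' S) := by
  refine ⟨hS.1.image _, ?_⟩
  rintro U V hU hV ⟨_, ⟨x, hx, rfl⟩, hxU⟩ ⟨_, ⟨y, hy, rfl⟩, hyV⟩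
  obtain ⟨z, hz, hzU, hzV⟩ := hS.2 _ _ (ZOpen.snd_preimage (X := X) hU)
    (ZOpen.snd_preimage (X := X) hV) ⟨x, hx, hxU⟩ ⟨y, hy, hyV⟩
  exact ⟨_, ⟨z, hz, rfl⟩, hzU, hzV⟩

theorem maximal_of_mem_zcomponents {S T : Set X} (hT : T ∈ zcomponents k S) :
    Maximal (fun T => T ⊆ S ∧ ZIrreducible k T) T := hT

theorem ZClosed.of_mem_zcomponents {S T : Set X} (hS : ZClosed k S) (hT : T ∈ zcomponents k S) :
    ZClosed k T := by
  replace hT := maximal_of_mem_zcomponents hT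
  have h1 : zclosure k T ⊆ T :=
    hT.le_of_ge ⟨hS.zclosure_subset hT.prop.1, hT.prop.2.zclosure⟩ (subset_zclosure T)
  rw [← h1.antisymm (subset_zclosure T)]
  exact zclosed_zclosure T

/-- A closed set has finitely many irreducible components and is their union. -/
theorem ZClosed.finite_zcomponents [Finite (Idx X)]
    (hpt : Function.Surjective (pt : Dom X → X)) {S : Set X} (hS : ZClosed k S) :
    (zcomponents k S).Finite ∧ S = ⋃₀ zcomponents k S := by
  obtain ⟨𝓕, hfin, h𝓕, hcov⟩ := exists_finite_irreducible_cover (k := k) hpt S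
  have hfin' : (zclosure k '' 𝓕).Finite := hfin.image _
  have hcl : ∀ T ∈ zclosure k '' 𝓕, ZClosed k T := by
    rintro _ ⟨T, -, rfl⟩
    exact zclosed_zclosure T
  have hirr : ∀ T ∈ zclosure k '' 𝓕, T ⊆ S ∧ ZIrreducible k T := by
    rintro _ ⟨T, hT, rfl⟩
    exact ⟨hS.zclosure_subset (h𝓕 T hT).2, (h𝓕 T hT).1.zclosure⟩
  have hcov' : S ⊆ ⋃₀ (zclosure k '' 𝓕) := by
    intro x hx
    rw [hcov] at hx
    obtain ⟨T, hT, hxT⟩ := hx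
    exact ⟨_, ⟨T, hT, rfl⟩, subset_zclosure T hxT⟩
  refine ⟨hfin'.subset fun T hT => ?_, Set.Subset.antisymm (fun x hx => ?_) ?_⟩
  · replace hT : Maximal (fun T => T ⊆ S ∧ ZIrreducible k T) T := hT
    obtain ⟨T', hT', hTT'⟩ := hT.prop.2.exists_subset hfin' hcl (hT.prop.1.trans hcov')
    rwa [hTT'.antisymm (hT.le_of_ge (hirr T' hT') hTT')]
  · obtain ⟨T, hT, hxT⟩ := hcov' hx
    obtain ⟨M, hTM, hM⟩ := hfin'.exists_le_maximal hT
    refine ⟨M, ⟨hirr M hM.prop, fun R hR hMR => ?_⟩, hTM hxT⟩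
    obtain ⟨T', hT', hRT'⟩ := hR.2.exists_subset hfin' hcl (hR.1.trans hcov')
    exact hRT'.trans (hM.le_of_ge hT' (le_trans hMR hRT'))
  · exact Set.sUnion_subset fun T hT => (maximal_of_mem_zcomponents hT).prop.1

end

variable {C : Set (Cotangent K (Fin (n + 1)))}

theorem dualImage_mono {C₁ C₂ : Set (Cotangent K (Fin (n + 1)))} (h : C₁ ⊆ C₂) :
    dualImage d C₁ ⊆ dualImage d C₂ := by
  rintro _ ⟨z, ⟨w, η, hw, hη, h0, rfl, v, hv, η', h1, heq, hm⟩, rfl⟩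
  exact ⟨_, ⟨w, η, hw, hη, h0, rfl, v, hv, η', h1, heq, h hm⟩, rfl⟩

variable [IsAlgClosed K]

/-- The projection from the lift of a closed cone to the dual projective space is a closed map,
by elimination of the point of projective space. -/
theorem zclosed_image_snd (hd : 1 ≤ d) (hcl : ZClosed k C) (hC : IsConical C)
    {N : Set (ℙ K (Mon n d → K) × ℙ K (Mon n d → K))} (hN : ZClosed k N) :
    ZClosed k (Prod.snd '' (conormalLift d C ∩ N)) := by
  let V : Fin (n + 1) → MvPolynomial (Mon n d ⊕ Fin (n + 1)) k := fun j => X (Sum.inr j)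
  let Φ : Mon n d → MvPolynomial (Mon n d ⊕ Fin (n + 1)) k := fun m => X (Sum.inl m)
  let pullN : MvPolynomial (Mon n d ⊕ Mon n d) k → MvPolynomial (Mon n d ⊕ Fin (n + 1)) k :=
    fun g => aeval (Sum.elim (fun m : Mon n d => ∏ j, V j ^ m.1 j) Φ) g
  let I : Set (MvPolynomial (Mon n d ⊕ Fin (n + 1)) k) :=
    {evalForm V Φ} ∪ (gradSubst V Φ '' {f | ∀ p ∈ hat C, aeval p f = 0} ∪
      pullN '' {g | ∀ p ∈ hat N, aeval p g = 0})
  have hpull : ∀ (F : Mon n d → K) (v : Fin (n + 1) → K) g,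
      aeval (Sum.elim F v) (pullN g) = aeval (Sum.elim (veronese d v) F) g := by
    intro F v g
    rw [show pullN g = aeval _ g from rfl, ← AlgHom.comp_apply]
    erw [comp_aeval]
    congr 2
    ext (m | m)
    · simp [V, veronese_eq]
    · simp [Φ]
  have hgrad : ∀ (F : Mon n d → K) (v : Fin (n + 1) → K) f,
      aeval (Sum.elim F v) (gradSubst V Φ f) = aeval (Sum.elim v (gradForm v F)) f := by
    intro F v f
    rw [aeval_gradSubst]
    simp only [V, Φ, aeval_X, Sum.elim_inl, Sum.elim_inr]
  have heval : ∀ (F : Mon n d → K) (v : Fin (n + 1) → K),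
      aeval (Sum.elim F v) (evalForm V Φ) = evalForm v F := by
    intro F v
    rw [aeval_evalForm]
    simp only [V, Φ, aeval_X, Sum.elim_inl, Sum.elim_inr]
  have key : ∀ (F : Mon n d → K) (v : Fin (n + 1) → K) (hF : F ≠ 0) (hv : v ≠ 0),
      (∀ f ∈ I, aeval (Sum.elim F v) f = 0) ↔
        (Projectivization.mk K (veronese d v) (veronese_ne_zero d hv),
          Projectivization.mk K F hF) ∈ conormalLift d C ∩ N := by
    intro F v hF hv
    rw [Set.mem_inter_iff, mk_mem_conormalLift hd hC hv hF]
    constructor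
    · intro h
      have h1 : evalForm v F = 0 := by
        rw [← heval]
        exact h _ (Or.inl rfl)
      refine ⟨⟨h1, hcl.inCone hv (by rw [dotProduct_gradForm, h1, mul_zero]) fun f hf => ?_⟩, ?_⟩
      · rw [← hgrad]
        exact h _ (Or.inr (Or.inl ⟨f, hf, rfl⟩))
      · refine zclosed_iff.1 hN (⟨_, veronese_ne_zero d hv⟩, ⟨F, hF⟩) fun g hg => ?_
        refine (hpull F v g).symm.trans ?_
        exact h _ (Or.inr (Or.inr ⟨g, hg, rfl⟩))
    · rintro ⟨⟨h1, h2⟩, h3⟩ f (rfl | ⟨f, hf, rfl⟩ | ⟨g, hg, rfl⟩)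
      · rw [heval, h1]
      · rw [hgrad]
        exact hf _ (inCone_iff_mem_hat.1 h2)
      · rw [hpull]
        exact hg _ ⟨(⟨_, veronese_ne_zero d hv⟩, ⟨F, hF⟩), h3, rfl⟩
  have hopen : ZOpen k (Prod.snd '' (conormalLift d C ∩ N))ᶜ := by
    rw [zopen_iff]
    rintro ⟨F, hF⟩ hp
    have hscale : ∀ (F : Mon n d → K) (v : Fin (n + 1) → K) (t : K), F ≠ 0 → t ≠ 0 → v ≠ 0 →
        (∀ f ∈ I, aeval (Sum.elim F v) f = 0) → ∀ f ∈ I, aeval (Sum.elim F (t • v)) f = 0 := by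
      intro F v t hF ht hv h
      rw [key F v hF hv] at h
      rw [key F (t • v) hF (smul_ne_zero ht hv)]
      have : Projectivization.mk K (veronese d (t • v)) (veronese_ne_zero d (smul_ne_zero ht hv)) =
          Projectivization.mk K (veronese d v) (veronese_ne_zero d hv) :=
        (Projectivization.mk_eq_mk_iff' K _ _ _ _).2 ⟨t ^ d, (veronese_smul t v).symm⟩
      rwa [this]
    have hno : ∀ v : Fin (n + 1) → K, v ≠ 0 → ∃ f ∈ I, aeval (Sum.elim F v) f ≠ 0 := by
      intro v hv
      by_contra hcon
      push Not at hcon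
      exact hp ⟨_, (key F v hF hv).1 hcon, rfl⟩
    obtain ⟨g, hg, hgI⟩ := exists_elimination (K := K) I (fun F => F ≠ 0) hscale F hno
    refine ⟨g, hg, ?_⟩
    rintro ⟨G, hG⟩ hgG ⟨z, ⟨hz, hzN⟩, hzG⟩
    obtain ⟨v, G', hv, hG', rfl, -⟩ := mem_conormalLift.1 hz
    obtain ⟨f, hf, hfv⟩ := hgI G hG hgG v hv
    refine hfv ((key G v hG hv).2 ?_ f hf)
    have : Projectivization.mk K G' hG' = Projectivization.mk K G hG := hzG
    rw [← this]
    exact ⟨hz, hzN⟩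
  have := hopen.compl
  rwa [compl_compl] at this

theorem zclosed_dualImage (hd : 1 ≤ d) (hcl : ZClosed k C) (hC : IsConical C) :
    ZClosed k (dualImage d C) := by
  have := zclosed_image_snd hd hcl hC (zclosed_univ (k := k))
  rwa [Set.inter_univ] at this

theorem isSmall_conormalLift (hn : 1 ≤ n) (hd : 3 ≤ d) (hcl : ZClosed k C) (hC : IsConical C)
    (hirr : ZIrreducible k C) (hdim : zdim k C ≤ (n : WithBot ℕ∞)) :
    IsSmall k Prod.snd (conormalLift d C) (dualImage d C) :=
  ⟨zirreducible_conormalLift hn hd hcl hC hirr, Set.mapsTo_image _ _, subset_zclosure _,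
    zdim_incidence_lt hn hd hcl hC hdim hirr.1 hcl hC hdim⟩

theorem genericallyRadicial_conormalLift (hn : 1 ≤ n) (hd : 3 ≤ d) (hcl : ZClosed k C)
    (hC : IsConical C) (hirr : ZIrreducible k C) (hdim : zdim k C ≤ (n : WithBot ℕ∞)) :
    GenericallyRadicial k Prod.snd (conormalLift d C) (dualImage d C) := by
  have hZ := zirreducible_conormalLift hn hd hcl hC hirr
  obtain ⟨z, hz, hzW⟩ := Set.not_subset.1
    (not_conormalLift_subset hn hd hcl hC hdim hirr.1 hZ hcl hC hdim)
  have hU : ZOpen k (Prod.snd ''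
      (conormalLift d C ∩ zclosure k (Prod.fst '' incidence d C C)))ᶜ :=
    (zclosed_image_snd (by omega) hcl hC (zclosed_zclosure _)).compl
  refine ⟨Set.mapsTo_image _ _, _, hU, ?_, ?_⟩
  · refine (ZIrreducible.image_snd hZ).subset_of_open (zclosed_zclosure _) hU
      ⟨z.2, ⟨z, hz, rfl⟩, ?_⟩ ?_
    · rintro ⟨z', ⟨hz', hz'W⟩, heq⟩
      refine hzW (subset_zclosure _ ⟨(z, z'), ⟨hz, hz', heq.symm, ?_⟩, rfl⟩)
      intro h
      exact hzW (by rwa [show z = z' from h])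
    · rw [Set.inter_comm]
      exact subset_zclosure _
  · rintro x ⟨hx, hxU⟩ y ⟨hy, -⟩ hxy
    by_contra hne
    exact hxU ⟨x, ⟨hx, subset_zclosure _ ⟨(x, y), ⟨hx, hy, hxy, hne⟩, rfl⟩⟩, rfl⟩

theorem bijOn_zcomponents_dualImage (hn : 1 ≤ n) (hd : 3 ≤ d) (hcl : ZClosed k C)
    (hC : IsConical C) (hdim : zdim k C ≤ (n : WithBot ℕ∞)) :
    Set.BijOn (dualImage d) (zcomponents k C) (zcomponents k (dualImage d C)) := by
  have hinf : Infinite K := IsAlgClosed.instInfinite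
  obtain ⟨hfin, hcov⟩ := hcl.finite_zcomponents surjective_pt_cotangent
  have hcl' : ∀ γ ∈ zcomponents k C, ZClosed k γ := fun γ hγ => hcl.of_mem_zcomponents hγ
  have hC' : ∀ γ ∈ zcomponents k C, IsConical γ := fun γ hγ => hC.of_mem_zcomponents hγ
  have hirr : ∀ γ ∈ zcomponents k C, ZIrreducible k γ := fun γ hγ => (maximal_of_mem_zcomponents hγ).prop.2
  have hsub : ∀ γ ∈ zcomponents k C, γ ⊆ C := fun γ hγ => (maximal_of_mem_zcomponents hγ).prop.1
  have hD : ∀ γ ∈ zcomponents k C, ZIrreducible k (dualImage d γ) := fun γ hγ =>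
    ZIrreducible.image_snd
      (zirreducible_conormalLift hn hd (hcl' γ hγ) (hC' γ hγ) (hirr γ hγ))
  have hle : ∀ γ ∈ zcomponents k C, ∀ γ' ∈ zcomponents k C, dualImage d γ ⊆ dualImage d γ' →
      γ = γ' := by
    intro γ hγ γ' hγ' h
    have h1 := subset_of_dualImage_subset hn hd (hcl' γ hγ) (hC' γ hγ)
      ((zdim_mono (hsub γ hγ)).trans hdim) (hirr γ hγ) (hcl' γ' hγ') (hC' γ' hγ')
      ((zdim_mono (hsub γ' hγ')).trans hdim) h
    exact h1.antisymm ((maximal_of_mem_zcomponents hγ).le_of_ge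
      (maximal_of_mem_zcomponents hγ').prop h1)
  have hDcov : dualImage d C ⊆ ⋃₀ (dualImage d '' zcomponents k C) := by
    rintro _ ⟨z, ⟨w, η, hw, hη, h0, rfl, v, hv, η', h1, heq, hm⟩, rfl⟩
    rw [hcov] at hm
    obtain ⟨γ, hγ, hmγ⟩ := hm
    exact ⟨_, ⟨γ, hγ, rfl⟩, _, ⟨w, η, hw, hη, h0, rfl, v, hv, η', h1, heq, hmγ⟩, rfl⟩
  have hin : ∀ S, S ⊆ dualImage d C → ZIrreducible k S →
      ∃ γ ∈ zcomponents k C, S ⊆ dualImage d γ := by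
    intro S hS hSirr
    obtain ⟨_, ⟨γ, hγ, rfl⟩, h⟩ := hSirr.exists_subset (hfin.image (dualImage d)) (by
      rintro _ ⟨γ, hγ, rfl⟩
      exact zclosed_dualImage (by omega) (hcl' γ hγ) (hC' γ hγ)) (hS.trans hDcov)
    exact ⟨γ, hγ, h⟩
  refine ⟨fun γ hγ => ⟨⟨dualImage_mono (hsub γ hγ), hD γ hγ⟩, fun S hS hγS => ?_⟩,
    fun γ hγ γ' hγ' h => hle γ hγ γ' hγ' h.subset, fun T hT => ?_⟩
  · obtain ⟨γ', hγ', hSγ'⟩ := hin S hS.1 hS.2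
    rwa [hle γ hγ γ' hγ' (le_trans hγS hSγ')]
  · replace hT := maximal_of_mem_zcomponents hT
    obtain ⟨γ, hγ, hTγ⟩ := hin T hT.prop.1 hT.prop.2
    exact ⟨γ, hγ, (hT.le_of_ge ⟨dualImage_mono (hsub γ hγ), hD γ hγ⟩ hTγ).antisymm hTγ⟩

end Components

end VeroneseRadon

theorem proposition4p5 {k : Type*} {K : Type*} [Field k] [Field K] [Algebra k K] [IsAlgClosed K]
    (n d : ℕ) (hn : 1 ≤ n) (hd : 3 ≤ d) :
    (∀ C : Set (VeroneseRadon.Cotangent K (Fin (n + 1))),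
      VeroneseRadon.ZClosed k C → VeroneseRadon.IsConical C → VeroneseRadon.ZIrreducible k C →
      VeroneseRadon.zdim k C ≤ (n : WithBot ℕ∞) →
        VeroneseRadon.IsSmall k Prod.snd (VeroneseRadon.conormalLift d C)
          (VeroneseRadon.dualImage d C) ∧
        VeroneseRadon.GenericallyRadicial k Prod.snd (VeroneseRadon.conormalLift d C)
          (VeroneseRadon.dualImage d C)) ∧
    (∀ C : Set (VeroneseRadon.Cotangent K (Fin (n + 1))),
      VeroneseRadon.ZClosed k C → VeroneseRadon.IsConical C →
      VeroneseRadon.zdim k C ≤ (n : WithBot ℕ∞) →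
        Set.BijOn (VeroneseRadon.dualImage d) (VeroneseRadon.zcomponents k C)
          (VeroneseRadon.zcomponents k (VeroneseRadon.dualImage d C))) := by
  refine ⟨fun C hcl hC hirr hdim => ⟨?_, ?_⟩, fun C hcl hC hdim => ?_⟩
  · exact VeroneseRadon.isSmall_conormalLift hn hd hcl hC hirr hdim
  · exact VeroneseRadon.genericallyRadicial_conormalLift hn hd hcl hC hirr hdim
  · exact VeroneseRadon.bijOn_zcomponents_dualImage hn hd hcl hC hdim
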